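/- Let $N\ge 1$, $\alpha\in(0,1]$, and let $f\in C^{0,\alpha}_c(\mathbb{R}^N)$ be real-valued (globally $\alpha$-Hölder continuous with compact support). For $|s|<\min\{1,\frac N2\}$ put $$\kappa_1(s)=2^{-2s}\pi^{-\frac N2}\frac{\Gamma(\frac{N-2s}{2})}{\Gamma(1+s)},\qquad \kappa_2(s)=2^{-2s}\frac{\Gamma(\frac{N-2s}{2})}{\Gamma(\frac N2)\,\Gamma(1+s)},$$ and, for $0<s<\min\{1,\frac N2\}$, let $\Phi_s(x)=s\,\kappa_1(s)\,|x|^{2s-N}$ $(x\ne0)$ be the Riesz kernel and $$(-\Delta)^s u(x)=c_{N,s}\lim_{\varepsilon\to0^+}\int_{\mathbb{R}^N\setminus B_\varepsilon(x)}\frac{u(x)-u(y)}{|x-y|^{N+2s}}\,dy,\qquad c_{N,s}=2^{2s}\pi^{-\frac N2}s\,\frac{\Gamma(\frac{N+2s}{2})}{\Gamma(1-s)}.$$ Let $\mathcal K_0u=u$ and, for $j\ge1$, $$\mathcal K_ju(x)=\int_{\mathbb{R}^N}\big(u(x)1_{B_1(x)}(y)-u(y)\big)\,|x-y|^{-N}\,(-2\ln|x-y|)^{j-1}\,dy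 .$$ For $m\ge1$ the $m$-order logarithmic Laplacian is $\mathcal L_mu=\sum_{j=0}^m\alpha_j\mathcal K_ju$, where $$\alpha_0=(-1)^m\kappa_2^{(m)}(0),\qquad \alpha_j=m(-1)^{m+j}\binom{m-1}{j-1}\kappa_1^{(m-j)}(0)\quad(1\le j\le m).$$ Then the following hold. (a) For every $s$ with $0<s<\min\{1,\frac N2\}$, the convolution $u_{s,f}=\Phi_s\ast f$ is given by an absolutely convergent integral at every point, and it is the unique continuous function $u$ on $\mathbb{R}^N$ such that $(-\Delta)^su(x)=f(x)$ for every $x\in\mathbb{R}^N$ (the integrals over $\mathbb{R}^N\setminus B_\varepsilon(x)$ converging absolutely and the limit existing) and $\lim_{|x|\to\infty}u(x)=0$. (b) For every $j\ge1$ and every $x\in\mathbb{R}^N$ the integral defining $\mathcal K_jf(x)$ converges absolutely. For every $p\in(1,\infty]$ and every $m\ge1$, $\mathcal L_mf\in L^p(\mathbb{R}^N)$. For every $p\in(1,\infty]$ and every integer $n\ge1$, $$u_{s,f}=f+\sum_{m=1}^n\frac{(-s)^m}{m!}\,\mathcal L_mf+o(s^n)\quad\text{in }L^p(\mathbb{R}^N)\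 \text{ as } s\to0^+,$$ that is, the remainder $R_s=u_{s,f}-f-\sum_{m=1}^n\frac{(-s)^m}{m!}\mathcal L_mf$ belongs to $L^p(\mathbb{R}^N)$ for all sufficiently small $s>0$, and $\|R_s\|_{L^p(\mathbb{R}^N)}/s^n\to0$ as $s\to0^+$. -/

import Mathlib

open MeasureTheory Filter Topology Metric
open scoped ENNReal NNReal

noncomputable section

namespace LogLaplacian

/-- The Euclidean space of dimension `N`. -/
abbrev Space (N : ℕ) : Type := EuclideanSpace ℝ (Fin N)

/-- The class of compactly supported functions that are globally Hölder continuous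
with exponent `α`. -/
def HolderCompact (N : ℕ) (α : ℝ≥0) (f : Space N → ℝ) : Prop :=
  (∃ C : ℝ≥0, HolderWith C α f) ∧ HasCompactSupport f

/-! ### The Riesz kernel and the Riesz potential -/

/-- The function `κ₁(s) = 2^{-2s} π^{-N/2} Γ((N-2s)/2) / Γ(1+s)`. -/
def kappaOne (N : ℕ) (s : ℝ) : ℝ :=
  (2 : ℝ) ^ (-2 * s) * Real.pi ^ (-(N : ℝ) / 2) *
    (Real.Gamma (((N : ℝ) - 2 * s) / 2) / Real.Gamma (1 + s))

/-- The function `κ₂(s) = 2^{-2s} Γ((N-2s)/2) / (Γ(N/2) Γ(1+s))`. -/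
def kappaTwo (N : ℕ) (s : ℝ) : ℝ :=
  (2 : ℝ) ^ (-2 * s) *
    (Real.Gamma (((N : ℝ) - 2 * s) / 2) / (Real.Gamma ((N : ℝ) / 2) * Real.Gamma (1 + s)))

/-- The normalising constant `κ_{N,s} = 2^{-2s} π^{-N/2} (Γ((N-2s)/2) / Γ(1+s)) s`
of the Riesz kernel. -/
def rieszConst (N : ℕ) (s : ℝ) : ℝ := kappaOne N s * s

/-- The Riesz kernel `Φ_s(x) = κ_{N,s} |x|^{2s-N}`, `x ≠ 0` (the value at the origin is
irrelevant, as the kernel is only integrated). -/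
def rieszKernel (N : ℕ) (s : ℝ) (x : Space N) : ℝ :=
  rieszConst N s * ‖x‖ ^ (2 * s - (N : ℝ))

/-- The Riesz potential `Φ_s ∗ f`. -/
def rieszPotential (N : ℕ) (s : ℝ) (f : Space N → ℝ) : Space N → ℝ :=
  convolution (rieszKernel N s) f (ContinuousLinearMap.mul ℝ ℝ) volume

/-! ### The fractional Laplacian as a singular integral -/

/-- The constant `c_{N,s} = 2^{2s} π^{-N/2} s Γ((N+2s)/2) / Γ(1-s)`. -/
def fracLapConst (N : ℕ) (s : ℝ) : ℝ :=
  (2 : ℝ) ^ (2 * s) * Real.pi ^ (-(N : ℝ) / 2) * s *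
    (Real.Gamma (((N : ℝ) + 2 * s) / 2) / Real.Gamma (1 - s))

/-- `(-Δ)^s u (x)` exists as the principal value
`c_{N,s} lim_{ε → 0⁺} ∫_{ℝᴺ ∖ B_ε(x)} (u(x) - u(y)) / |x-y|^{N+2s} dy`
and is equal to `v`. -/
def HasFracLaplacianAt (N : ℕ) (s : ℝ) (u : Space N → ℝ) (v : ℝ) (x : Space N) : Prop :=
  (∀ ε : ℝ, 0 < ε →
    IntegrableOn (fun y => (u x - u y) / ‖x - y‖ ^ ((N : ℝ) + 2 * s)) (ball x ε)ᶜ volume) ∧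
  Tendsto
    (fun ε : ℝ => fracLapConst N s *
      ∫ y in (ball x ε)ᶜ, (u x - u y) / ‖x - y‖ ^ ((N : ℝ) + 2 * s))
    (𝓝[>] 0) (𝓝 v)

/-- `u` is a (continuous, pointwise) solution of `(-Δ)^s u = f` in `ℝᴺ` with
`u(x) → 0` as `|x| → ∞`. -/
structure IsDecayingSolution (N : ℕ) (s : ℝ) (f u : Space N → ℝ) : Prop where
  continuous : Continuous u
  equation : ∀ x, HasFracLaplacianAt N s u (f x) x
  decay : Tendsto u (cocompact (Space N)) (𝓝 0)

/-! ### The logarithmic Laplacians -/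

/-- The radial profile `q_n(t) = t^{-N} (-2 ln t)^{n-1}`, for `n ≥ 1`. -/
def qProfile (N n : ℕ) (t : ℝ) : ℝ :=
  t ^ (-(N : ℝ)) * (-2 * Real.log t) ^ (n - 1)

/-- The integrand `y ↦ (u(x) 1_{B_1(x)}(y) - u(y)) q_n(|x-y|)`. -/
def zeroOrderIntegrand (N n : ℕ) (u : Space N → ℝ) (x y : Space N) : ℝ :=
  ((ball x 1).indicator (fun _ => u x) y - u y) * qProfile N n ‖x - y‖

/-- The operators `𝒦_n`: `𝒦_0 u = u`, and
`𝒦_n u (x) = ∫ (u(x) 1_{B_1(x)}(y) - u(y)) q_n(|x-y|) dy` for `n ≥ 1`. -/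
def zeroOrderOp (N n : ℕ) (u : Space N → ℝ) (x : Space N) : ℝ :=
  if n = 0 then u x else ∫ y, zeroOrderIntegrand N n u x y

/-- The coefficients of the `m`-order logarithmic Laplacian (`m ≥ 1`):
`α_0 = (-1)^m κ₂^{(m)}(0)` and
`α_j = m (-1)^{m+j} binom(m-1, j-1) κ₁^{(m-j)}(0)` for `1 ≤ j ≤ m`. -/
def logCoeff (N m j : ℕ) : ℝ :=
  if j = 0 then (-1) ^ m * iteratedDeriv m (kappaTwo N) 0
  else (m : ℝ) * (-1) ^ (m + j) * ((m - 1).choose (j - 1) : ℝ) *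
    iteratedDeriv (m - j) (kappaOne N) 0

/-- The `m`-order logarithmic Laplacian `ℒ_m u = ∑_{j=0}^m α_j 𝒦_j u`, for `m ≥ 1`. -/
def logLaplacian (N m : ℕ) (u : Space N → ℝ) (x : Space N) : ℝ :=
  ∑ j ∈ Finset.range (m + 1), logCoeff N m j * zeroOrderOp N j u x

/-- The remainder `Φ_s ∗ f - f - ∑_{m=1}^n ((-s)^m / m!) ℒ_m f`. -/
def expansionRemainder (N n : ℕ) (f : Space N → ℝ) (s : ℝ) (x : Space N) : ℝ :=
  rieszPotential N s f x - f x -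
    ∑ m ∈ Finset.Icc 1 n, (-s) ^ m / (m.factorial : ℝ) * logLaplacian N m f x

/-- `R_s = o(s^n)` in `L^p(ℝᴺ)` as `s → 0⁺`: for small `s > 0` the function `R_s` lies in
`L^p(ℝᴺ)`, and `‖R_s‖_{L^p} / s^n → 0`. -/
def IsLittleOInLp (N : ℕ) (p : ℝ≥0∞) (n : ℕ) (R : ℝ → Space N → ℝ) : Prop :=
  (∀ᶠ s in 𝓝[>] (0 : ℝ), MemLp (R s) p volume) ∧
  Tendsto (fun s : ℝ => (eLpNorm (R s) p volume).toReal / s ^ n) (𝓝[>] (0 : ℝ)) (𝓝 0)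

end LogLaplacian

end

/-! The expansion. Adding and subtracting `f x` times the kernel on the unit ball removes the
singularity of the Riesz potential as `s → 0`. The integral of `|z|^(2s-N)` over the unit ball is
the area of the sphere divided by `2s`, and this `1/s` cancels the factor `s` in the Riesz constant.
The result is the exact identity `rieszPotential_eq`: `Φ_s ∗ f = κ₂(s) f - s κ₁(s) ∫ cutDiff f x y
|x-y|^(2s-N) dy`. The exponential series of `|x-y|^(2s) = exp(2s ln|x-y|)` turns the last integral
into `∑ (-s)^k/k! 𝒦_{k+1} f` plus a remainder. Multiplying by the Taylor series of `κ₁` and `κ₂` and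
collecting powers of `s` gives precisely the coefficients `α_j` (`sum_Icc_logLaplacian`).

All errors are controlled pointwise by one estimate, `exists_integral_cutDiff_le`: Hölder continuity
handles `y` near `x`, compact support handles `y` far away, and the integral is `O((1+|x|)^(-γ))`
for each `γ < N`. An arbitrarily small power of `|x-y|` absorbs all logarithms. Hence the remainder
is at most `C s^(n+1) (1+|x|)^(-γ)`, and for `p > 1` some `γ < N` makes this weight an `L^p`
function.

The equation. Both the Riesz kernel and `c_{N,s}|y|^(-N-2s)` are superpositions of heat kernels,
with weights `t^(s-1)/Γ(s)` and `s t^(-1-s)/Γ(1-s)`. Replacing `t^(-1-s)` by `(t+τ)^(-1-s)` makes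
the second kernel integrable. For `f ≥ 0`, Tonelli and the semigroup law then show that the
regularised operator applied to `Φ_s ∗ f` averages the heat flow of `f` at times of order `τ`
(`integral_sub_mul_levyKernel`), so it tends to `f` as `τ → 0`. The regularised integrals and the
truncated ones defining `(-Δ)^s` have the same limit: after symmetrisation both are dominated,
because second differences of the potential are `O(|y|^(2s+β))` for some `β > 0`
(`exists_rieszPotential_second_difference_le`). Signed `f` follow by splitting into positive and
negative parts. Uniqueness is the maximum principle. -/

namespace LogLaplacian

/-! ### Powers of the norm -/

lemma measurable_norm_rpow (N : ℕ) (a : ℝ) : Measurable fun x : Space N => ‖x‖ ^ a :=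
  measurable_norm.pow_const a

lemma finrank_space (N : ℕ) : Module.finrank ℝ (Space N) = N := by simp

lemma integrableOn_ball_norm_rpow {N : ℕ} (hN : 1 ≤ N) {a : ℝ} (ha : -(N : ℝ) < a) (r : ℝ) :
    IntegrableOn (fun x : Space N => ‖x‖ ^ a) (ball 0 r) := by
  refine integrableOn_ball_of_norm_le_rpow (by simpa using hN) (C := 1) (α := -a)
    (by simpa using by linarith) (ae_of_all _ fun x => ?_)
    (measurable_norm_rpow N a).aestronglyMeasurable
  rw [Real.norm_of_nonneg (by positivity)]
  simp

lemma locallyIntegrable_norm_rpow {N : ℕ} (hN : 1 ≤ N) {a : ℝ} (ha : -(N : ℝ) < a) :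
    LocallyIntegrable (fun x : Space N => ‖x‖ ^ a) := by
  refine locallyIntegrable_of_norm_le_rpow (by simpa using hN) (C := 1) (α := -a)
    (by simpa using by linarith) (ae_of_all _ fun x => ?_)
    (measurable_norm_rpow N a).aestronglyMeasurable
  rw [Real.norm_of_nonneg (by positivity)]
  simp

lemma integrableOn_compl_ball_norm_rpow {N : ℕ} {a : ℝ} (ha : a < -(N : ℝ)) {r : ℝ} (hr : 0 < r) :
    IntegrableOn (fun x : Space N => ‖x‖ ^ a) (ball 0 r)ᶜ := by
  have h := (integrable_one_add_norm (E := Space N) (μ := volume) (r := -a)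
    (by simpa using by linarith)).const_mul ((1 / r + 1) ^ (-a))
  refine Integrable.mono' h.integrableOn (measurable_norm_rpow N a).aestronglyMeasurable ?_
  filter_upwards [ae_restrict_mem measurableSet_ball.compl] with x hx
  have hx : r ≤ ‖x‖ := by simpa using hx
  have hxp : 0 < ‖x‖ := hr.trans_le hx
  rw [Real.norm_of_nonneg (by positivity), neg_neg]
  have h1 : (1 + ‖x‖) / (1 / r + 1) ≤ ‖x‖ := by
    rw [div_le_iff₀ (by positivity)]
    have : 1 ≤ ‖x‖ * (1 / r) := by rw [mul_one_div, le_div_iff₀ hr]; linarith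
    linarith
  calc ‖x‖ ^ a ≤ ((1 + ‖x‖) / (1 / r + 1)) ^ a :=
        Real.rpow_le_rpow_of_nonpos (by positivity) h1 (by have := N.cast_nonneg (α := ℝ); linarith)
    _ = _ := by
        rw [Real.div_rpow (by positivity) (by positivity), Real.rpow_neg (by positivity),
          div_eq_inv_mul]

lemma volume_real_unit_ball {N : ℕ} (hN : 1 ≤ N) :
    volume.real (ball (0 : Space N) 1) =
      Real.pi ^ ((N : ℝ) / 2) / Real.Gamma ((N : ℝ) / 2 + 1) := by
  have : Nonempty (Fin N) := ⟨⟨0, hN⟩⟩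
  rw [measureReal_def, EuclideanSpace.volume_ball]
  have : 0 < Real.Gamma ((N : ℝ) / 2 + 1) := Real.Gamma_pos_of_pos (by positivity)
  simp only [ENNReal.ofReal_one, one_pow, one_mul, Fintype.card_fin]
  rw [ENNReal.toReal_ofReal (by positivity), Real.sqrt_eq_rpow, ← Real.rpow_mul_natCast Real.pi_nonneg]
  congr 2
  ring

/-- Polar coordinates: the numerator is the area of the unit sphere, `N` times the volume of the
ball. For `b = 2s` this is the source of the `1/s` that the Riesz constant compensates. -/
lemma setIntegral_unit_ball_norm_rpow {N : ℕ} (hN : 1 ≤ N) {b : ℝ} (hb : 0 < b) :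
    ∫ x in ball (0 : Space N) 1, ‖x‖ ^ (b - (N : ℝ)) =
      2 * Real.pi ^ ((N : ℝ) / 2) / Real.Gamma ((N : ℝ) / 2) / b := by
  have : Nonempty (Fin N) := ⟨⟨0, hN⟩⟩
  have e : ∫ x in ball (0 : Space N) 1, ‖x‖ ^ (b - (N : ℝ)) =
      ∫ x : Space N, (Set.Iio (1 : ℝ)).indicator (fun t => t ^ (b - (N : ℝ))) ‖x‖ := by
    rw [← integral_indicator measurableSet_ball]
    congr 1 with x
    by_cases h : ‖x‖ < 1
    · rw [Set.indicator_of_mem (by simpa using h), Set.indicator_of_mem (by simpa using h)]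
    · rw [Set.indicator_of_notMem (by simpa using h), Set.indicator_of_notMem (by simpa using h)]
  rw [e, integral_fun_norm_addHaar, finrank_space, volume_real_unit_ball hN]
  have e2 : ∫ y in Set.Ioi (0 : ℝ),
      y ^ (N - 1) • (Set.Iio (1 : ℝ)).indicator (fun t => t ^ (b - (N : ℝ))) y = 1 / b := by
    have : ∀ y ∈ Set.Ioi (0 : ℝ),
        y ^ (N - 1) • (Set.Iio (1 : ℝ)).indicator (fun t => t ^ (b - (N : ℝ))) y =
        (Set.Iio (1 : ℝ)).indicator (fun t => t ^ (b - 1)) y := by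
      intro y hy
      have hy : 0 < y := hy
      by_cases h : y < 1
      · simp only [Set.indicator_apply, Set.mem_Iio, h, if_true, smul_eq_mul]
        rw [← Real.rpow_natCast, ← Real.rpow_add hy, Nat.cast_sub hN]
        congr 1; push_cast; ring
      · simp [h]
    rw [setIntegral_congr_fun measurableSet_Ioi this, setIntegral_indicator measurableSet_Iio,
      Set.Ioi_inter_Iio, ← integral_Ioc_eq_integral_Ioo,
      ← intervalIntegral.integral_of_le zero_le_one, integral_rpow (Or.inl (by linarith))]
    rw [sub_add_cancel, Real.one_rpow, Real.zero_rpow hb.ne', sub_zero]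
  rw [e2]
  have hN' : (0 : ℝ) < N := by exact_mod_cast hN
  have hG : Real.Gamma ((N : ℝ) / 2) ≠ 0 := (Real.Gamma_pos_of_pos (by positivity)).ne'
  rw [Real.Gamma_add_one (by positivity)]
  simp only [nsmul_eq_mul, smul_eq_mul]
  field_simp

/-! ### The normalising constants -/

/-- The complex Gamma function is holomorphic on the right half-plane, and the real one is its real
part on the real axis. -/
lemma analyticAt_real_Gamma {x : ℝ} (hx : 0 < x) : AnalyticAt ℝ Real.Gamma x := by
  have hc : AnalyticAt ℂ Complex.Gamma (x : ℂ) := by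
    refine DifferentiableOn.analyticAt (s := {z : ℂ | 0 < z.re}) (fun z hz => ?_) ?_
    · refine (Complex.differentiableAt_Gamma z fun m h => ?_).differentiableWithinAt
      have hz : 0 < z.re := hz
      rw [h] at hz
      simp only [Complex.neg_re, Complex.natCast_re] at hz
      have := m.cast_nonneg (α := ℝ)
      linarith
    · exact (isOpen_lt continuous_const Complex.continuous_re).mem_nhds (by simpa using hx)
  exact hc.re_ofReal

lemma analyticAt_two_rpow (x : ℝ) : AnalyticAt ℝ (fun s : ℝ => (2 : ℝ) ^ (-2 * s)) x := by
  have : (fun s : ℝ => (2 : ℝ) ^ (-2 * s)) = fun s => Real.exp (Real.log 2 * (-2 * s)) := by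
    ext s; rw [Real.rpow_def_of_pos (by norm_num)]
  rw [this]
  fun_prop

lemma analyticAt_Gamma_quotient {N : ℕ} (hN : 1 ≤ N) :
    AnalyticAt ℝ (fun s : ℝ => Real.Gamma (((N : ℝ) - 2 * s) / 2)) 0 := by
  refine AnalyticAt.fun_comp (g := Real.Gamma) (f := fun s : ℝ => ((N : ℝ) - 2 * s) / 2) ?_ (by fun_prop)
  exact analyticAt_real_Gamma (by have : (0 : ℝ) < N := (by exact_mod_cast hN); simpa using this)

lemma analyticAt_Gamma_one_add : AnalyticAt ℝ (fun s : ℝ => Real.Gamma (1 + s)) 0 :=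
  AnalyticAt.fun_comp (g := Real.Gamma) (f := fun s : ℝ => 1 + s)
    (analyticAt_real_Gamma (by norm_num)) (by fun_prop)

lemma analyticAt_kappaOne {N : ℕ} (hN : 1 ≤ N) : AnalyticAt ℝ (kappaOne N) 0 :=
  ((analyticAt_two_rpow 0).mul analyticAt_const).mul
    ((analyticAt_Gamma_quotient hN).div analyticAt_Gamma_one_add (by simp))

/-- The factor is half the area of the unit sphere, which is what integrating `2 s |z|^(2s-N)` over
the unit ball yields, up to the factor 2. -/
lemma kappaTwo_eq {N : ℕ} (hN : 1 ≤ N) (s : ℝ) :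
    kappaTwo N s = kappaOne N s * (Real.pi ^ ((N : ℝ) / 2) / Real.Gamma ((N : ℝ) / 2)) := by
  have hN' : (0 : ℝ) < N := by exact_mod_cast hN
  have hG : Real.Gamma ((N : ℝ) / 2) ≠ 0 := (Real.Gamma_pos_of_pos (by positivity)).ne'
  have hp : Real.pi ^ (-(N : ℝ) / 2) = (Real.pi ^ ((N : ℝ) / 2))⁻¹ := by
    rw [← Real.rpow_neg Real.pi_nonneg]; congr 1; ring
  have : Real.pi ^ ((N : ℝ) / 2) ≠ 0 := by positivity
  rw [kappaTwo, kappaOne, hp, mul_comm (Real.Gamma ((N : ℝ) / 2)), ← div_div]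
  field_simp

lemma analyticAt_kappaTwo {N : ℕ} (hN : 1 ≤ N) : AnalyticAt ℝ (kappaTwo N) 0 := by
  have : kappaTwo N = fun s => kappaOne N s * (Real.pi ^ ((N : ℝ) / 2) / Real.Gamma ((N : ℝ) / 2)) :=
    funext (kappaTwo_eq hN)
  rw [this]
  exact (analyticAt_kappaOne hN).mul analyticAt_const

lemma kappaTwo_zero {N : ℕ} (hN : 1 ≤ N) : kappaTwo N 0 = 1 := by
  have hN' : (0 : ℝ) < N := by exact_mod_cast hN
  have hG : Real.Gamma ((N : ℝ) / 2) ≠ 0 := (Real.Gamma_pos_of_pos (by positivity)).ne'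
  simp [kappaTwo, hG]

/-- Taylor's formula at the origin for an analytic function. -/
lemma exists_taylor_bound {g : ℝ → ℝ} (hg : AnalyticAt ℝ g 0) (n : ℕ) :
    ∃ C : ℝ, 0 ≤ C ∧ ∀ᶠ s in 𝓝[>] (0 : ℝ),
      |g s - ∑ k ∈ Finset.range n, iteratedDeriv k g 0 / k.factorial * s ^ k| ≤ C * s ^ n := by
  obtain ⟨C, hC⟩ := (hg.hasFPowerSeriesAt.isBigO_sub_partialSum_pow n).bound
  refine ⟨max C 0, le_max_right _ _, ?_⟩
  filter_upwards [hC.filter_mono nhdsWithin_le_nhds, self_mem_nhdsWithin] with s hs hs0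
  have hs0 : 0 < s := hs0
  simp only [zero_add, FormalMultilinearSeries.partialSum,
    FormalMultilinearSeries.ofScalars_apply_eq, smul_eq_mul, Real.norm_eq_abs, abs_pow,
    abs_of_pos hs0] at hs
  exact hs.trans (mul_le_mul_of_nonneg_right (le_max_left _ _) (by positivity))

/-! ### Consequences of the Hölder condition -/

section Holder

variable {N : ℕ} {α : ℝ≥0} {f : Space N → ℝ}

lemma HolderCompact.continuous (hf : HolderCompact N α f) (hα : 0 < α) : Continuous f := by
  obtain ⟨⟨C, hC⟩, -⟩ := hf
  exact hC.continuous hα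

lemma HolderCompact.exists_abs_sub_le (hf : HolderCompact N α f) :
    ∃ H : ℝ, 0 ≤ H ∧ ∀ x y, |f x - f y| ≤ H * ‖x - y‖ ^ (α : ℝ) := by
  obtain ⟨⟨C, hC⟩, -⟩ := hf
  refine ⟨C, C.coe_nonneg, fun x y => ?_⟩
  have := hC.dist_le x y
  rwa [Real.dist_eq, dist_eq_norm] at this

lemma HolderCompact.exists_radius (hf : HolderCompact N α f) :
    ∃ R : ℝ, 0 ≤ R ∧ ∀ x, R < ‖x‖ → f x = 0 := by
  obtain ⟨R, hR⟩ := hf.2.isBounded.subset_closedBall 0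
  refine ⟨max R 0, le_max_right _ _, fun x hx => ?_⟩
  by_contra h
  have := hR (subset_tsupport f h)
  simp only [mem_closedBall, dist_zero_right] at this
  exact absurd hx (not_lt.2 (this.trans (le_max_left _ _)))

end Holder

/-- The cut-off difference `f(x) 1_{B_1(x)}(y) - f(y)`. -/
noncomputable def cutDiff {N : ℕ} (f : Space N → ℝ) (x y : Space N) : ℝ :=
  (ball x 1).indicator (fun _ => f x) y - f y

/-- The radial majorant `t^{-N} e^{ε |ln t|}`. -/
noncomputable def logMajorant (N : ℕ) (ε t : ℝ) : ℝ :=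
  t ^ (-(N : ℝ)) * Real.exp (ε * |Real.log t|)

lemma logMajorant_of_lt_one {N : ℕ} {ε t : ℝ} (ht : 0 < t) (h1 : t < 1) :
    logMajorant N ε t = t ^ (-(N : ℝ) - ε) := by
  rw [logMajorant, abs_of_neg (Real.log_neg ht h1), sub_eq_add_neg, Real.rpow_add ht,
    Real.rpow_def_of_pos ht (-ε)]
  congr 2
  ring

lemma logMajorant_of_one_le {N : ℕ} {ε t : ℝ} (h1 : 1 ≤ t) :
    logMajorant N ε t = t ^ (-(N : ℝ) + ε) := by
  have ht : 0 < t := by linarith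
  rw [logMajorant, abs_of_nonneg (Real.log_nonneg h1), Real.rpow_add ht,
    Real.rpow_def_of_pos ht ε, mul_comm ε]

lemma logMajorant_nonneg {N : ℕ} {ε t : ℝ} (ht : 0 ≤ t) : 0 ≤ logMajorant N ε t := by
  unfold logMajorant; positivity

lemma measurable_logMajorant (N : ℕ) (ε : ℝ) : Measurable (logMajorant N ε) := by
  unfold logMajorant; fun_prop

/-- Kernels take conventional values at `t = 0`; since the difference vanishes on the diagonal,
bounds on kernels are only ever needed for `t > 0`. -/
lemma cutDiff_self {N : ℕ} (f : Space N → ℝ) (x : Space N) : cutDiff f x x = 0 := by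
  simp [cutDiff]

lemma cutDiff_of_lt {N : ℕ} (f : Space N → ℝ) {x y : Space N} (h : ‖x - y‖ < 1) :
    cutDiff f x y = f x - f y := by
  have : y ∈ ball x 1 := by rwa [mem_ball, dist_comm, dist_eq_norm]
  simp only [cutDiff, Set.indicator_of_mem this]

lemma cutDiff_of_le {N : ℕ} (f : Space N → ℝ) {x y : Space N} (h : 1 ≤ ‖x - y‖) :
    cutDiff f x y = - f y := by
  have : y ∉ ball x 1 := by rwa [mem_ball, dist_comm, dist_eq_norm, not_lt]
  simp only [cutDiff, Set.indicator_of_notMem this, zero_sub]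

lemma measurable_cutDiff {N : ℕ} {f : Space N → ℝ} (hf : Measurable f) :
    Measurable fun p : Space N × Space N => cutDiff f p.1 p.2 := by
  have : (fun p : Space N × Space N => cutDiff f p.1 p.2) =
      fun p => {p : Space N × Space N | dist p.2 p.1 < 1}.indicator (fun p => f p.1) p - f p.2 := by
    ext p
    rw [cutDiff]
    by_cases h : dist p.2 p.1 < 1
    · rw [Set.indicator_of_mem (by simpa using h),
        Set.indicator_of_mem (a := p) (s := {p : Space N × Space N | dist p.2 p.1 < 1}) h]
    · rw [Set.indicator_of_notMem (by simpa using h),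
        Set.indicator_of_notMem (a := p) (s := {p : Space N × Space N | dist p.2 p.1 < 1}) h]
  rw [this]
  refine Measurable.sub (Measurable.indicator (by fun_prop) ?_) (by fun_prop)
  exact measurableSet_lt (measurable_snd.dist measurable_fst) measurable_const

lemma measurable_cutDiff_right {N : ℕ} {f : Space N → ℝ} (hf : Measurable f) (x : Space N) :
    Measurable (cutDiff f x) :=
  (measurable_const.indicator measurableSet_ball).sub hf

lemma measurable_norm_const_sub {N : ℕ} (x : Space N) : Measurable fun y : Space N => ‖x - y‖ :=
  (continuous_const.sub continuous_id).norm.measurable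

/-! ### Weighted estimates for integrals of the cut-off difference. -/

section Majorant

variable {N : ℕ} {α : ℝ≥0} {f : Space N → ℝ}

/-- A Peetre-type inequality: away from the diagonal, `1 + |x| ≤ 2 |x-y| (1 + |y|)`. It converts
decay in `x - y` into decay in `x`, at the price of a weight in `y` that is harmless on the support
of `f`. -/
lemma one_add_norm_rpow_neg_le {γ : ℝ} (hγ : 0 ≤ γ) {x y : Space N} (h : 1 ≤ ‖x - y‖) :
    ‖x - y‖ ^ (-γ) ≤ 2 ^ γ * ((1 + ‖x‖) ^ (-γ) * (1 + ‖y‖) ^ γ) := by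
  have h1 : 1 + ‖x‖ ≤ 2 * ‖x - y‖ * (1 + ‖y‖) := by
    have : ‖x‖ ≤ ‖x - y‖ + ‖y‖ := by simpa using norm_add_le (x - y) y
    nlinarith [norm_nonneg y]
  have hp : 0 < ‖x - y‖ := by linarith
  have h2 : (2 * ‖x - y‖ * (1 + ‖y‖)) ^ (-γ) ≤ (1 + ‖x‖) ^ (-γ) :=
    Real.rpow_le_rpow_of_nonpos (by positivity) h1 (by linarith)
  rw [Real.mul_rpow (by positivity) (by positivity), Real.mul_rpow (by positivity) (by positivity),
    Real.rpow_neg (by positivity : (0 : ℝ) ≤ 2), Real.rpow_neg (by positivity : 0 ≤ 1 + ‖y‖)] at h2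
  have h3 : 0 < (2 : ℝ) ^ γ := by positivity
  have h4 : 0 < (1 + ‖y‖) ^ γ := by positivity
  calc ‖x - y‖ ^ (-γ) = 2 ^ γ * ((((2 : ℝ) ^ γ)⁻¹ * ‖x - y‖ ^ (-γ) * ((1 + ‖y‖) ^ γ)⁻¹) *
        (1 + ‖y‖) ^ γ) := by field_simp
    _ ≤ _ := by gcongr

/-- For `|x-y| < 1` the Hölder bound leaves `|x-y|^(α-N-ε)`, integrable because `ε < α`, and this
part is present only for `x` near the support. For `|x-y| ≥ 1` only `-f y` survives, and
`|x-y|^(-N+ε) ≤ |x-y|^(-γ)` because `ε ≤ N - γ`. -/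
lemma exists_integral_cutDiff_le (hN : 1 ≤ N) (hα : 0 < α) (hf : HolderCompact N α f)
    {γ ε : ℝ} (hγ : 0 ≤ γ) (hεα : ε < α) (hεγ : ε ≤ N - γ) :
    ∃ C : ℝ, 0 ≤ C ∧ ∀ x, Integrable (fun y => |cutDiff f x y| * logMajorant N ε ‖x - y‖) ∧
      ∫ y, |cutDiff f x y| * logMajorant N ε ‖x - y‖ ≤ C * (1 + ‖x‖) ^ (-γ) := by
  obtain ⟨H, hH0, hH⟩ := hf.exists_abs_sub_le
  obtain ⟨R, hR0, hR⟩ := hf.exists_radius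
  have hc := hf.continuous hα
  set I := ∫ z in ball (0 : Space N) 1, ‖z‖ ^ ((α : ℝ) - N - ε) with hI
  set J := ∫ y : Space N, |f y| * (1 + ‖y‖) ^ γ with hJ
  have hI0 : 0 ≤ I := integral_nonneg fun z => by positivity
  have hJ0 : 0 ≤ J := integral_nonneg fun z => by positivity
  have hJi : Integrable fun y : Space N => |f y| * (1 + ‖y‖) ^ γ := by
    refine Continuous.integrable_of_hasCompactSupport ?_ ?_
    · exact hc.abs.mul ((by fun_prop : Continuous fun y : Space N => 1 + ‖y‖).rpow_const
        fun y => Or.inl (by positivity))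
    · exact (hf.2.comp_left (g := fun t : ℝ => |t|) abs_zero).mul_right
  have hIi : IntegrableOn (fun z : Space N => ‖z‖ ^ ((α : ℝ) - N - ε)) (ball 0 1) :=
    integrableOn_ball_norm_rpow hN (by linarith) 1
  refine ⟨H * I * (R + 2) ^ γ + 2 ^ γ * J, by positivity, fun x => ?_⟩
  set W := (1 + ‖x‖) ^ (-γ) with hW
  have hW0 : 0 < W := by positivity
  have hg1 : Integrable fun y => H * (R + 2) ^ γ * W *
      (ball (0 : Space N) 1).indicator (fun z => ‖z‖ ^ ((α : ℝ) - N - ε)) (x - y) :=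
    (((integrable_indicator_iff measurableSet_ball).2 hIi).comp_sub_left x).const_mul _
  have hg2 : Integrable fun y => 2 ^ γ * W * (|f y| * (1 + ‖y‖) ^ γ) := hJi.const_mul _
  have hle : ∀ y, |cutDiff f x y| * logMajorant N ε ‖x - y‖ ≤
      H * (R + 2) ^ γ * W *
        (ball (0 : Space N) 1).indicator (fun z => ‖z‖ ^ ((α : ℝ) - N - ε)) (x - y) +
      2 ^ γ * W * (|f y| * (1 + ‖y‖) ^ γ) := by
    intro y
    rcases eq_or_ne x y with rfl | hxy
    · rw [cutDiff_self, abs_zero, zero_mul]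
      exact add_nonneg (mul_nonneg (by positivity) (Set.indicator_nonneg (fun z _ => by positivity) _))
        (by positivity)
    have hp : 0 < ‖x - y‖ := norm_pos_iff.2 (sub_ne_zero.2 hxy)
    rcases lt_or_ge ‖x - y‖ 1 with h | h
    · rw [cutDiff_of_lt f h, logMajorant_of_lt_one hp h,
        Set.indicator_of_mem (by simpa using h)]
      refine le_add_of_le_of_nonneg ?_ (by positivity)
      rcases le_or_gt ‖x‖ (R + 1) with hx | hx
      -- Here `x` ranges over a bounded set, so the weight is bounded below and may be inserted for
      -- free.
      · have h1 : 1 ≤ (R + 2) ^ γ * W := by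
          rw [hW, Real.rpow_neg (by positivity), ← div_eq_mul_inv, one_le_div (by positivity)]
          exact Real.rpow_le_rpow (by positivity) (by linarith) hγ
        calc |f x - f y| * ‖x - y‖ ^ (-(N : ℝ) - ε)
            ≤ H * ‖x - y‖ ^ (α : ℝ) * ‖x - y‖ ^ (-(N : ℝ) - ε) := by gcongr; exact hH x y
          _ = H * 1 * ‖x - y‖ ^ ((α : ℝ) - N - ε) := by
            rw [mul_assoc, ← Real.rpow_add hp, mul_one]; congr 2; ring
          _ ≤ H * ((R + 2) ^ γ * W) * ‖x - y‖ ^ ((α : ℝ) - N - ε) := by gcongr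
          _ = _ := by ring
      -- Here both `x` and `y` lie outside the support of `f`, so the difference vanishes.
      · have hy : R < ‖y‖ := by
          have : ‖x‖ ≤ ‖x - y‖ + ‖y‖ := by simpa using norm_add_le (x - y) y
          linarith
        rw [hR x (by linarith), hR y hy, sub_zero, abs_zero, zero_mul]
        positivity
    · rw [cutDiff_of_le f h, logMajorant_of_one_le h, abs_neg]
      refine le_add_of_nonneg_of_le
        (mul_nonneg (by positivity) (Set.indicator_nonneg (fun z _ => by positivity) _)) ?_
      have h1 : ‖x - y‖ ^ (-(N : ℝ) + ε) ≤ ‖x - y‖ ^ (-γ) :=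
        Real.rpow_le_rpow_of_exponent_le h (by linarith)
      calc |f y| * ‖x - y‖ ^ (-(N : ℝ) + ε)
          ≤ |f y| * (2 ^ γ * (W * (1 + ‖y‖) ^ γ)) := by
            gcongr; exact h1.trans (one_add_norm_rpow_neg_le hγ h)
        _ = _ := by ring
  have hnn : ∀ y, 0 ≤ |cutDiff f x y| * logMajorant N ε ‖x - y‖ := fun y =>
    mul_nonneg (abs_nonneg _) (logMajorant_nonneg (norm_nonneg _))
  have hint : Integrable (fun y => |cutDiff f x y| * logMajorant N ε ‖x - y‖) := by
    refine Integrable.mono' (hg1.add hg2) ?_ (ae_of_all _ fun y => ?_)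
    · have h1 := measurable_cutDiff_right hc.measurable x
      have h2 := (measurable_logMajorant N ε).comp (measurable_norm_const_sub x)
      exact ((measurable_norm.comp h1).mul h2).aestronglyMeasurable
    · rw [Real.norm_of_nonneg (hnn y)]; exact hle y
  refine ⟨hint, (integral_mono hint (hg1.add hg2) hle).trans_eq ?_⟩
  rw [Pi.add_def, integral_add hg1 hg2, integral_const_mul, integral_const_mul,
    integral_sub_left_eq_self
      (fun z => (ball (0 : Space N) 1).indicator (fun z => ‖z‖ ^ ((α : ℝ) - N - ε)) z) volume x,
    integral_indicator measurableSet_ball]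
  ring

/-- The exponent `ε |ln t|` is split in halves: one half dominates `2 s |ln t|` since `4 s ≤ ε`, the
other absorbs the power of the logarithm through `v^k/k! ≤ e^v`. The constant does not depend on
`s`. -/
lemma exists_log_pow_le {ε : ℝ} (hε : 0 < ε) (k : ℕ) :
    ∃ C : ℝ, 0 ≤ C ∧ ∀ s t : ℝ, 0 ≤ s → 4 * s ≤ ε → 0 ≤ t →
      t ^ (-(N : ℝ)) * (|2 * Real.log t| ^ k * Real.exp |2 * s * Real.log t|) ≤
        C * logMajorant N ε t := by
  refine ⟨k.factorial * (4 / ε) ^ k, by positivity, fun s t hs0 hs ht => ?_⟩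
  set L := |Real.log t| with hL
  have hL0 : 0 ≤ L := abs_nonneg _
  have h1 : |2 * Real.log t| = 2 * L := by rw [abs_mul, abs_two]
  have h2 : |2 * s * Real.log t| = 2 * s * L := by rw [abs_mul, abs_of_nonneg (by positivity)]
  have h3 := Real.pow_div_factorial_le_exp (ε / 2 * L) (by positivity) k
  rw [div_le_iff₀ (by positivity)] at h3
  rw [h1, h2, logMajorant, ← hL]
  have h4 : (2 * L) ^ k ≤ k.factorial * (4 / ε) ^ k * Real.exp (ε / 2 * L) := by
    calc (2 * L) ^ k = (4 / ε) ^ k * (ε / 2 * L) ^ k := by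
          rw [← mul_pow]; congr 1; field_simp; ring
      _ ≤ (4 / ε) ^ k * (Real.exp (ε / 2 * L) * k.factorial) := by gcongr
      _ = _ := by ring
  calc t ^ (-(N : ℝ)) * ((2 * L) ^ k * Real.exp (2 * s * L))
      ≤ t ^ (-(N : ℝ)) * ((k.factorial * (4 / ε) ^ k * Real.exp (ε / 2 * L)) *
        Real.exp (ε / 2 * L)) := by
        gcongr
        linarith
    _ = _ := by
        have : Real.exp (ε * L) = Real.exp (ε / 2 * L) * Real.exp (ε / 2 * L) := by
          rw [← Real.exp_add]; congr 1; ring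
        rw [this]; ring

/-- Integrals of the cut-off difference against kernels dominated by `logMajorant`. -/
lemma integrable_cutDiff_mul (hα : 0 < α) (hf : HolderCompact N α f) {ε C K : ℝ}
    {x : Space N} {B : ℝ}
    (hx : Integrable (fun y => |cutDiff f x y| * logMajorant N ε ‖x - y‖) ∧
      ∫ y, |cutDiff f x y| * logMajorant N ε ‖x - y‖ ≤ B) {k : ℝ → ℝ} (hk : Measurable k)
    (hK0 : 0 ≤ K) (hK : ∀ t, 0 < t → |k t| ≤ K * logMajorant N ε t) (hC : C = K * B) :
    Integrable (fun y => cutDiff f x y * k ‖x - y‖) ∧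
      |∫ y, cutDiff f x y * k ‖x - y‖| ≤ C := by
  have hle : ∀ y, ‖cutDiff f x y * k ‖x - y‖‖ ≤
      K * (|cutDiff f x y| * logMajorant N ε ‖x - y‖) := by
    intro y
    rcases eq_or_ne x y with rfl | hxy
    · simp [cutDiff_self]
    have hp : 0 < ‖x - y‖ := norm_pos_iff.2 (sub_ne_zero.2 hxy)
    rw [norm_mul, Real.norm_eq_abs, Real.norm_eq_abs]
    calc _ ≤ |cutDiff f x y| * (K * logMajorant N ε ‖x - y‖) := by gcongr; exact hK _ hp
      _ = _ := by ring
  have hint : Integrable (fun y => cutDiff f x y * k ‖x - y‖) := by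
    refine Integrable.mono' (hx.1.const_mul K) ?_ (ae_of_all _ hle)
    have h1 := measurable_cutDiff_right (hf.continuous hα).measurable x
    have h2 := hk.comp (measurable_norm_const_sub x)
    exact (h1.mul h2).aestronglyMeasurable
  refine ⟨hint, ?_⟩
  rw [← Real.norm_eq_abs]
  refine (norm_integral_le_of_norm_le (hx.1.const_mul K) (ae_of_all _ hle)).trans ?_
  rw [integral_const_mul, hC]
  exact mul_le_mul_of_nonneg_left hx.2 hK0

lemma measurable_integral_cutDiff_mul (hα : 0 < α) (hf : HolderCompact N α f) {k : ℝ → ℝ}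
    (hk : Measurable k) : StronglyMeasurable fun x => ∫ y, cutDiff f x y * k ‖x - y‖ := by
  have : StronglyMeasurable fun p : Space N × Space N => cutDiff f p.1 p.2 * k ‖p.1 - p.2‖ :=
    ((measurable_cutDiff (hf.continuous hα).measurable).mul
      (hk.comp (by fun_prop))).stronglyMeasurable
  exact this.integral_prod_right

end Majorant

/-! ### The logarithmic Laplacians of a Hölder function -/

section Operators

variable {N : ℕ} {α : ℝ≥0} {f : Space N → ℝ}

lemma measurable_qProfile (N n : ℕ) : Measurable (qProfile N n) := by
  unfold qProfile; fun_prop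

lemma exists_qProfile_le {ε : ℝ} (hε : 0 < ε) (j : ℕ) :
    ∃ K : ℝ, 0 ≤ K ∧ ∀ t, 0 < t → |qProfile N j t| ≤ K * logMajorant N ε t := by
  obtain ⟨K, hK0, hK⟩ := exists_log_pow_le (N := N) hε (j - 1)
  -- At `s = 0` the exponential factor is 1 and only the power of the logarithm remains.
  refine ⟨K, hK0, fun t ht => le_trans (le_of_eq ?_) (hK 0 t le_rfl (by linarith) ht.le)⟩
  rw [qProfile, abs_mul, abs_of_nonneg (by positivity), abs_pow, neg_mul, abs_neg]
  simp

lemma integrable_zeroOrderIntegrand (hN : 1 ≤ N) (hα : 0 < α) (hf : HolderCompact N α f) (j : ℕ)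
    (x : Space N) : Integrable (zeroOrderIntegrand N j f x) := by
  have hN' : (1 : ℝ) ≤ N := by exact_mod_cast hN
  have hα' : (0 : ℝ) < α := hα
  have hε : 0 < min ((α : ℝ) / 2) 1 := by positivity
  obtain ⟨C, -, hC⟩ := exists_integral_cutDiff_le hN hα hf (γ := 0)
    (ε := min ((α : ℝ) / 2) 1) le_rfl
    (lt_of_le_of_lt (min_le_left _ _) (by linarith)) ((min_le_right _ _).trans (by linarith))
  obtain ⟨K, hK0, hK⟩ := exists_qProfile_le (N := N) hε j
  exact (integrable_cutDiff_mul hα hf (hC x) (measurable_qProfile N j) hK0 hK rfl).1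

lemma stronglyMeasurable_zeroOrderOp (hα : 0 < α) (hf : HolderCompact N α f) (j : ℕ) :
    StronglyMeasurable (zeroOrderOp N j f) := by
  unfold zeroOrderOp
  split_ifs
  · exact (hf.continuous hα).stronglyMeasurable
  · exact measurable_integral_cutDiff_mul hα hf (measurable_qProfile N j)

lemma HolderCompact.exists_abs_le (hα : 0 < α) (hf : HolderCompact N α f) (γ : ℝ) :
    ∃ C : ℝ, 0 ≤ C ∧ ∀ x, |f x| ≤ C * (1 + ‖x‖) ^ (-γ) := by
  have hc := hf.continuous hα
  have h1 : Continuous fun x : Space N => f x * (1 + ‖x‖) ^ γ :=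
    hc.mul ((by fun_prop : Continuous fun y : Space N => 1 + ‖y‖).rpow_const
        fun y => Or.inl (by positivity))
  obtain ⟨C, hC⟩ := h1.bounded_above_of_compact_support hf.2.mul_right
  refine ⟨C, (norm_nonneg _).trans (hC 0), fun x => ?_⟩
  have := hC x
  have hp : 0 < (1 + ‖x‖) ^ γ := by positivity
  rw [norm_mul, Real.norm_eq_abs, Real.norm_of_nonneg hp.le] at this
  rwa [Real.rpow_neg (by positivity), ← div_eq_mul_inv, le_div_iff₀ hp]

/-- The strict inequality `γ < N` leaves room for a positive `ε` in the majorant. Far from the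
support `𝒦_j f` is an integral of `f` against `|x-y|^(-N)` times a power of a logarithm, so decay
faster than order `N` is not available in general; this is where `p > 1` comes from. -/
lemma exists_abs_zeroOrderOp_le (hN : 1 ≤ N) (hα : 0 < α) (hf : HolderCompact N α f)
    {γ : ℝ} (hγ0 : 0 ≤ γ) (hγ : γ < N) (j : ℕ) :
    ∃ C : ℝ, 0 ≤ C ∧ ∀ x, |zeroOrderOp N j f x| ≤ C * (1 + ‖x‖) ^ (-γ) := by
  rcases eq_or_ne j 0 with rfl | hj
  · simpa [zeroOrderOp] using hf.exists_abs_le hα γ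
  have hα' : (0 : ℝ) < α := hα
  have hε : 0 < min ((α : ℝ) / 2) (N - γ) := lt_min (by positivity) (by linarith)
  obtain ⟨C, hC0, hC⟩ := exists_integral_cutDiff_le hN hα hf hγ0
    (lt_of_le_of_lt (min_le_left _ _) (by linarith)) (min_le_right ((α : ℝ) / 2) _)
  obtain ⟨K, hK0, hK⟩ := exists_qProfile_le (N := N) hε j
  refine ⟨K * C, by positivity, fun x => ?_⟩
  have := (integrable_cutDiff_mul hα hf (hC x) (measurable_qProfile N j) hK0 hK rfl).2
  rw [← mul_assoc] at this
  simp only [zeroOrderOp, hj, if_false]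
  exact this

lemma stronglyMeasurable_logLaplacian (hα : 0 < α) (hf : HolderCompact N α f) (m : ℕ) :
    StronglyMeasurable (logLaplacian N m f) := by
  unfold logLaplacian
  exact Finset.stronglyMeasurable_fun_sum _ fun j _ =>
    (stronglyMeasurable_zeroOrderOp hα hf j).const_mul _

lemma exists_abs_logLaplacian_le (hN : 1 ≤ N) (hα : 0 < α) (hf : HolderCompact N α f)
    {γ : ℝ} (hγ0 : 0 ≤ γ) (hγ : γ < N) (m : ℕ) :
    ∃ C : ℝ, 0 ≤ C ∧ ∀ x, |logLaplacian N m f x| ≤ C * (1 + ‖x‖) ^ (-γ) := by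
  choose C hC0 hC using exists_abs_zeroOrderOp_le hN hα hf hγ0 hγ
  refine ⟨∑ j ∈ Finset.range (m + 1), |logCoeff N m j| * C j,
    Finset.sum_nonneg fun j _ => mul_nonneg (abs_nonneg _) (hC0 j), fun x => ?_⟩
  rw [logLaplacian, Finset.sum_mul]
  refine (Finset.abs_sum_le_sum_abs _ _).trans (Finset.sum_le_sum fun j _ => ?_)
  rw [abs_mul, mul_assoc]
  exact mul_le_mul_of_nonneg_left (hC j x) (abs_nonneg _)

end Operators

/-! ### Weighted bounds and `L^p` -/

lemma memLp_one_add_norm_rpow {N : ℕ} {p : ℝ≥0∞} (hp : 1 < p) {γ : ℝ} (hγ : 0 ≤ γ)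
    (hpγ : p ≠ ∞ → (N : ℝ) < γ * p.toReal) :
    MemLp (fun x : Space N => (1 + ‖x‖) ^ (-γ)) p := by
  have hm : Measurable fun x : Space N => (1 + ‖x‖) ^ (-γ) := by fun_prop
  rcases eq_or_ne p ∞ with rfl | hpt
  · refine memLp_top_of_bound hm.aestronglyMeasurable 1 (ae_of_all _ fun x => ?_)
    rw [Real.norm_of_nonneg (by positivity)]
    exact Real.rpow_le_one_of_one_le_of_nonpos (by simp) (by linarith)
  · have hp0 : p ≠ 0 := (zero_lt_one.trans hp).ne'
    rw [← integrable_norm_rpow_iff hm.aestronglyMeasurable hp0 hpt]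
    refine (integrable_one_add_norm (r := γ * p.toReal) (by simpa using hpγ hpt)).congr
      (ae_of_all _ fun x => ?_)
    simp only
    rw [Real.norm_of_nonneg (by positivity), ← Real.rpow_mul (by positivity), neg_mul]

lemma exists_weight_exponent {N : ℕ} (hN : 1 ≤ N) {p : ℝ≥0∞} (hp : 1 < p) :
    ∃ γ : ℝ, 0 ≤ γ ∧ γ < N ∧ (p ≠ ∞ → (N : ℝ) < γ * p.toReal) := by
  have hN' : (1 : ℝ) ≤ N := by exact_mod_cast hN
  rcases eq_or_ne p ∞ with rfl | hpt
  · exact ⟨0, le_rfl, by linarith, fun h => absurd rfl h⟩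
  have h1 : 1 < p.toReal := by
    rwa [← ENNReal.toReal_one, ENNReal.toReal_lt_toReal (by simp) hpt]
  -- The midpoint of `N/p` and `N`; the interval between them is nonempty because `p > 1`.
  refine ⟨N * ((1 + 1 / p.toReal) / 2), by positivity, ?_, fun _ => ?_⟩
  · have : 1 / p.toReal < 1 := by rw [div_lt_one (by linarith)]; exact h1
    nlinarith
  · have : N * ((1 + 1 / p.toReal) / 2) * p.toReal = N * ((p.toReal + 1) / 2) := by
      field_simp
    rw [this]
    nlinarith

lemma memLp_of_abs_le {N : ℕ} {p : ℝ≥0∞} {w g : Space N → ℝ} (hw : MemLp w p) {C : ℝ}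
    (hg : StronglyMeasurable g) (h : ∀ x, |g x| ≤ C * w x) : MemLp g p :=
  (hw.const_mul C).mono' hg.aestronglyMeasurable (ae_of_all _ h)

lemma toReal_eLpNorm_le_of_abs_le {N : ℕ} {p : ℝ≥0∞} {w g : Space N → ℝ} (hw : MemLp w p) {C : ℝ}
    (hC : 0 ≤ C) (h : ∀ x, |g x| ≤ C * w x) :
    (eLpNorm g p volume).toReal ≤ C * (eLpNorm w p volume).toReal := by
  have h1 : eLpNorm g p volume ≤ eLpNorm (fun x => C * w x) p volume :=
    eLpNorm_mono_real h
  have h2 : eLpNorm (fun x => C * w x) p volume = ENNReal.ofReal C * eLpNorm w p volume := by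
    have := eLpNorm_const_smul C w p (volume : Measure (Space N))
    rw [Real.enorm_of_nonneg hC] at this
    exact this
  rw [h2] at h1
  refine (ENNReal.toReal_mono (ENNReal.mul_ne_top ENNReal.ofReal_ne_top hw.2.ne) h1).trans_eq ?_
  rw [ENNReal.toReal_mul, ENNReal.toReal_ofReal hC]

/-! ### The expansion of the Riesz potential -/

section Expansion

variable {N : ℕ} {α : ℝ≥0} {f : Space N → ℝ}

lemma locallyIntegrable_rieszKernel (hN : 1 ≤ N) {s : ℝ} (hs : 0 < s) :
    LocallyIntegrable (rieszKernel N s) :=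
  (locallyIntegrable_norm_rpow hN (by linarith)).smul (rieszConst N s)

lemma convolutionExists_rieszKernel (hN : 1 ≤ N) (hα : 0 < α) (hf : HolderCompact N α f)
    {s : ℝ} (hs : 0 < s) :
    ConvolutionExists (rieszKernel N s) f (ContinuousLinearMap.mul ℝ ℝ) volume :=
  hf.2.convolutionExists_right _ (locallyIntegrable_rieszKernel hN hs) (hf.continuous hα)

lemma rieszPotential_apply (s : ℝ) (f : Space N → ℝ) (x : Space N) :
    rieszPotential N s f x = ∫ t, rieszKernel N s t * f (x - t) := rfl

/-- The term `f x` times the kernel over the unit ball is explicit and contributes `κ₂(s) f x`. The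
integral that remains has a finite limit as `s → 0`, which the potential's own integral, without the
prefactor `s`, need not have. -/
lemma rieszPotential_eq (hN : 1 ≤ N) (hα : 0 < α) (hf : HolderCompact N α f)
    {s : ℝ} (hs : 0 < s) (x : Space N) :
    rieszPotential N s f x = kappaTwo N s * f x -
      s * kappaOne N s * ∫ y, cutDiff f x y * ‖x - y‖ ^ (2 * s - (N : ℝ)) := by
  have hi1 : Integrable fun z : Space N =>
      f x * (ball (0 : Space N) 1).indicator (fun z => ‖z‖ ^ (2 * s - (N : ℝ))) z :=
    ((integrable_indicator_iff measurableSet_ball).2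
      (integrableOn_ball_norm_rpow hN (by linarith) 1)).const_mul _
  have hi2 : Integrable fun z : Space N => ‖z‖ ^ (2 * s - (N : ℝ)) * f (x - z) :=
    hf.2.convolutionExists_right (ContinuousLinearMap.mul ℝ ℝ)
      (locallyIntegrable_norm_rpow hN (by linarith)) (hf.continuous hα) x
  have e : ∫ y, cutDiff f x y * ‖x - y‖ ^ (2 * s - (N : ℝ)) =
      f x * (∫ z in ball (0 : Space N) 1, ‖z‖ ^ (2 * s - (N : ℝ))) -
        ∫ z, ‖z‖ ^ (2 * s - (N : ℝ)) * f (x - z) := by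
    rw [← integral_sub_left_eq_self _ volume x, ← integral_indicator measurableSet_ball,
      ← integral_const_mul, ← integral_sub hi1 hi2]
    refine integral_congr_ae (ae_of_all _ fun z => ?_)
    simp only [sub_sub_cancel]
    by_cases h : ‖z‖ < 1
    · rw [cutDiff_of_lt f (by simpa using h), Set.indicator_of_mem (by simpa using h)]
      ring
    · rw [cutDiff_of_le f (by simpa using h), Set.indicator_of_notMem (by simpa using h)]
      ring
  have e2 : rieszPotential N s f x =
      rieszConst N s * ∫ z, ‖z‖ ^ (2 * s - (N : ℝ)) * f (x - z) := by
    rw [rieszPotential_apply, ← integral_const_mul]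
    simp only [rieszKernel, mul_assoc]
  rw [e, e2, setIntegral_unit_ball_norm_rpow hN (by linarith : 0 < 2 * s), kappaTwo_eq hN, rieszConst]
  have hN' : (0 : ℝ) < N := by exact_mod_cast hN
  have hG : Real.Gamma ((N : ℝ) / 2) ≠ 0 := (Real.Gamma_pos_of_pos (by positivity)).ne'
  field_simp
  ring

/-- The remainder of order `n` in the exponential series of `t^{2s} = exp (2 s ln t)`, times
`t^{-N}`. -/
noncomputable def expProfile (N n : ℕ) (s t : ℝ) : ℝ :=
  t ^ (-(N : ℝ)) * (Real.exp (2 * s * Real.log t) -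
    ∑ k ∈ Finset.range n, (2 * s * Real.log t) ^ k / k.factorial)

lemma measurable_expProfile (N n : ℕ) (s : ℝ) : Measurable (expProfile N n s) := by
  unfold expProfile; fun_prop

/-- The exponential remainder of order `n` at `v = 2 s ln t` is at most `|v|^n e^|v|` (the complex
estimate, read on real arguments). The factor `s^n` comes out and the logarithms go into the
majorant. -/
lemma exists_expProfile_le {ε : ℝ} (hε : 0 < ε) (n : ℕ) :
    ∃ K : ℝ, 0 ≤ K ∧ ∀ s t : ℝ, 0 ≤ s → 4 * s ≤ ε → 0 < t →
      |expProfile N n s t| ≤ K * s ^ n * logMajorant N ε t := by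
  obtain ⟨K, hK0, hK⟩ := exists_log_pow_le (N := N) hε n
  refine ⟨K, hK0, fun s t hs0 hs ht => ?_⟩
  have h := Complex.norm_exp_sub_sum_le_norm_mul_exp ((2 * s * Real.log t : ℝ) : ℂ) n
  have e : Complex.exp ((2 * s * Real.log t : ℝ) : ℂ) -
      ∑ k ∈ Finset.range n, ((2 * s * Real.log t : ℝ) : ℂ) ^ k / (k.factorial : ℂ) =
      ((Real.exp (2 * s * Real.log t) -
        ∑ k ∈ Finset.range n, (2 * s * Real.log t) ^ k / k.factorial : ℝ) : ℂ) := by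
    push_cast; ring
  rw [e, Complex.norm_real, Complex.norm_real, Real.norm_eq_abs, Real.norm_eq_abs] at h
  rw [expProfile, abs_mul, abs_of_nonneg (by positivity : 0 ≤ t ^ (-(N : ℝ)))]
  have e2 : |2 * s * Real.log t| ^ n = s ^ n * |2 * Real.log t| ^ n := by
    rw [mul_comm 2 s, mul_assoc, abs_mul, abs_of_nonneg hs0, mul_pow]
  calc _ ≤ t ^ (-(N : ℝ)) * (|2 * s * Real.log t| ^ n * Real.exp |2 * s * Real.log t|) := by gcongr
    _ = s ^ n * (t ^ (-(N : ℝ)) * (|2 * Real.log t| ^ n * Real.exp |2 * s * Real.log t|)) := by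
      rw [e2]; ring
    _ ≤ s ^ n * (K * logMajorant N ε t) :=
      mul_le_mul_of_nonneg_left (hK s t hs0 hs ht.le) (by positivity)
    _ = _ := by ring

/-- Since `2 s ln t = (-s)(-2 ln t)`, the `k`-th term of the exponential series is `(-s)^k/k!` times
the profile `q_{k+1}`; the shift by one reflects the exponent `n - 1` in `qProfile`. -/
lemma integral_cutDiff_rpow_eq (hN : 1 ≤ N) (hα : 0 < α) (hf : HolderCompact N α f)
    (n : ℕ) {s : ℝ} {x : Space N}
    (hi : Integrable fun y => cutDiff f x y * expProfile N n s ‖x - y‖) :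
    ∫ y, cutDiff f x y * ‖x - y‖ ^ (2 * s - (N : ℝ)) =
      ∑ k ∈ Finset.range n, (-s) ^ k / k.factorial * zeroOrderOp N (k + 1) f x +
        ∫ y, cutDiff f x y * expProfile N n s ‖x - y‖ := by
  have hk : ∀ k ∈ Finset.range n, Integrable fun y =>
      (-s) ^ k / k.factorial * zeroOrderIntegrand N (k + 1) f x y := fun k _ =>
    (integrable_zeroOrderIntegrand hN hα hf (k + 1) x).const_mul _
  have e : ∑ k ∈ Finset.range n, (-s) ^ k / k.factorial * zeroOrderOp N (k + 1) f x =
      ∫ y, ∑ k ∈ Finset.range n, (-s) ^ k / k.factorial * zeroOrderIntegrand N (k + 1) f x y := by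
    rw [integral_finsetSum _ hk]
    refine Finset.sum_congr rfl fun k _ => ?_
    rw [integral_const_mul, zeroOrderOp, if_neg (by omega)]
  rw [e, ← integral_add (integrable_finsetSum _ hk) hi]
  refine integral_congr_ae (ae_of_all _ fun y => ?_)
  rcases eq_or_ne x y with rfl | hxy
  · have : ∀ k, zeroOrderIntegrand N k f x x = 0 := fun k => by
      simp [zeroOrderIntegrand]
    simp [this, cutDiff_self]
  have hp : 0 < ‖x - y‖ := norm_pos_iff.2 (sub_ne_zero.2 hxy)
  have h1 : ‖x - y‖ ^ (2 * s - (N : ℝ)) =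
      ‖x - y‖ ^ (-(N : ℝ)) * Real.exp (2 * s * Real.log ‖x - y‖) := by
    rw [show 2 * s - (N : ℝ) = -(N : ℝ) + 2 * s by ring, Real.rpow_add hp,
      Real.rpow_def_of_pos hp (2 * s), mul_comm (Real.log _)]
  have h2 : ∀ k, (-s) ^ k / k.factorial * zeroOrderIntegrand N (k + 1) f x y =
      cutDiff f x y * ‖x - y‖ ^ (-(N : ℝ)) *
        ((2 * s * Real.log ‖x - y‖) ^ k / k.factorial) := fun k => by
    have : (2 * s * Real.log ‖x - y‖) ^ k = (-s) ^ k * (-2 * Real.log ‖x - y‖) ^ k := by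
      rw [← mul_pow]; congr 1; ring
    rw [this, zeroOrderIntegrand, qProfile, Nat.add_sub_cancel, cutDiff]
    ring
  simp only [h1, h2, expProfile, ← Finset.mul_sum]
  ring

/-- The coefficients `α_j` are those of a Cauchy product. The term `f x` is the constant term of the
Taylor series of `κ₂`, as `κ₂(0) = 1`. The `k`-th exponential term already carries `s^(k+1)`, so
`κ₁` is expanded only to degree `n - k - 1` there. -/
lemma sum_Icc_logLaplacian (hN : 1 ≤ N) (n : ℕ) (s : ℝ) (x : Space N) :
    f x + ∑ m ∈ Finset.Icc 1 n, (-s) ^ m / (m.factorial : ℝ) * logLaplacian N m f x =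
      (∑ k ∈ Finset.range (n + 1), iteratedDeriv k (kappaTwo N) 0 / k.factorial * s ^ k) * f x +
      ∑ k ∈ Finset.range n, (-s) ^ (k + 1) / k.factorial * zeroOrderOp N (k + 1) f x *
        ∑ i ∈ Finset.range (n - k), iteratedDeriv i (kappaOne N) 0 / i.factorial * s ^ i := by
  have hsq : ∀ m : ℕ, (-s) ^ m * (-1) ^ m = s ^ m := fun m => by
    rw [← mul_pow]; congr 1; ring
  have e1 : ∑ m ∈ Finset.Icc 1 n, (-s) ^ m / (m.factorial : ℝ) * logLaplacian N m f x =
      ∑ m ∈ Finset.range n,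
        (iteratedDeriv (m + 1) (kappaTwo N) 0 / (m + 1).factorial * s ^ (m + 1) * f x +
        ∑ k ∈ Finset.range (m + 1), (-s) ^ (k + 1) / k.factorial * zeroOrderOp N (k + 1) f x *
          (iteratedDeriv (m - k) (kappaOne N) 0 / (m - k).factorial * s ^ (m - k))) := by
    rw [← Finset.Ico_add_one_right_eq_Icc, Finset.sum_Ico_eq_sum_range, Nat.add_sub_cancel]
    refine Finset.sum_congr rfl fun m _ => ?_
    rw [add_comm 1 m, logLaplacian, Finset.sum_range_succ', mul_add, add_comm, Finset.mul_sum]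
    congr 1
    · simp only [logCoeff, zeroOrderOp, if_true]
      rw [← hsq (m + 1)]
      ring
    · refine Finset.sum_congr rfl fun k hk => ?_
      have hk : k ≤ m := Nat.lt_succ_iff.1 (Finset.mem_range.1 hk)
      -- With `m + 1` in the role of `m` and `j = k + 1`, the factor `m binom(m-1, j-1)/m!` splits
      -- into the factorials of the two series.
      have hf1 : ((m + 1 : ℕ) : ℝ) * (m.choose k : ℝ) / ((m + 1).factorial : ℝ) =
          1 / ((k.factorial : ℝ) * ((m - k).factorial : ℝ)) := by
        rw [Nat.factorial_succ, ← Nat.choose_mul_factorial_mul_factorial hk]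
        have h1 : (m.choose k : ℝ) ≠ 0 := by exact_mod_cast (Nat.choose_pos hk).ne'
        push_cast
        field_simp
      have hf2 : (-s) ^ (m + 1) * (-1) ^ (m + 1 + (k + 1)) = (-s) ^ (k + 1) * s ^ (m - k) := by
        have : m + 1 = (k + 1) + (m - k) := by omega
        have h4 : (-1 : ℝ) ^ (m + 1 + (k + 1)) = (-1) ^ (m - k) := by
          rw [show m + 1 + (k + 1) = (m - k) + 2 * (k + 1) by omega, pow_add, pow_mul]
          simp
        rw [h4, this, pow_add, mul_assoc, ← hsq (m - k)]
      rw [logCoeff, if_neg (by omega)]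
      simp only [Nat.add_sub_cancel, Nat.add_sub_add_right]
      calc _ = (-s) ^ (m + 1) * (-1) ^ (m + 1 + (k + 1)) *
            (((m + 1 : ℕ) : ℝ) * (m.choose k : ℝ) / ((m + 1).factorial : ℝ)) *
            iteratedDeriv (m - k) (kappaOne N) 0 * zeroOrderOp N (k + 1) f x := by ring
        _ = _ := by rw [hf1, hf2]; ring
  rw [e1, Finset.sum_add_distrib, Finset.sum_range_succ' _ n, ← Finset.sum_mul]
  simp only [iteratedDeriv_zero, Nat.factorial_zero, Nat.cast_one, div_one, pow_zero, mul_one,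
    kappaTwo_zero hN]
  have e2 : ∑ m ∈ Finset.range n, ∑ k ∈ Finset.range (m + 1),
      (-s) ^ (k + 1) / k.factorial * zeroOrderOp N (k + 1) f x *
          (iteratedDeriv (m - k) (kappaOne N) 0 / (m - k).factorial * s ^ (m - k)) =
      ∑ k ∈ Finset.range n, (-s) ^ (k + 1) / k.factorial * zeroOrderOp N (k + 1) f x *
        ∑ i ∈ Finset.range (n - k), iteratedDeriv i (kappaOne N) 0 / i.factorial * s ^ i := by
    rw [Finset.sum_sigma']
    simp only [Finset.mul_sum]
    rw [Finset.sum_sigma']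
    -- The triangle `k ≤ m < n` is reindexed by `k` and `i = m - k`.
    refine Finset.sum_bij' (fun a _ => ⟨a.2, a.1 - a.2⟩) (fun a _ => ⟨a.1 + a.2, a.1⟩) ?_ ?_ ?_ ?_ ?_
    · rintro ⟨a, b⟩ h; simp only [Finset.mem_sigma, Finset.mem_range] at h ⊢; omega
    · rintro ⟨a, b⟩ h; simp only [Finset.mem_sigma, Finset.mem_range] at h ⊢; omega
    · rintro ⟨a, b⟩ h
      simp only [Finset.mem_sigma, Finset.mem_range] at h
      simp only [Sigma.mk.injEq, heq_eq_eq, and_true]; omega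
    · rintro ⟨a, b⟩ h
      simp
    · rintro ⟨a, b⟩ h
      rfl
  rw [e2]
  ring

/-- The remainder in the expansion of the Riesz potential, in terms of Taylor remainders. -/
lemma expansionRemainder_eq (hN : 1 ≤ N) (hα : 0 < α) (hf : HolderCompact N α f)
    (n : ℕ) {s : ℝ} (hs : 0 < s) {x : Space N}
    (hi : Integrable fun y => cutDiff f x y * expProfile N n s ‖x - y‖) :
    expansionRemainder N n f s x =
      (kappaTwo N s -
        ∑ k ∈ Finset.range (n + 1), iteratedDeriv k (kappaTwo N) 0 / k.factorial * s ^ k) * f x +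
      ∑ k ∈ Finset.range n, (kappaOne N s -
          ∑ i ∈ Finset.range (n - k), iteratedDeriv i (kappaOne N) 0 / i.factorial * s ^ i) *
        ((-s) ^ (k + 1) / k.factorial * zeroOrderOp N (k + 1) f x) -
      s * kappaOne N s * ∫ y, cutDiff f x y * expProfile N n s ‖x - y‖ := by
  have h := sum_Icc_logLaplacian (f := f) hN n s x
  rw [expansionRemainder, rieszPotential_eq hN hα hf hs,
    integral_cutDiff_rpow_eq hN hα hf n hi, sub_sub, h]
  have e : ∀ k, (kappaOne N s -
          ∑ i ∈ Finset.range (n - k), iteratedDeriv i (kappaOne N) 0 / i.factorial * s ^ i) *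
        ((-s) ^ (k + 1) / k.factorial * zeroOrderOp N (k + 1) f x) =
      -(s * kappaOne N s) * ((-s) ^ k / k.factorial * zeroOrderOp N (k + 1) f x) -
      (-s) ^ (k + 1) / k.factorial * zeroOrderOp N (k + 1) f x *
        ∑ i ∈ Finset.range (n - k), iteratedDeriv i (kappaOne N) 0 / i.factorial * s ^ i :=
    fun k => by ring
  simp only [e, Finset.sum_sub_distrib, ← Finset.mul_sum]
  ring

/-- Each of the three error terms has order `s^(n+1)`: the Taylor remainder of `κ₂` directly, that
of `κ₁` as `s^(n-k) s^(k+1)`, and the exponential remainder as `s · s^n`. -/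
lemma exists_abs_expansionRemainder_le (hN : 1 ≤ N) (hα : 0 < α) (hf : HolderCompact N α f)
    {γ : ℝ} (hγ0 : 0 ≤ γ) (hγ : γ < N) (n : ℕ) :
    ∃ C : ℝ, 0 ≤ C ∧ ∀ᶠ s in 𝓝[>] (0 : ℝ),
      ∀ x, |expansionRemainder N n f s x| ≤ C * s ^ (n + 1) * (1 + ‖x‖) ^ (-γ) := by
  have hα' : (0 : ℝ) < α := hα
  set ε := min ((α : ℝ) / 2) (N - γ) with hεdef
  have hε : 0 < ε := lt_min (by positivity) (by linarith)
  obtain ⟨C, hC0, hC⟩ := exists_integral_cutDiff_le hN hα hf hγ0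
    (lt_of_le_of_lt (min_le_left _ _) (by linarith)) (min_le_right ((α : ℝ) / 2) _)
  obtain ⟨A, hA0, hA⟩ := hf.exists_abs_le hα γ
  obtain ⟨K, hK0, hK⟩ := exists_expProfile_le (N := N) hε n
  choose D hD0 hD using exists_abs_zeroOrderOp_le hN hα hf hγ0 hγ
  obtain ⟨T, hT0, hT⟩ := exists_taylor_bound (analyticAt_kappaTwo hN) (n + 1)
  choose S hS0 hS using exists_taylor_bound (analyticAt_kappaOne hN)
  have hS' : ∀ᶠ s in 𝓝[>] (0 : ℝ), ∀ k ∈ Finset.range n, |kappaOne N s - ∑ i ∈ Finset.range (n - k),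
      iteratedDeriv i (kappaOne N) 0 / i.factorial * s ^ i| ≤ S (n - k) * s ^ (n - k) :=
    (Finset.eventually_all _).2 fun k _ => hS (n - k)
  refine ⟨T * A + ∑ k ∈ Finset.range n, S (n - k) * D (k + 1) + S 0 * (K * C), ?_, ?_⟩
  · have : 0 ≤ ∑ k ∈ Finset.range n, S (n - k) * D (k + 1) :=
      Finset.sum_nonneg fun k _ => mul_nonneg (hS0 _) (hD0 _)
    have := hS0 0
    positivity
  filter_upwards [hT, hS', hS 0, Ioo_mem_nhdsGT (by positivity : 0 < ε / 4)] with s hT hS hS1 hs x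
  obtain ⟨hs0, hs1⟩ := hs
  -- At order 0 the Taylor polynomial is empty, so `S 0` bounds `κ₁` itself near the origin.
  simp only [Finset.range_zero, Finset.sum_empty, sub_zero, pow_zero, mul_one] at hS1
  have hkey := integrable_cutDiff_mul hα hf (hC x) (measurable_expProfile N n s)
    (by positivity : 0 ≤ K * s ^ n) (fun t ht => hK s t hs0.le (by linarith) ht) rfl
  rw [expansionRemainder_eq hN hα hf n hs0 hkey.1]
  set W := (1 + ‖x‖) ^ (-γ) with hW
  have hW0 : 0 ≤ W := by positivity
  refine (abs_sub _ _).trans ?_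
  refine (add_le_add_left (abs_add_le _ _) _).trans ?_
  rw [add_mul, add_mul, add_mul, add_mul, Finset.sum_mul, Finset.sum_mul]
  gcongr ?_ + ?_ + ?_
  · rw [abs_mul]
    calc _ ≤ T * s ^ (n + 1) * (A * W) := by gcongr; exact hA x
      _ = _ := by ring
  · refine (Finset.abs_sum_le_sum_abs _ _).trans (Finset.sum_le_sum fun k hk => ?_)
    have hkn : k < n := Finset.mem_range.1 hk
    rw [abs_mul, abs_mul, abs_div, abs_pow, abs_neg, abs_of_pos hs0, Nat.abs_cast]
    have h1 : s ^ (k + 1) / (k.factorial : ℝ) ≤ s ^ (k + 1) :=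
      div_le_self (by positivity) (by exact_mod_cast Nat.factorial_pos k)
    calc _ ≤ S (n - k) * s ^ (n - k) * (s ^ (k + 1) * (D (k + 1) * W)) := by
          gcongr
          · exact mul_nonneg (hS0 _) (by positivity)
          · exact hS k hk
          · exact hD _ x
      _ = S (n - k) * D (k + 1) * s ^ ((n - k) + (k + 1)) * W := by rw [pow_add]; ring
      _ = _ := by rw [show (n - k) + (k + 1) = n + 1 by omega]
  · rw [abs_mul, abs_mul, abs_of_pos hs0]
    calc _ ≤ s * S 0 * (K * s ^ n * (C * W)) := by
          gcongr
          · exact mul_nonneg hs0.le (hS0 0)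
          · exact hkey.2
      _ = _ := by ring

lemma stronglyMeasurable_expansionRemainder (hN : 1 ≤ N) (hα : 0 < α) (hf : HolderCompact N α f)
    (n : ℕ) {s : ℝ} (hs : 0 < s) : StronglyMeasurable (expansionRemainder N n f s) := by
  have h1 : StronglyMeasurable (rieszPotential N s f) := by
    rw [funext (rieszPotential_eq hN hα hf hs)]
    exact ((hf.continuous hα).stronglyMeasurable.const_mul _).sub
      ((measurable_integral_cutDiff_mul hα hf (k := fun t => t ^ (2 * s - (N : ℝ)))
        (by fun_prop)).const_mul _)
  unfold expansionRemainder
  exact (h1.sub (hf.continuous hα).stronglyMeasurable).sub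
    (Finset.stronglyMeasurable_fun_sum _ fun m _ =>
      (stronglyMeasurable_logLaplacian hα hf m).const_mul _)

lemma memLp_logLaplacian (hN : 1 ≤ N) (hα : 0 < α) (hf : HolderCompact N α f) {p : ℝ≥0∞}
    (hp : 1 < p) (m : ℕ) : MemLp (logLaplacian N m f) p := by
  obtain ⟨γ, hγ0, hγ, hpγ⟩ := exists_weight_exponent hN hp
  obtain ⟨C, -, hC⟩ := exists_abs_logLaplacian_le hN hα hf hγ0 hγ m
  exact memLp_of_abs_le (memLp_one_add_norm_rpow hp hγ0 hpγ)
    (stronglyMeasurable_logLaplacian hα hf m) hC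

lemma isLittleOInLp_expansionRemainder (hN : 1 ≤ N) (hα : 0 < α) (hf : HolderCompact N α f)
    {p : ℝ≥0∞} (hp : 1 < p) (n : ℕ) : IsLittleOInLp N p n (expansionRemainder N n f) := by
  obtain ⟨γ, hγ0, hγ, hpγ⟩ := exists_weight_exponent hN hp
  obtain ⟨C, hC0, hC⟩ := exists_abs_expansionRemainder_le hN hα hf hγ0 hγ n
  have hw := memLp_one_add_norm_rpow (N := N) hp hγ0 hpγ
  refine ⟨?_, ?_⟩
  · filter_upwards [hC, self_mem_nhdsWithin] with s hs hs0
    exact memLp_of_abs_le hw (stronglyMeasurable_expansionRemainder hN hα hf n hs0) hs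
  · set L := (eLpNorm (fun x : Space N => (1 + ‖x‖) ^ (-γ)) p volume).toReal
    -- The pointwise bound has one power of `s` to spare, so the quotient is at most `C s L`.
    have hlim : Tendsto (fun s : ℝ => C * s * L) (𝓝[>] (0 : ℝ)) (𝓝 0) := by
      have : Continuous fun s : ℝ => C * s * L := by fun_prop
      simpa using (this.tendsto 0).mono_left nhdsWithin_le_nhds
    refine squeeze_zero' ?_ ?_ hlim
    · filter_upwards [self_mem_nhdsWithin] with s hs0
      have hs0 : 0 < s := hs0
      positivity
    · filter_upwards [hC, self_mem_nhdsWithin] with s hs hs0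
      have hs0 : 0 < s := hs0
      rw [div_le_iff₀ (by positivity)]
      refine (toReal_eLpNorm_le_of_abs_le hw (by positivity) hs).trans_eq ?_
      rw [pow_succ]
      ring

end Expansion

/-! ### The heat kernel -/

/-- The Gauss-Weierstrass kernel. -/
noncomputable def heat (N : ℕ) (t : ℝ) (z : Space N) : ℝ :=
  (4 * Real.pi * t) ^ (-((N : ℝ) / 2)) * Real.exp (-(1 / (4 * t)) * ‖z‖ ^ 2)

section Heat

variable {N : ℕ}

lemma heat_nonneg {t : ℝ} (ht : 0 ≤ t) (z : Space N) : 0 ≤ heat N t z := by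
  have := Real.pi_pos
  unfold heat; positivity

lemma heat_neg (t : ℝ) (z : Space N) : heat N t (-z) = heat N t z := by simp [heat]

lemma measurable_heat_uncurry : Measurable fun p : ℝ × Space N => heat N p.1 p.2 := by
  unfold heat; fun_prop

lemma continuous_heat (t : ℝ) : Continuous (heat N t) := by
  unfold heat; fun_prop

lemma integral_heat {t : ℝ} (ht : 0 < t) : ∫ z, heat N t z = 1 := by
  have := Real.pi_pos
  unfold heat
  rw [integral_const_mul, GaussianFourier.integral_rexp_neg_mul_sq_norm (by positivity),
    finrank_space, div_div_eq_mul_div, div_one, ← mul_assoc, mul_comm Real.pi 4,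
    Real.rpow_neg (by positivity)]
  exact inv_mul_cancel₀ (by positivity)

lemma integrable_heat {t : ℝ} (ht : 0 < t) : Integrable (heat N t) := by
  -- A non-integrable function would have integral 0 by convention, but this integral is 1.
  by_contra h
  have h1 := integral_heat (N := N) ht
  rw [integral_undef h] at h1
  exact zero_ne_one h1

lemma lintegral_heat {t : ℝ} (ht : 0 < t) : ∫⁻ z, ENNReal.ofReal (heat N t z) = 1 := by
  rw [← ofReal_integral_eq_lintegral_ofReal (integrable_heat ht)
    (ae_of_all _ fun z => heat_nonneg ht.le z), integral_heat ht, ENNReal.ofReal_one]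

/-- Completing the square in `y`. The second factor on the right has mass one in `y`, which yields
the semigroup law. -/
lemma heat_mul_heat {t r : ℝ} (ht : 0 < t) (hr : 0 < r) (y z : Space N) :
    heat N t y * heat N r (z - y) =
      heat N (t + r) z * heat N (t * r / (t + r)) (y - (t / (t + r)) • z) := by
  have hpi := Real.pi_pos
  have h1 : ‖z - y‖ ^ 2 = ‖z‖ ^ 2 - 2 * inner ℝ y z + ‖y‖ ^ 2 := by
    rw [norm_sub_sq_real, real_inner_comm]
  have h2 : ‖y - (t / (t + r)) • z‖ ^ 2 =
      ‖y‖ ^ 2 - 2 * (t / (t + r)) * inner ℝ y z + (t / (t + r)) ^ 2 * ‖z‖ ^ 2 := by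
    rw [norm_sub_sq_real, inner_smul_right, norm_smul, mul_pow, Real.norm_eq_abs, sq_abs]
    ring
  have h3 : (4 * Real.pi * t) ^ (-((N : ℝ) / 2)) * (4 * Real.pi * r) ^ (-((N : ℝ) / 2)) =
      (4 * Real.pi * (t + r)) ^ (-((N : ℝ) / 2)) *
        (4 * Real.pi * (t * r / (t + r))) ^ (-((N : ℝ) / 2)) := by
    rw [← Real.mul_rpow (by positivity) (by positivity), ← Real.mul_rpow (by positivity)
      (by positivity)]
    congr 1
    field_simp
  have h4 : -(1 / (4 * t)) * ‖y‖ ^ 2 + -(1 / (4 * r)) * ‖z - y‖ ^ 2 =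
      -(1 / (4 * (t + r))) * ‖z‖ ^ 2 +
        -(1 / (4 * (t * r / (t + r)))) * ‖y - (t / (t + r)) • z‖ ^ 2 := by
    rw [h1, h2]
    field_simp
    ring
  unfold heat
  rw [mul_mul_mul_comm, mul_mul_mul_comm _ _ ((4 * Real.pi * (t * r / (t + r))) ^ _), h3,
    ← Real.exp_add, ← Real.exp_add, h4]

lemma lintegral_heat_mul_heat {t r : ℝ} (ht : 0 < t) (hr : 0 < r) (z : Space N) :
    ∫⁻ y, ENNReal.ofReal (heat N t y) * ENNReal.ofReal (heat N r (z - y)) =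
      ENNReal.ofReal (heat N (t + r) z) := by
  have h : ∀ y, ENNReal.ofReal (heat N t y) * ENNReal.ofReal (heat N r (z - y)) =
      ENNReal.ofReal (heat N (t + r) z) *
        ENNReal.ofReal (heat N (t * r / (t + r)) (y - (t / (t + r)) • z)) := fun y => by
    rw [← ENNReal.ofReal_mul (heat_nonneg ht.le _), heat_mul_heat ht hr,
      ENNReal.ofReal_mul (heat_nonneg (by positivity) _)]
  simp only [h]
  rw [lintegral_const_mul' _ _ ENNReal.ofReal_ne_top,
    lintegral_sub_right_eq_self (fun y => ENNReal.ofReal (heat N (t * r / (t + r)) y)),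
    lintegral_heat (by positivity), mul_one]

/-- Parabolic scaling of the heat kernel. -/
lemma heat_smul {t c : ℝ} (ht : 0 < t) (hc : 0 < c) (z : Space N) :
    heat N (c ^ 2 * t) (c • z) * c ^ N = heat N t z := by
  have hpi := Real.pi_pos
  unfold heat
  have h1 : (4 * Real.pi * (c ^ 2 * t)) ^ (-((N : ℝ) / 2)) * c ^ N =
      (4 * Real.pi * t) ^ (-((N : ℝ) / 2)) := by
    rw [show 4 * Real.pi * (c ^ 2 * t) = (4 * Real.pi * t) * c ^ 2 by ring,
      Real.mul_rpow (by positivity) (by positivity), mul_assoc, ← Real.rpow_natCast c 2,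
      ← Real.rpow_mul hc.le, ← Real.rpow_natCast c N, ← Real.rpow_add hc]
    have : ((2 : ℕ) : ℝ) * -((N : ℝ) / 2) + N = 0 := by push_cast; ring
    rw [this, Real.rpow_zero, mul_one]
  have h2 : -(1 / (4 * (c ^ 2 * t))) * ‖c • z‖ ^ 2 = -(1 / (4 * t)) * ‖z‖ ^ 2 := by
    rw [norm_smul, Real.norm_of_nonneg hc.le]
    field_simp
  rw [h2, mul_right_comm, h1]

lemma integral_heat_mul {t : ℝ} (ht : 0 < t) (g : Space N → ℝ) :
    ∫ z, heat N t z * g z = ∫ w, heat N 1 w * g (√t • w) := by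
  have hc : 0 < √t := Real.sqrt_pos.2 ht
  have h := Measure.integral_comp_smul (volume : Measure (Space N))
    (fun z => heat N t z * g z) (√t)
  rw [finrank_space, abs_of_pos (by positivity), smul_eq_mul, eq_inv_mul_iff_mul_eq₀ (by positivity)]
    at h
  rw [← h, ← integral_const_mul]
  congr 1 with w
  have := heat_smul (N := N) one_pos hc w
  rw [mul_one, Real.sq_sqrt ht.le] at this
  rw [← this]
  ring

/-- Integrating the heat kernel against a power of time gives a power of the norm. -/
lemma integral_rpow_mul_heat {a : ℝ} (ha : a < (N : ℝ) / 2) {z : Space N} (hz : z ≠ 0) :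
    IntegrableOn (fun t : ℝ => t ^ (a - 1) * heat N t z) (Set.Ioi 0) ∧
    ∫ t in Set.Ioi (0 : ℝ), t ^ (a - 1) * heat N t z =
      (2 : ℝ) ^ (-2 * a) * Real.pi ^ (-(N : ℝ) / 2) * Real.Gamma ((N : ℝ) / 2 - a) *
        ‖z‖ ^ (2 * a - (N : ℝ)) := by
  have hpi := Real.pi_pos
  have hz' : 0 < ‖z‖ := norm_pos_iff.2 hz
  set b := (N : ℝ) / 2 - a with hb
  have hb0 : 0 < b := by linarith
  set q := ‖z‖ ^ 2 / 4 with hq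
  have hq0 : 0 < q := by positivity
  -- The substitution `t = 1/v` turns the integral into a Gamma integral with exponent `b = N/2 - a`
  -- and rate `q = |z|²/4`.
  set g : ℝ → ℝ := fun v => (4 * Real.pi) ^ (-((N : ℝ) / 2)) * (v ^ (b - 1) * Real.exp (-(q * v)))
    with hg
  have hgi : ∫ v in Set.Ioi (0 : ℝ), g v =
      (4 * Real.pi) ^ (-((N : ℝ) / 2)) * ((1 / q) ^ b * Real.Gamma b) := by
    rw [hg, integral_const_mul, Real.integral_rpow_mul_exp_neg_mul_Ioi hb0 hq0]
  have hgp : IntegrableOn g (Set.Ioi 0) := by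
    by_contra h
    rw [integral_undef h] at hgi
    have := Real.Gamma_pos_of_pos hb0
    exact absurd hgi (by positivity)
  have hcongr : ∀ t ∈ Set.Ioi (0 : ℝ), (|(-1 : ℝ)| * t ^ ((-1 : ℝ) - 1)) • g (t ^ (-1 : ℝ)) =
      t ^ (a - 1) * heat N t z := by
    intro t ht
    have ht : 0 < t := ht
    have e1 : -(q * t ^ (-1 : ℝ)) = -(1 / (4 * t)) * ‖z‖ ^ 2 := by
      rw [Real.rpow_neg_one, hq]; field_simp
    have e2 : t ^ ((-1 : ℝ) - 1) * (t ^ (-1 : ℝ)) ^ (b - 1) =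
        t ^ (a - 1) * t ^ (-((N : ℝ) / 2)) := by
      rw [← Real.rpow_mul ht.le, ← Real.rpow_add ht, ← Real.rpow_add ht]
      congr 1; rw [hb]; ring
    rw [hg]
    beta_reduce
    rw [abs_neg, abs_one, one_mul, smul_eq_mul, heat, e1,
      Real.mul_rpow (by positivity) ht.le]
    linear_combination ((4 * Real.pi) ^ (-((N : ℝ) / 2)) * Real.exp (-(1 / (4 * t)) * ‖z‖ ^ 2)) * e2
  constructor
  · rw [← integrableOn_Ioi_comp_rpow_iff g (p := -1) (by norm_num)] at hgp
    exact hgp.congr_fun hcongr measurableSet_Ioi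
  · rw [← setIntegral_congr_fun measurableSet_Ioi hcongr,
      integral_comp_rpow_Ioi g (p := -1) (by norm_num), hgi]
    have e3 : (1 / q) ^ b = (4 : ℝ) ^ b * ‖z‖ ^ (2 * a - (N : ℝ)) := by
      rw [hq, one_div_div, Real.div_rpow (by norm_num) (by positivity), ← Real.rpow_natCast,
        ← Real.rpow_mul hz'.le, div_eq_mul_inv, ← Real.rpow_neg hz'.le]
      congr 2; rw [hb]; push_cast; ring
    have e4 : (4 : ℝ) ^ (-((N : ℝ) / 2)) * (4 : ℝ) ^ b = (2 : ℝ) ^ (-2 * a) := by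
      rw [← Real.rpow_add (by norm_num), show (4 : ℝ) = 2 ^ (2 : ℝ) by norm_num,
        ← Real.rpow_mul (by norm_num)]
      congr 1; rw [hb]; ring
    rw [Real.mul_rpow (by norm_num) hpi.le, e3, ← e4, show -(N : ℝ) / 2 = -((N : ℝ) / 2) by ring]
    ring

/-- The Riesz kernel as a superposition of heat kernels. -/
lemma rieszKernel_eq_integral_heat {s : ℝ} (hs0 : 0 < s) (hs : 2 * s < N) {z : Space N}
    (hz : z ≠ 0) :
    IntegrableOn (fun t : ℝ => t ^ (s - 1) / Real.Gamma s * heat N t z) (Set.Ioi 0) ∧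
    ∫ t in Set.Ioi (0 : ℝ), t ^ (s - 1) / Real.Gamma s * heat N t z = rieszKernel N s z := by
  obtain ⟨h1, h2⟩ := integral_rpow_mul_heat (N := N) (a := s) (by linarith) hz
  have e : ∀ t : ℝ, t ^ (s - 1) / Real.Gamma s * heat N t z =
      (Real.Gamma s)⁻¹ * (t ^ (s - 1) * heat N t z) := fun t => by ring
  have hG : Real.Gamma s ≠ 0 := (Real.Gamma_pos_of_pos hs0).ne'
  simp only [e]
  refine ⟨h1.const_mul _, ?_⟩
  rw [integral_const_mul, h2, rieszKernel, rieszConst, kappaOne, add_comm 1 s,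
    Real.Gamma_add_one hs0.ne', show ((N : ℝ) - 2 * s) / 2 = (N : ℝ) / 2 - s by ring]
  field_simp

/-- The kernel of the fractional Laplacian as a superposition of heat kernels. -/
lemma fracLapConst_mul_eq_integral_heat {s : ℝ} (hs0 : 0 < s) {z : Space N}
    (hz : z ≠ 0) :
    IntegrableOn (fun t : ℝ => s / Real.Gamma (1 - s) * t ^ (-1 - s) * heat N t z) (Set.Ioi 0) ∧
    ∫ t in Set.Ioi (0 : ℝ), s / Real.Gamma (1 - s) * t ^ (-1 - s) * heat N t z =
      fracLapConst N s * ‖z‖ ^ (-((N : ℝ) + 2 * s)) := by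
  obtain ⟨h1, h2⟩ := integral_rpow_mul_heat (N := N) (a := -s)
    (by have := N.cast_nonneg (α := ℝ); linarith) hz
  rw [show -s - 1 = -1 - s by ring] at h1 h2
  simp only [mul_assoc] at h1 h2 ⊢
  refine ⟨h1.const_mul _, ?_⟩
  rw [integral_const_mul, h2, fracLapConst,
    show ((N : ℝ) + 2 * s) / 2 = (N : ℝ) / 2 - -s by ring,
    show 2 * -s - (N : ℝ) = -((N : ℝ) + 2 * s) by ring, show -2 * -s = 2 * s by ring]
  ring

/-- The second difference of the heat kernel is dominated by a wider heat kernel. -/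
lemma abs_heat_second_difference_le {r : ℝ} (hr : 0 < r) {y : Space N} (hy : ‖y‖ ^ 2 ≤ r)
    (z : Space N) :
    |2 * heat N r z - heat N r (z - y) - heat N r (z + y)| ≤
      4 * 4 ^ ((N : ℝ) / 2) * (‖y‖ ^ 2 / r) * heat N (4 * r) z := by
  have hpi := Real.pi_pos
  -- In this notation the heat kernel at `z ∓ y` is `A e^(-4q) e^(-a) e^(±b)`, so the second
  -- difference equals `2 A e^(-4q) (1 - e^(-a) cosh b)`. The kernel at time `4r` is a multiple of
  -- `e^(-q)`, so a loss of `e^(3q)` is affordable.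
  set A := (4 * Real.pi * r) ^ (-((N : ℝ) / 2)) with hA
  have hA0 : 0 < A := by positivity
  set a := ‖y‖ ^ 2 / (4 * r) with ha
  have ha0 : 0 ≤ a := by positivity
  set b := inner ℝ z y / (2 * r) with hb
  set q := ‖z‖ ^ 2 / (16 * r) with hq
  have hq0 : 0 ≤ q := by positivity
  have e0 : heat N r z = A * Real.exp (-(4 * q)) := by
    rw [heat, hq]; congr 2; field_simp; ring
  have e1 : heat N r (z - y) = A * (Real.exp (-(4 * q)) * Real.exp (-a) * Real.exp b) := by
    rw [heat, norm_sub_sq_real, ← Real.exp_add, ← Real.exp_add, hq, ha, hb]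
    congr 2; field_simp; ring
  have e2 : heat N r (z + y) = A * (Real.exp (-(4 * q)) * Real.exp (-a) * Real.exp (-b)) := by
    rw [heat, norm_add_sq_real, ← Real.exp_add, ← Real.exp_add, hq, ha, hb]
    congr 2; field_simp; ring
  have e3 : 4 ^ ((N : ℝ) / 2) * heat N (4 * r) z = A * Real.exp (-q) := by
    rw [heat, show 4 * Real.pi * (4 * r) = 4 * (4 * Real.pi * r) by ring,
      Real.mul_rpow (by norm_num) (by positivity), ← hA, Real.rpow_neg (by norm_num : (0:ℝ) ≤ 4),
      hq]
    have : (4 : ℝ) ^ ((N : ℝ) / 2) ≠ 0 := by positivity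
    rw [mul_assoc, mul_inv_cancel_left₀ this]
    congr 2; field_simp; ring
  -- Cauchy–Schwarz. This keeps the small factor `|y|²/r`, while `|y|² ≤ r` also gives `e^(b²/2) ≤
  -- e^(2q)`.
  have hb2 : b ^ 2 / 2 ≤ 2 * q * (‖y‖ ^ 2 / r) := by
    have h1 : (inner ℝ z y) ^ 2 ≤ (‖z‖ * ‖y‖) ^ 2 :=
      sq_le_sq' (by have := abs_le.1 (abs_real_inner_le_norm z y); linarith [this.1])
        (real_inner_le_norm z y)
    rw [hb, hq, div_pow, div_div, mul_pow] at *
    calc (inner ℝ z y) ^ 2 / (2 ^ 2 * r ^ 2 * 2) ≤ (‖z‖ ^ 2 * ‖y‖ ^ 2) / (2 ^ 2 * r ^ 2 * 2) := by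
          gcongr
      _ = _ := by field_simp; ring
  have hyr : ‖y‖ ^ 2 / r ≤ 1 := by rwa [div_le_one hr]
  have hb3 : b ^ 2 / 2 ≤ 2 * q := hb2.trans (mul_le_of_le_one_right (by positivity) hyr)
  -- From `cosh b ≤ e^(b²/2)` and `e^v - 1 ≤ v e^v`.
  have hcosh1 : Real.cosh b - 1 ≤ b ^ 2 / 2 * Real.exp (2 * q) := by
    have h1 := Real.cosh_le_exp_half_sq b
    have h2 : 1 - b ^ 2 / 2 ≤ Real.exp (-(b ^ 2 / 2)) := by
      have := Real.add_one_le_exp (-(b ^ 2 / 2)); linarith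
    have h3 : Real.exp (b ^ 2 / 2) - 1 ≤ b ^ 2 / 2 * Real.exp (b ^ 2 / 2) := by
      have h4 : Real.exp (b ^ 2 / 2) * Real.exp (-(b ^ 2 / 2)) = 1 := by
        rw [← Real.exp_add]; simp
      nlinarith [Real.exp_pos (b ^ 2 / 2)]
    have h5 : Real.exp (b ^ 2 / 2) ≤ Real.exp (2 * q) := Real.exp_le_exp.2 hb3
    have h6 : 0 ≤ b ^ 2 / 2 := by positivity
    nlinarith
  have hcosh0 : 1 ≤ Real.cosh b := Real.one_le_cosh b
  have hea : 1 - a ≤ Real.exp (-a) := by have := Real.add_one_le_exp (-a); linarith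
  have hea1 : Real.exp (-a) ≤ 1 := Real.exp_le_one_iff.2 (by linarith)
  have hmain : |1 - Real.exp (-a) * Real.cosh b| ≤ 2 * (‖y‖ ^ 2 / r) * Real.exp (3 * q) := by
    have h1 : |1 - Real.exp (-a) * Real.cosh b| ≤ a + b ^ 2 / 2 * Real.exp (2 * q) := by
      rw [abs_le]
      have := Real.exp_pos (-a)
      constructor <;> nlinarith
    have h2 : a = 1 / 4 * (‖y‖ ^ 2 / r) := by rw [ha]; field_simp
    have h3 : b ^ 2 / 2 * Real.exp (2 * q) ≤ 2 * q * (‖y‖ ^ 2 / r) * Real.exp (2 * q) := by gcongr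
    have h4 : 1 / 4 ≤ 1 / 4 * Real.exp (2 * q) := by
      have := Real.one_le_exp (by positivity : 0 ≤ 2 * q); linarith
    -- The linear factor in `q` costs one more `e^q`, for a total loss of `e^(3q)`.
    have h5 : (1 / 4 + 2 * q) ≤ 2 * Real.exp q := by
      have := Real.add_one_le_exp q; linarith
    have h6 : Real.exp (3 * q) = Real.exp q * Real.exp (2 * q) := by
      rw [← Real.exp_add]; congr 1; ring
    have hk : 0 ≤ ‖y‖ ^ 2 / r := by positivity
    calc _ ≤ a + b ^ 2 / 2 * Real.exp (2 * q) := h1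
      _ ≤ (1 / 4 * Real.exp (2 * q)) * (‖y‖ ^ 2 / r) +
          2 * q * (‖y‖ ^ 2 / r) * Real.exp (2 * q) := by
        rw [h2]
        exact add_le_add (mul_le_mul_of_nonneg_right h4 hk) h3
      _ = (‖y‖ ^ 2 / r) * Real.exp (2 * q) * (1 / 4 + 2 * q) := by ring
      _ ≤ (‖y‖ ^ 2 / r) * Real.exp (2 * q) * (2 * Real.exp q) := by gcongr
      _ = _ := by rw [h6]; ring
  have e4 : 2 * heat N r z - heat N r (z - y) - heat N r (z + y) =
      2 * A * Real.exp (-(4 * q)) * (1 - Real.exp (-a) * Real.cosh b) := by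
    rw [e0, e1, e2, Real.cosh_eq]; ring
  rw [e4, abs_mul, abs_of_pos (by positivity)]
  calc _ ≤ 2 * A * Real.exp (-(4 * q)) * (2 * (‖y‖ ^ 2 / r) * Real.exp (3 * q)) := by gcongr
    _ = 4 * (‖y‖ ^ 2 / r) * (A * Real.exp (-q)) := by
      rw [show -q = -(4 * q) + 3 * q by ring, Real.exp_add]; ring
    _ = _ := by rw [← e3]; ring

/-- Polynomial growth is absorbed by doubling the time: `|z|^β` is at most a constant times
`exp(|z|²/(8t))`, which is the ratio of the two Gaussians up to a constant. -/
lemma integrable_heat_mul_norm_rpow {β t : ℝ} (hβ : 0 ≤ β) (ht : 0 < t) :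
    Integrable fun z : Space N => heat N t z * ‖z‖ ^ β := by
  have hpi := Real.pi_pos
  obtain ⟨n, hn⟩ := exists_nat_ge β
  set K := n.factorial * Real.exp (2 * t) with hK
  have hle : ∀ z : Space N, heat N t z * ‖z‖ ^ β ≤
      (1 + K) * (2 : ℝ) ^ ((N : ℝ) / 2) * heat N (2 * t) z := by
    intro z
    have h1 : ‖z‖ ^ β ≤ 1 + ‖z‖ ^ n := by
      rcases le_total ‖z‖ 1 with h | h
      · have := Real.rpow_le_one (norm_nonneg z) h hβ
        have : 0 ≤ ‖z‖ ^ n := by positivity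
        linarith
      · have := Real.rpow_le_rpow_of_exponent_le h hn
        rw [Real.rpow_natCast] at this
        linarith
    have h2 : ‖z‖ ^ n ≤ n.factorial * Real.exp ‖z‖ := by
      have := Real.pow_div_factorial_le_exp ‖z‖ (norm_nonneg z) n
      rwa [div_le_iff₀' (by positivity)] at this
    -- This is `(|z| - 4t)² ≥ 0`.
    have h3 : Real.exp ‖z‖ ≤ Real.exp (2 * t) * Real.exp (1 / (8 * t) * ‖z‖ ^ 2) := by
      rw [← Real.exp_add, Real.exp_le_exp]
      have : 2 * t + 1 / (8 * t) * ‖z‖ ^ 2 - ‖z‖ = (1 / (8 * t)) * (‖z‖ - 4 * t) ^ 2 := by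
        field_simp; ring
      have : 0 ≤ (1 / (8 * t)) * (‖z‖ - 4 * t) ^ 2 := by positivity
      linarith
    have h4 : 1 ≤ Real.exp (1 / (8 * t) * ‖z‖ ^ 2) := Real.one_le_exp (by positivity)
    have h5 : ‖z‖ ^ β ≤ (1 + K) * Real.exp (1 / (8 * t) * ‖z‖ ^ 2) := by
      have : (n.factorial : ℝ) * Real.exp ‖z‖ ≤ K * Real.exp (1 / (8 * t) * ‖z‖ ^ 2) := by
        rw [hK, mul_assoc]; gcongr
      linarith
    have h6 : heat N t z * Real.exp (1 / (8 * t) * ‖z‖ ^ 2) =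
        (2 : ℝ) ^ ((N : ℝ) / 2) * heat N (2 * t) z := by
      rw [heat, heat, show 4 * Real.pi * (2 * t) = 2 * (4 * Real.pi * t) by ring,
        Real.mul_rpow (by norm_num : (0:ℝ) ≤ 2) (by positivity : 0 ≤ 4 * Real.pi * t), Real.rpow_neg (by norm_num : (0:ℝ) ≤ 2),
        mul_assoc, ← Real.exp_add]
      have : (2 : ℝ) ^ ((N : ℝ) / 2) ≠ 0 := by positivity
      rw [mul_assoc _ (_ ^ _) (Real.exp _), mul_inv_cancel_left₀ this]
      congr 2; field_simp; ring
    calc _ ≤ heat N t z * ((1 + K) * Real.exp (1 / (8 * t) * ‖z‖ ^ 2)) := by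
          gcongr; exact heat_nonneg ht.le z
      _ = (1 + K) * (heat N t z * Real.exp (1 / (8 * t) * ‖z‖ ^ 2)) := by ring
      _ = _ := by rw [h6]; ring
  refine Integrable.mono' ((integrable_heat (t := 2 * t) (by positivity)).const_mul
    ((1 + K) * (2 : ℝ) ^ ((N : ℝ) / 2))) ?_ (ae_of_all _ fun z => ?_)
  · exact ((continuous_heat t).mul (continuous_norm.rpow_const fun _ => Or.inr hβ)).aestronglyMeasurable
  · rw [Real.norm_of_nonneg (mul_nonneg (heat_nonneg ht.le z) (by positivity))]
    exact hle z

end Heat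

/-! ### Superpositions of heat kernels -/

section Subordination

variable {N : ℕ}

/-- The heat flow of a nonnegative extended-valued function. -/
noncomputable def lheatFlow (N : ℕ) (t : ℝ) (F : Space N → ℝ≥0∞) (x : Space N) : ℝ≥0∞ :=
  ∫⁻ z, ENNReal.ofReal (heat N t z) * F (x - z)

lemma measurable_ofReal_heat : Measurable fun p : ℝ × Space N => ENNReal.ofReal (heat N p.1 p.2) :=
  measurable_heat_uncurry.ennreal_ofReal

lemma measurable_ofReal_heat_time (z : Space N) :
    Measurable fun t => ENNReal.ofReal (heat N t z) := by
  unfold heat; fun_prop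

lemma measurable_lheatFlow {F : Space N → ℝ≥0∞} (hF : Measurable F) :
    Measurable fun p : ℝ × Space N => lheatFlow N p.1 F p.2 := by
  have h1 : Measurable fun q : (ℝ × Space N) × Space N => ENNReal.ofReal (heat N q.1.1 q.2) :=
    measurable_ofReal_heat.comp ((measurable_fst.comp measurable_fst).prodMk measurable_snd)
  have h2 : Measurable fun q : (ℝ × Space N) × Space N => F (q.1.2 - q.2) :=
    hF.comp ((continuous_snd.comp continuous_fst).sub continuous_snd).measurable
  exact (h1.mul h2).lintegral_prod_right'

lemma measurable_comp_const_sub {F : Space N → ℝ≥0∞} (hF : Measurable F) (x : Space N) :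
    Measurable fun z => F (x - z) :=
  hF.comp (continuous_const.sub continuous_id).measurable

/-- Tonelli's theorem for a superposition of heat kernels. -/
lemma setLIntegral_mul_lheatFlow {w : ℝ → ℝ≥0∞} (hw : Measurable w) {F : Space N → ℝ≥0∞}
    (hF : Measurable F) (x : Space N) :
    ∫⁻ t in Set.Ioi (0 : ℝ), w t * lheatFlow N t F x =
      ∫⁻ z, (∫⁻ t in Set.Ioi (0 : ℝ), w t * ENNReal.ofReal (heat N t z)) * F (x - z) := by
  have hm : Measurable fun p : ℝ × Space N =>
      w p.1 * ENNReal.ofReal (heat N p.1 p.2) * F (x - p.2) :=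
    ((hw.comp measurable_fst).mul measurable_ofReal_heat).mul
      ((measurable_comp_const_sub hF x).comp measurable_snd)
  have hz : ∀ t, Measurable fun z : Space N => ENNReal.ofReal (heat N t z) * F (x - z) := fun t =>
    ((continuous_heat t).measurable.ennreal_ofReal).mul (measurable_comp_const_sub hF x)
  have ht : ∀ z : Space N, Measurable fun t => w t * ENNReal.ofReal (heat N t z) := fun z =>
    hw.mul (measurable_ofReal_heat_time z)
  calc _ = ∫⁻ t in Set.Ioi (0 : ℝ), ∫⁻ z, w t * ENNReal.ofReal (heat N t z) * F (x - z) := by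
        refine lintegral_congr fun t => ?_
        rw [lheatFlow, ← lintegral_const_mul _ (hz t)]
        simp only [mul_assoc]
    _ = ∫⁻ z, ∫⁻ t in Set.Ioi (0 : ℝ), w t * ENNReal.ofReal (heat N t z) * F (x - z) :=
        lintegral_lintegral_swap hm.aemeasurable
    _ = _ := lintegral_congr fun z => lintegral_mul_const _ (ht z)

/-- The semigroup property of the heat flow. -/
lemma lheatFlow_lheatFlow {t r : ℝ} (ht : 0 < t) (hr : 0 < r) {F : Space N → ℝ≥0∞}
    (hF : Measurable F) (x : Space N) :
    lheatFlow N t (lheatFlow N r F) x = lheatFlow N (t + r) F x := by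
  have hc : ∀ t, Measurable fun z : Space N => ENNReal.ofReal (heat N t z) := fun t =>
    (continuous_heat t).measurable.ennreal_ofReal
  have h1 : ∀ y, lheatFlow N r F (x - y) =
      ∫⁻ z, ENNReal.ofReal (heat N r (z - y)) * F (x - z) := fun y => by
    rw [lheatFlow, ← lintegral_sub_right_eq_self _ y]
    simp only [sub_sub, add_sub_cancel]
  have h2 : ∀ y, Measurable fun z : Space N => ENNReal.ofReal (heat N r (z - y)) * F (x - z) :=
    fun y => ((hc r).comp (continuous_id.sub continuous_const).measurable).mul
      (measurable_comp_const_sub hF x)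
  have h3 : ∀ z, Measurable fun y : Space N =>
      ENNReal.ofReal (heat N t y) * ENNReal.ofReal (heat N r (z - y)) := fun z =>
    (hc t).mul ((hc r).comp (continuous_const.sub continuous_id).measurable)
  have hm : Measurable fun p : Space N × Space N => ENNReal.ofReal (heat N t p.1) *
      ENNReal.ofReal (heat N r (p.2 - p.1)) * F (x - p.2) :=
    (((hc t).comp measurable_fst).mul
      ((hc r).comp (continuous_snd.sub continuous_fst).measurable)).mul
      ((measurable_comp_const_sub hF x).comp measurable_snd)
  rw [lheatFlow]
  simp only [h1]
  calc _ = ∫⁻ y, ∫⁻ z, ENNReal.ofReal (heat N t y) *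
        ENNReal.ofReal (heat N r (z - y)) * F (x - z) := by
        refine lintegral_congr fun y => ?_
        rw [← lintegral_const_mul _ (h2 y)]
        simp only [mul_assoc]
    _ = ∫⁻ z, ∫⁻ y, ENNReal.ofReal (heat N t y) *
        ENNReal.ofReal (heat N r (z - y)) * F (x - z) := lintegral_lintegral_swap hm.aemeasurable
    _ = _ := by
        rw [lheatFlow]
        refine lintegral_congr fun z => ?_
        rw [lintegral_mul_const _ (h3 z), lintegral_heat_mul_heat ht hr]

lemma measurable_lheatFlow_time {F : Space N → ℝ≥0∞} (hF : Measurable F) (x : Space N) :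
    Measurable fun t => lheatFlow N t F x :=
  (measurable_lheatFlow hF).comp (measurable_id.prodMk measurable_const)

lemma measurable_lheatFlow_space {F : Space N → ℝ≥0∞} (hF : Measurable F) (t : ℝ) :
    Measurable (lheatFlow N t F) :=
  (measurable_lheatFlow hF).comp (measurable_const.prodMk measurable_id)

lemma measurable_lheatFlow_snd_fst {F : Space N → ℝ≥0∞} (hF : Measurable F) :
    Measurable fun p : Space N × ℝ => lheatFlow N p.2 F p.1 :=
  (measurable_lheatFlow hF).comp measurable_swap

lemma measurable_lheatFlow_const_sub {F : Space N → ℝ≥0∞} (hF : Measurable F) (x : Space N) :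
    Measurable fun p : Space N × ℝ => lheatFlow N p.2 F (x - p.1) := by
  have h : Measurable fun p : Space N × ℝ => (x - p.1, p.2) :=
    ((continuous_const.sub continuous_id).measurable.comp measurable_fst).prodMk measurable_snd
  exact (measurable_lheatFlow_snd_fst hF).comp h

lemma measurable_superposition {w : ℝ → ℝ≥0∞} (hw : Measurable w) {F : Space N → ℝ≥0∞}
    (hF : Measurable F) :
    Measurable fun y => ∫⁻ r in Set.Ioi (0 : ℝ), w r * lheatFlow N r F y := by
  have hUm : Measurable fun p : Space N × ℝ => w p.2 * lheatFlow N p.2 F p.1 :=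
    (hw.comp measurable_snd).mul (measurable_lheatFlow_snd_fst hF)
  exact hUm.lintegral_prod_right'

lemma lheatFlow_superposition {w : ℝ → ℝ≥0∞} (hw : Measurable w) {F : Space N → ℝ≥0∞}
    (hF : Measurable F) {t : ℝ} (ht : 0 < t) (x : Space N) :
    lheatFlow N t (fun y => ∫⁻ r in Set.Ioi (0 : ℝ), w r * lheatFlow N r F y) x =
      ∫⁻ r in Set.Ioi (0 : ℝ), w r * lheatFlow N (t + r) F x := by
  have h1 : Measurable fun p : Space N × ℝ => ENNReal.ofReal (heat N t p.1) :=
    (continuous_heat t).measurable.ennreal_ofReal.comp measurable_fst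
  have h2 := measurable_lheatFlow_const_sub hF x
  have hm : Measurable fun p : Space N × ℝ => ENNReal.ofReal (heat N t p.1) *
      (w p.2 * lheatFlow N p.2 F (x - p.1)) :=
    h1.mul ((hw.comp measurable_snd).mul h2)
  calc _ = ∫⁻ y, ∫⁻ r in Set.Ioi (0 : ℝ), ENNReal.ofReal (heat N t y) *
        (w r * lheatFlow N r F (x - y)) := by
        rw [lheatFlow]
        refine lintegral_congr fun y => ?_
        rw [lintegral_const_mul' _ _ ENNReal.ofReal_ne_top]
    _ = ∫⁻ r in Set.Ioi (0 : ℝ), ∫⁻ y, ENNReal.ofReal (heat N t y) *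
        (w r * lheatFlow N r F (x - y)) := lintegral_lintegral_swap hm.aemeasurable
    _ = _ := by
        refine setLIntegral_congr_fun measurableSet_Ioi fun r hr => ?_
        have h3 : Measurable fun y => ENNReal.ofReal (heat N t y) * lheatFlow N r F (x - y) :=
          (continuous_heat t).measurable.ennreal_ofReal.mul
            (measurable_comp_const_sub (measurable_lheatFlow_space hF r) x)
        simp only [mul_left_comm _ (w r)]
        rw [lintegral_const_mul _ h3, ← lheatFlow_lheatFlow ht hr hF]
        rfl

/-- Tonelli's theorem for an additive convolution on the half-line. -/
lemma setLIntegral_mul_setLIntegral_comp_add {w₁ w₂ φ : ℝ → ℝ≥0∞} (h₁ : Measurable w₁)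
    (h₂ : Measurable w₂) (hφ : Measurable φ) :
    ∫⁻ t in Set.Ioi (0 : ℝ), w₁ t * ∫⁻ r in Set.Ioi (0 : ℝ), w₂ r * φ (t + r) =
      ∫⁻ ρ in Set.Ioi (0 : ℝ), (∫⁻ t in Set.Ioo 0 ρ, w₁ t * w₂ (ρ - t)) * φ ρ := by
  -- The joint weight after the substitution `ρ = t + r`; the condition `r > 0` becomes `t < ρ`.
  set k : ℝ × ℝ → ℝ≥0∞ :=
    {p : ℝ × ℝ | p.1 < p.2}.indicator fun p => w₁ p.1 * w₂ (p.2 - p.1) with hk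
  have hkm : Measurable k :=
    ((h₁.comp measurable_fst).mul (h₂.comp (measurable_snd.sub measurable_fst))).indicator
      (measurableSet_lt measurable_fst measurable_snd)
  have hk1 : ∀ {t ρ : ℝ}, t < ρ → k (t, ρ) = w₁ t * w₂ (ρ - t) := fun {t ρ} h =>
    Set.indicator_of_mem (s := {p : ℝ × ℝ | p.1 < p.2}) (a := (t, ρ)) h _
  have hk0 : ∀ {t ρ : ℝ}, ¬ t < ρ → k (t, ρ) = 0 := fun {t ρ} h =>
    Set.indicator_of_notMem (s := {p : ℝ × ℝ | p.1 < p.2}) (a := (t, ρ)) h _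
  have hm : Measurable fun p : ℝ × ℝ => k p * φ p.2 := hkm.mul (hφ.comp measurable_snd)
  calc _ = ∫⁻ t in Set.Ioi (0 : ℝ), ∫⁻ ρ, k (t, ρ) * φ ρ := by
        refine lintegral_congr fun t => ?_
        have hmt : Measurable fun r => (Set.Ioi (0 : ℝ)).indicator (fun r => w₂ r * φ (t + r)) r :=
          (h₂.mul (hφ.comp (measurable_id.const_add t))).indicator measurableSet_Ioi
        rw [← lintegral_indicator measurableSet_Ioi, ← lintegral_const_mul _ hmt,
          ← lintegral_sub_right_eq_self _ t]
        refine lintegral_congr fun ρ => ?_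
        by_cases h : t < ρ
        · rw [Set.indicator_of_mem (by simpa using h), hk1 h, add_sub_cancel, mul_assoc]
        · rw [Set.indicator_of_notMem (by simpa using h), hk0 h, mul_zero, zero_mul]
    _ = ∫⁻ ρ, ∫⁻ t in Set.Ioi (0 : ℝ), k (t, ρ) * φ ρ := lintegral_lintegral_swap hm.aemeasurable
    _ = ∫⁻ ρ, (Set.Ioi (0 : ℝ)).indicator (fun ρ =>
        (∫⁻ t in Set.Ioo 0 ρ, w₁ t * w₂ (ρ - t)) * φ ρ) ρ := by
        refine lintegral_congr fun ρ => ?_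
        have h4 : Measurable fun t : ℝ => k (t, ρ) :=
          hkm.comp (measurable_id.prodMk measurable_const)
        have h5 : ∫⁻ t in Set.Ioi (0 : ℝ), k (t, ρ) =
            ∫⁻ t in Set.Ioo 0 ρ, w₁ t * w₂ (ρ - t) := by
          rw [← lintegral_indicator measurableSet_Ioi, ← lintegral_indicator measurableSet_Ioo]
          refine lintegral_congr fun t => ?_
          by_cases h0 : 0 < t
          · rw [Set.indicator_of_mem (by simpa using h0)]
            by_cases h : t < ρ
            · rw [hk1 h, Set.indicator_of_mem (Set.mem_Ioo.2 ⟨h0, h⟩)]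
            · rw [hk0 h, Set.indicator_of_notMem fun h' => h (Set.mem_Ioo.1 h').2]
          · rw [Set.indicator_of_notMem (by simpa using h0),
              Set.indicator_of_notMem fun h' => h0 (Set.mem_Ioo.1 h').1]
        rw [lintegral_mul_const _ h4, h5]
        by_cases h : 0 < ρ
        · rw [Set.indicator_of_mem (by simpa using h)]
        · rw [Set.indicator_of_notMem (by simpa using h), Set.Ioo_eq_empty h]
          simp
    _ = _ := lintegral_indicator measurableSet_Ioi _

/-- Composition of two superpositions of heat flows. -/
lemma lintegral_superposition_mul {w₁ w₂ : ℝ → ℝ≥0∞} (h₁ : Measurable w₁) (h₂ : Measurable w₂)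
    {F : Space N → ℝ≥0∞} (hF : Measurable F) (x : Space N) :
    ∫⁻ y, (∫⁻ t in Set.Ioi (0 : ℝ), w₁ t * ENNReal.ofReal (heat N t y)) *
        (∫⁻ r in Set.Ioi (0 : ℝ), w₂ r * lheatFlow N r F (x - y)) =
      ∫⁻ ρ in Set.Ioi (0 : ℝ), (∫⁻ t in Set.Ioo 0 ρ, w₁ t * w₂ (ρ - t)) * lheatFlow N ρ F x := by
  rw [← setLIntegral_mul_lheatFlow h₁ (measurable_superposition h₂ hF) x,
    ← setLIntegral_mul_setLIntegral_comp_add h₁ h₂ (measurable_lheatFlow_time hF x)]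
  refine setLIntegral_congr_fun measurableSet_Ioi fun t ht => ?_
  simp only [lheatFlow_superposition h₂ hF ht]

end Subordination

/-! ### Two one-dimensional integrals -/

/-- Up to Gamma factors this is the time density obtained by composing the regularised kernel with
the Riesz kernel. It has the antiderivative `-((ρ-t)/(t+τ))^s / (s(ρ+τ))`. -/
lemma setLIntegral_Ioo_rpow_mul_rpow {s τ ρ : ℝ} (hs0 : 0 < s) (hτ : 0 < τ)
    (hρ : 0 < ρ) :
    ∫⁻ t in Set.Ioo 0 ρ, ENNReal.ofReal ((t + τ) ^ (-1 - s) * (ρ - t) ^ (s - 1)) =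
      ENNReal.ofReal (ρ ^ s * τ ^ (-s) / (s * (ρ + τ))) := by
  set H : ℝ → ℝ := fun t => -(1 / (s * (ρ + τ))) * ((ρ - t) / (t + τ)) ^ s with hH
  have hcont : ContinuousOn H (Set.Icc 0 ρ) := by
    refine ContinuousOn.mul continuousOn_const (ContinuousOn.rpow_const ?_ fun t _ => Or.inr hs0.le)
    exact ContinuousOn.div (by fun_prop) (by fun_prop) fun t ht => by
      have := ht.1; positivity
  have hderiv : ∀ t ∈ Set.Ioo 0 ρ, HasDerivAt H ((t + τ) ^ (-1 - s) * (ρ - t) ^ (s - 1)) t := by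
    intro t ht
    have h1 : 0 < ρ - t := by linarith [ht.2]
    have h2 : 0 < t + τ := by linarith [ht.1]
    have hd : HasDerivAt (fun t => (ρ - t) / (t + τ))
        ((-1 * (t + τ) - (ρ - t) * 1) / (t + τ) ^ 2) t :=
      ((hasDerivAt_id t).const_sub ρ).div ((hasDerivAt_id t).add_const τ) h2.ne'
    have := (hd.rpow_const (p := s) (Or.inl (by positivity))).const_mul (-(1 / (s * (ρ + τ))))
    refine this.congr_deriv ?_
    have e : (t + τ) ^ (-1 - s) = ((t + τ) ^ (s - 1))⁻¹ * ((t + τ) ^ 2)⁻¹ := by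
      rw [← Real.rpow_two, ← Real.rpow_neg h2.le, ← Real.rpow_neg h2.le, ← Real.rpow_add h2]
      congr 1; ring
    rw [Real.div_rpow h1.le h2.le, e]
    have h3 : (t + τ) ^ (s - 1) ≠ 0 := by positivity
    field_simp
    ring
  have hpos : ∀ t ∈ Set.Ioo 0 ρ, 0 ≤ (t + τ) ^ (-1 - s) * (ρ - t) ^ (s - 1) := by
    intro t ht
    have h1 : 0 < ρ - t := by linarith [ht.2]
    have h2 : 0 < t + τ := by linarith [ht.1]
    positivity
  -- The integrand may blow up at `t = ρ`; integrability follows because it is the nonnegative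
  -- derivative of a function continuous up to the endpoints.
  have hint := intervalIntegral.integrableOn_deriv_of_nonneg hcont hderiv hpos
  rw [← ofReal_integral_eq_lintegral_ofReal (hint.mono_set Set.Ioo_subset_Ioc_self)
    ((ae_restrict_iff' measurableSet_Ioo).2 (ae_of_all _ hpos)),
    ← integral_Ioc_eq_integral_Ioo, ← intervalIntegral.integral_of_le hρ.le,
    intervalIntegral.integral_eq_sub_of_hasDerivAt_of_le hρ.le hcont hderiv
      ((intervalIntegrable_iff_integrableOn_Ioc_of_le hρ.le).2 hint)]
  congr 1
  simp only [hH, sub_self, zero_div, Real.zero_rpow hs0.ne', sub_zero, zero_add, mul_zero]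
  rw [Real.div_rpow hρ.le hτ.le, Real.rpow_neg hτ.le]
  ring

lemma integral_Ioi_add_rpow {s τ : ℝ} (hs0 : 0 < s) (hτ : 0 < τ) :
    IntegrableOn (fun t : ℝ => (t + τ) ^ (-1 - s)) (Set.Ioi 0) ∧
    ∫ t in Set.Ioi (0 : ℝ), (t + τ) ^ (-1 - s) = τ ^ (-s) / s := by
  have h1 : -1 - s < -1 := by linarith
  have h2 : -τ < 0 := by linarith
  refine ⟨integrableOn_add_rpow_Ioi_of_lt h1 (by linarith), ?_⟩
  have := (measurePreserving_add_right volume τ).setIntegral_preimage_emb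
    (measurableEmbedding_addRight τ) (fun t : ℝ => t ^ (-1 - s)) (Set.Ioi τ)
  rw [Set.preimage_add_const_Ioi, sub_self] at this
  rw [this, integral_Ioi_rpow_of_lt h1 hτ, show -1 - s + 1 = -s by ring, div_neg, neg_div,
    neg_neg]

/-- The beta integral on the half-line. -/
lemma integral_Ioi_rpow_div_one_add {s : ℝ} (hs0 : 0 < s) (hs1 : s < 1) :
    IntegrableOn (fun ρ : ℝ => ρ ^ (s - 1) / (1 + ρ)) (Set.Ioi 0) ∧
    ∫ ρ in Set.Ioi (0 : ℝ), ρ ^ (s - 1) / (1 + ρ) = Real.Gamma s * Real.Gamma (1 - s) := by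
  have hG1 := Real.Gamma_pos_of_pos hs0
  have hG2 := Real.Gamma_pos_of_pos (sub_pos.2 hs1)
  have hpow : ∀ {a b : ℝ}, 0 < a → 0 < b →
      ∫⁻ t in Set.Ioi (0 : ℝ), ENNReal.ofReal (t ^ (a - 1) * Real.exp (-(b * t))) =
        ENNReal.ofReal ((1 / b) ^ a * Real.Gamma a) := by
    intro a b ha hb
    have hi : IntegrableOn (fun t : ℝ => t ^ (a - 1) * Real.exp (-(b * t))) (Set.Ioi 0) := by
      refine Integrable.of_integral_ne_zero ?_
      rw [Real.integral_rpow_mul_exp_neg_mul_Ioi ha hb]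
      have := Real.Gamma_pos_of_pos ha
      positivity
    rw [← Real.integral_rpow_mul_exp_neg_mul_Ioi ha hb, ofReal_integral_eq_lintegral_ofReal hi]
    filter_upwards [ae_restrict_mem measurableSet_Ioi] with t ht
    have ht : 0 < t := ht
    positivity
  -- Write `1/(1+ρ)` as the integral of `e^(-(1+ρ)v)` over `v > 0`; integrating in `ρ` first gives
  -- `Γ(s) v^(-s) e^(-v)`, and then `Γ(1-s)` appears.
  have hswap := lintegral_lintegral_swap (μ := volume.restrict (Set.Ioi (0 : ℝ)))
    (ν := volume.restrict (Set.Ioi (0 : ℝ)))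
    (f := fun ρ v : ℝ => ENNReal.ofReal (ρ ^ (s - 1) * Real.exp (-((1 + ρ) * v))))
    (Measurable.aemeasurable (by unfold Function.uncurry; fun_prop))
  have hL : ∫⁻ ρ in Set.Ioi (0 : ℝ), ∫⁻ v in Set.Ioi (0 : ℝ),
      ENNReal.ofReal (ρ ^ (s - 1) * Real.exp (-((1 + ρ) * v))) =
      ∫⁻ ρ in Set.Ioi (0 : ℝ), ENNReal.ofReal (ρ ^ (s - 1) / (1 + ρ)) := by
    refine setLIntegral_congr_fun measurableSet_Ioi fun ρ hρ => ?_
    have hρ : 0 < ρ := hρ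
    have := hpow (a := 1) (b := 1 + ρ) one_pos (by positivity)
    simp only [sub_self, Real.rpow_zero, one_mul, Real.rpow_one, Real.Gamma_one, mul_one] at this
    simp only [ENNReal.ofReal_mul (by positivity : 0 ≤ ρ ^ (s - 1))]
    rw [lintegral_const_mul' _ _ ENNReal.ofReal_ne_top, this, div_eq_mul_one_div (ρ ^ (s - 1)),
      ENNReal.ofReal_mul (by positivity)]
  have hR : ∫⁻ v in Set.Ioi (0 : ℝ), ∫⁻ ρ in Set.Ioi (0 : ℝ),
      ENNReal.ofReal (ρ ^ (s - 1) * Real.exp (-((1 + ρ) * v))) =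
      ENNReal.ofReal (Real.Gamma s * Real.Gamma (1 - s)) := by
    have : ∀ v ∈ Set.Ioi (0 : ℝ), ∫⁻ ρ in Set.Ioi (0 : ℝ),
        ENNReal.ofReal (ρ ^ (s - 1) * Real.exp (-((1 + ρ) * v))) =
        ENNReal.ofReal (Real.Gamma s) *
          ENNReal.ofReal (v ^ ((1 - s) - 1) * Real.exp (-(1 * v))) := by
      intro v hv
      have hv : 0 < v := hv
      have e : ∀ ρ : ℝ, ρ ^ (s - 1) * Real.exp (-((1 + ρ) * v)) =
          Real.exp (-(1 * v)) * (ρ ^ (s - 1) * Real.exp (-(v * ρ))) := fun ρ => by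
        rw [mul_left_comm, ← Real.exp_add]; congr 2; ring
      simp only [e, ENNReal.ofReal_mul (Real.exp_pos (-(1 * v))).le]
      rw [lintegral_const_mul' _ _ ENNReal.ofReal_ne_top, hpow hs0 hv,
        ← ENNReal.ofReal_mul (Real.exp_pos _).le, ← ENNReal.ofReal_mul hG1.le]
      congr 1
      rw [one_div, Real.inv_rpow hv.le, ← Real.rpow_neg hv.le, show 1 - s - 1 = -s by ring]
      ring
    rw [setLIntegral_congr_fun measurableSet_Ioi this,
      lintegral_const_mul' _ _ ENNReal.ofReal_ne_top, hpow (sub_pos.2 hs1) one_pos,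
      ← ENNReal.ofReal_mul hG1.le]
    simp
  rw [hL, hR] at hswap
  have hnn : 0 ≤ᵐ[volume.restrict (Set.Ioi (0 : ℝ))] fun ρ : ℝ => ρ ^ (s - 1) / (1 + ρ) := by
    filter_upwards [ae_restrict_mem measurableSet_Ioi] with t ht
    have ht : 0 < t := ht
    simp only [Pi.zero_apply]
    positivity
  have hm : AEStronglyMeasurable (fun ρ : ℝ => ρ ^ (s - 1) / (1 + ρ))
      (volume.restrict (Set.Ioi (0 : ℝ))) :=
    (by fun_prop : Measurable fun ρ : ℝ => ρ ^ (s - 1) / (1 + ρ)).aestronglyMeasurable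
  have hint : IntegrableOn (fun ρ : ℝ => ρ ^ (s - 1) / (1 + ρ)) (Set.Ioi 0) :=
    (lintegral_ofReal_ne_top_iff_integrable hm hnn).1 (by rw [hswap]; exact ENNReal.ofReal_ne_top)
  refine ⟨hint, ?_⟩
  rw [integral_eq_lintegral_of_nonneg_ae hnn hm, hswap, ENNReal.toReal_ofReal (by positivity)]

/-! ### Regularisation of the fractional Laplacian -/

section Regularisation

variable {N : ℕ} {α : ℝ≥0} {f : Space N → ℝ} {s : ℝ}

lemma HolderCompact.exists_bound (hf : HolderCompact N α f) (hα : 0 < α) :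
    ∃ M : ℝ, 0 ≤ M ∧ ∀ x, |f x| ≤ M := by
  obtain ⟨C, hC0, hC⟩ := hf.exists_abs_le hα 0
  exact ⟨C, hC0, by simpa using hC⟩

lemma integrable_rieszKernel_mul (hN : 1 ≤ N) (hα : 0 < α) (hf : HolderCompact N α f)
    (hs : 0 < s) (x : Space N) : Integrable fun z => rieszKernel N s z * f (x - z) :=
  convolutionExists_rieszKernel hN hα hf hs x

lemma continuous_rieszPotential (hN : 1 ≤ N) (hα : 0 < α) (hf : HolderCompact N α f)
    (hs : 0 < s) : Continuous (rieszPotential N s f) :=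
  hf.2.continuous_convolution_right _ (locallyIntegrable_rieszKernel hN hs) (hf.continuous hα)

lemma rieszConst_nonneg (hs0 : 0 < s) (hsN : 2 * s < N) : 0 ≤ rieszConst N s := by
  have h1 : 0 < Real.Gamma (((N : ℝ) - 2 * s) / 2) := Real.Gamma_pos_of_pos (by linarith)
  have h2 : 0 < Real.Gamma (1 + s) := Real.Gamma_pos_of_pos (by linarith)
  have := Real.pi_pos
  unfold rieszConst kappaOne
  positivity

lemma rieszKernel_nonneg (hs0 : 0 < s) (hsN : 2 * s < N) (z : Space N) :
    0 ≤ rieszKernel N s z :=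
  mul_nonneg (rieszConst_nonneg hs0 hsN) (by positivity)

/-- If `f` vanishes outside the ball of radius `R`, only arguments of norm at least `|x| - R` enter
the kernel, whose exponent `2s - N` is negative. -/
lemma tendsto_rieszPotential_cocompact (hα : 0 < α) (hf : HolderCompact N α f)
    (hs0 : 0 < s) (hsN : 2 * s < N) :
    Tendsto (rieszPotential N s f) (cocompact (Space N)) (𝓝 0) := by
  obtain ⟨R, hR0, hR⟩ := hf.exists_radius
  have hc := hf.continuous hα
  set J := ∫ y, |f y| with hJ
  have hfi : Integrable fun y => |f y| := (hc.integrable_of_hasCompactSupport hf.2).abs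
  have hlim : Tendsto (fun x : Space N => rieszConst N s * (‖x‖ - R) ^ (-((N : ℝ) - 2 * s)) * J)
      (cocompact (Space N)) (𝓝 0) := by
    have h1 : Tendsto (fun x : Space N => ‖x‖ - R) (cocompact (Space N)) atTop :=
      tendsto_atTop_add_const_right _ _ (tendsto_norm_cocompact_atTop)
    have h2 := ((tendsto_rpow_neg_atTop (by linarith : 0 < (N : ℝ) - 2 * s)).comp h1)
    simpa using (h2.const_mul (rieszConst N s)).mul_const J
  refine squeeze_zero_norm' ?_ hlim
  filter_upwards [(tendsto_norm_cocompact_atTop (E := Space N)).eventually_gt_atTop R] with x hx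
  have hle : ∀ t, ‖rieszKernel N s t * f (x - t)‖ ≤
      rieszConst N s * (‖x‖ - R) ^ (-((N : ℝ) - 2 * s)) * |f (x - t)| := by
    intro t
    rcases eq_or_ne (f (x - t)) 0 with h | h
    · simp [h]
    · have h1 : ‖x - t‖ ≤ R := by
        by_contra h'; exact h (hR _ (not_le.1 h'))
      have h2 : ‖x‖ - R ≤ ‖t‖ := by
        have : ‖x‖ ≤ ‖x - t‖ + ‖t‖ := by simpa using norm_add_le (x - t) t
        linarith
      rw [norm_mul, Real.norm_of_nonneg (rieszKernel_nonneg hs0 hsN t), Real.norm_eq_abs,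
        rieszKernel]
      have h3 := rieszConst_nonneg hs0 hsN
      have h4 : ‖t‖ ^ (2 * s - (N : ℝ)) ≤ (‖x‖ - R) ^ (-((N : ℝ) - 2 * s)) := by
        rw [neg_sub]
        exact Real.rpow_le_rpow_of_nonpos (by linarith) h2 (by linarith)
      gcongr
  rw [rieszPotential_apply]
  refine (norm_integral_le_of_norm_le ((hfi.comp_sub_left x).const_mul _)
    (ae_of_all _ hle)).trans_eq ?_
  rw [integral_const_mul, integral_sub_left_eq_self (fun y => |f y|) volume x]

lemma exists_bound_of_tendsto_cocompact {u : Space N → ℝ} (hu : Continuous u)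
    (h0 : Tendsto u (cocompact (Space N)) (𝓝 0)) : ∃ M : ℝ, 0 ≤ M ∧ ∀ x, |u x| ≤ M := by
  let U : ZeroAtInftyContinuousMap (Space N) ℝ := ⟨⟨u, hu⟩, h0⟩
  refine ⟨‖U.toBCF‖, norm_nonneg _, fun x => ?_⟩
  exact U.toBCF.norm_coe_le_norm x

/-- The heat flow of a real function. -/
noncomputable def heatFlow (N : ℕ) (t : ℝ) (f : Space N → ℝ) (x : Space N) : ℝ :=
  ∫ z, heat N t z * f (x - z)

/-- A regularisation of the kernel `c_{N,s} |y|^{-N-2s}` of the fractional Laplacian. -/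
noncomputable def levyKernel (N : ℕ) (s τ : ℝ) (y : Space N) : ℝ :=
  ∫ t in Set.Ioi (0 : ℝ), s / Real.Gamma (1 - s) * (t + τ) ^ (-1 - s) * heat N t y

lemma continuous_comp_const_sub {u : Space N → ℝ} (hu : Continuous u) (x : Space N) :
    Continuous fun z => u (x - z) := hu.comp (continuous_const.sub continuous_id)

lemma integrable_mul_comp_const_sub {k u : Space N → ℝ} (hk : Integrable k) (hu : Continuous u)
    {M : ℝ} (hM : ∀ x, |u x| ≤ M) (x : Space N) : Integrable fun z => k z * u (x - z) :=
  hk.mul_bdd (c := M) (continuous_comp_const_sub hu x).aestronglyMeasurable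
    (ae_of_all _ fun _ => hM _)

lemma abs_heatFlow_le {M : ℝ} (hM : ∀ x, |f x| ≤ M) {t : ℝ} (ht : 0 < t) (x : Space N) :
    |heatFlow N t f x| ≤ M := by
  have h : ∀ z, ‖heat N t z * f (x - z)‖ ≤ heat N t z * M := fun z => by
    rw [norm_mul, Real.norm_of_nonneg (heat_nonneg ht.le z), Real.norm_eq_abs]
    exact mul_le_mul_of_nonneg_left (hM _) (heat_nonneg ht.le z)
  refine (norm_integral_le_of_norm_le ((integrable_heat ht).mul_const M) (ae_of_all _ h)).trans_eq ?_
  rw [integral_mul_const, integral_heat ht, one_mul]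

lemma heatFlow_nonneg (hf0 : ∀ x, 0 ≤ f x) {t : ℝ} (ht : 0 < t) (x : Space N) :
    0 ≤ heatFlow N t f x :=
  integral_nonneg fun z => mul_nonneg (heat_nonneg ht.le z) (hf0 _)

/-- After the scaling `z = √t w` the Gaussian weight no longer depends on `t`, and dominated
convergence applies. -/
lemma tendsto_heatFlow (hc : Continuous f) {M : ℝ} (hM : ∀ x, |f x| ≤ M) (x : Space N) :
    Tendsto (fun t => heatFlow N t f x) (𝓝[>] 0) (𝓝 (f x)) := by
  have h1 : Tendsto (fun t : ℝ => ∫ w, heat N 1 w * f (x - √t • w)) (𝓝[>] 0)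
      (𝓝 (∫ w, heat N 1 w * f x)) := by
    refine tendsto_integral_filter_of_dominated_convergence (fun w => heat N 1 w * M) ?_ ?_ ?_ ?_
    · refine Eventually.of_forall fun t => ?_
      exact ((continuous_heat 1).mul (hc.comp (by fun_prop))).aestronglyMeasurable
    · refine Eventually.of_forall fun t => ae_of_all _ fun w => ?_
      rw [norm_mul, Real.norm_of_nonneg (heat_nonneg zero_le_one w), Real.norm_eq_abs]
      exact mul_le_mul_of_nonneg_left (hM _) (heat_nonneg zero_le_one w)
    · exact (integrable_heat one_pos).mul_const M
    · refine ae_of_all _ fun w => ?_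
      have : Continuous fun t : ℝ => heat N 1 w * f (x - √t • w) :=
        continuous_const.mul (hc.comp (by fun_prop))
      simpa using (this.tendsto 0).mono_left nhdsWithin_le_nhds
  rw [integral_mul_const, integral_heat one_pos, one_mul] at h1
  refine h1.congr' ?_
  filter_upwards [self_mem_nhdsWithin] with t ht
  exact (integral_heat_mul ht fun z => f (x - z)).symm

lemma lheatFlow_ofReal (hc : Continuous f) {M : ℝ} (hM : ∀ x, |f x| ≤ M) (hf0 : ∀ x, 0 ≤ f x)
    {t : ℝ} (ht : 0 < t) (x : Space N) :
    lheatFlow N t (fun y => ENNReal.ofReal (f y)) x = ENNReal.ofReal (heatFlow N t f x) := by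
  rw [heatFlow, ofReal_integral_eq_lintegral_ofReal
    (integrable_mul_comp_const_sub (integrable_heat ht) hc hM x)
    (ae_of_all _ fun z => mul_nonneg (heat_nonneg ht.le z) (hf0 _)), lheatFlow]
  simp only [ENNReal.ofReal_mul (heat_nonneg ht.le _)]

lemma ae_ne_zero (hN : 1 ≤ N) : ∀ᵐ z : Space N, z ≠ 0 := by
  have : Nonempty (Fin N) := ⟨⟨0, hN⟩⟩
  have : Nontrivial (Space N) := inferInstance
  exact Measure.ae_ne volume 0

lemma setLIntegral_rpow_mul_lheatFlow (hN : 1 ≤ N) (hα : 0 < α) (hf : HolderCompact N α f)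
    (hf0 : ∀ x, 0 ≤ f x) (hs0 : 0 < s) (hsN : 2 * s < N) (x : Space N) :
    ∫⁻ r in Set.Ioi (0 : ℝ), ENNReal.ofReal (r ^ (s - 1) / Real.Gamma s) *
      lheatFlow N r (fun y => ENNReal.ofReal (f y)) x = ENNReal.ofReal (rieszPotential N s f x) := by
  have hc := hf.continuous hα
  have hG := Real.Gamma_pos_of_pos hs0
  rw [setLIntegral_mul_lheatFlow (by fun_prop) hc.measurable.ennreal_ofReal x, rieszPotential_apply,
    ofReal_integral_eq_lintegral_ofReal (integrable_rieszKernel_mul hN hα hf hs0 x)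
    (ae_of_all _ fun z => mul_nonneg (rieszKernel_nonneg hs0 hsN z) (hf0 _))]
  refine lintegral_congr_ae ?_
  filter_upwards [ae_ne_zero hN] with z hz
  obtain ⟨h1, h2⟩ := rieszKernel_eq_integral_heat hs0 hsN hz
  rw [ENNReal.ofReal_mul (rieszKernel_nonneg hs0 hsN z), ← h2,
    ofReal_integral_eq_lintegral_ofReal h1]
  · congr 1
    refine setLIntegral_congr_fun measurableSet_Ioi fun t ht => ?_
    have ht : 0 < t := ht
    exact (ENNReal.ofReal_mul (by positivity)).symm
  · filter_upwards [ae_restrict_mem measurableSet_Ioi] with t ht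
    have ht : 0 < t := ht
    exact mul_nonneg (by positivity) (heat_nonneg ht.le z)

/-- The Riesz potential as a superposition of heat flows. -/
lemma rieszPotential_eq_integral_heatFlow (hN : 1 ≤ N) (hα : 0 < α) (hf : HolderCompact N α f)
    (hf0 : ∀ x, 0 ≤ f x) (hs0 : 0 < s) (hsN : 2 * s < N) (x : Space N) :
    IntegrableOn (fun r : ℝ => r ^ (s - 1) / Real.Gamma s * heatFlow N r f x) (Set.Ioi 0) ∧
    ∫ r in Set.Ioi (0 : ℝ), r ^ (s - 1) / Real.Gamma s * heatFlow N r f x =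
      rieszPotential N s f x := by
  have hc := hf.continuous hα
  have hG := Real.Gamma_pos_of_pos hs0
  obtain ⟨M, -, hM⟩ := hf.exists_bound hα
  have hu0 : 0 ≤ rieszPotential N s f x := by
    rw [rieszPotential_apply]
    exact integral_nonneg fun z => mul_nonneg (rieszKernel_nonneg hs0 hsN z) (hf0 _)
  have h1 : ∫⁻ r in Set.Ioi (0 : ℝ), ENNReal.ofReal (r ^ (s - 1) / Real.Gamma s * heatFlow N r f x) =
      ENNReal.ofReal (rieszPotential N s f x) := by
    rw [← setLIntegral_rpow_mul_lheatFlow hN hα hf hf0 hs0 hsN x]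
    refine setLIntegral_congr_fun measurableSet_Ioi fun t ht => ?_
    have ht : 0 < t := ht
    rw [lheatFlow_ofReal hc hM hf0 ht, ENNReal.ofReal_mul (by positivity)]
  have hnn : 0 ≤ᵐ[volume.restrict (Set.Ioi (0 : ℝ))]
      fun r : ℝ => r ^ (s - 1) / Real.Gamma s * heatFlow N r f x := by
    filter_upwards [ae_restrict_mem measurableSet_Ioi] with t ht
    have ht : 0 < t := ht
    exact mul_nonneg (by positivity) (heatFlow_nonneg hf0 ht x)
  have hm : AEStronglyMeasurable (fun r : ℝ => r ^ (s - 1) / Real.Gamma s * heatFlow N r f x)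
      (volume.restrict (Set.Ioi (0 : ℝ))) := by
    have h2 : StronglyMeasurable fun t : ℝ => heatFlow N t f x := by
      have : StronglyMeasurable fun p : ℝ × Space N => heat N p.1 p.2 * f (x - p.2) :=
        (measurable_heat_uncurry.mul
          ((continuous_comp_const_sub hc x).measurable.comp measurable_snd)).stronglyMeasurable
      exact this.integral_prod_right
    exact ((by fun_prop : Measurable fun r : ℝ => r ^ (s - 1) / Real.Gamma s).mul
      h2.measurable).aestronglyMeasurable
  refine ⟨(lintegral_ofReal_ne_top_iff_integrable hm hnn).1
    (by rw [h1]; exact ENNReal.ofReal_ne_top), ?_⟩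
  rw [integral_eq_lintegral_of_nonneg_ae hnn hm, h1, ENNReal.toReal_ofReal hu0]

/-! ### The regularised kernel of the fractional Laplacian. -/

lemma integrableOn_levyKernel_integrand (hs0 : 0 < s) (hs1 : s < 1) {τ : ℝ} (hτ : 0 ≤ τ)
    {y : Space N} (hy : y ≠ 0) :
    IntegrableOn (fun t : ℝ => s / Real.Gamma (1 - s) * (t + τ) ^ (-1 - s) * heat N t y)
      (Set.Ioi 0) := by
  have hG := Real.Gamma_pos_of_pos (sub_pos.2 hs1)
  refine Integrable.mono' (fracLapConst_mul_eq_integral_heat hs0 hy).1 ?_ ?_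
  · have h : Measurable fun t => heat N t y := by unfold heat; fun_prop
    exact (Measurable.mul (by fun_prop) h).aestronglyMeasurable
  · filter_upwards [ae_restrict_mem measurableSet_Ioi] with t ht
    have ht : 0 < t := ht
    have h1 := heat_nonneg ht.le y
    rw [Real.norm_of_nonneg (by positivity)]
    have : (t + τ) ^ (-1 - s) ≤ t ^ (-1 - s) :=
      Real.rpow_le_rpow_of_nonpos ht (by linarith) (by linarith)
    gcongr

lemma levyKernel_nonneg (hs0 : 0 < s) (hs1 : s < 1) {τ : ℝ} (hτ : 0 ≤ τ) (y : Space N) :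
    0 ≤ levyKernel N s τ y := by
  have hG := Real.Gamma_pos_of_pos (sub_pos.2 hs1)
  refine setIntegral_nonneg measurableSet_Ioi fun t ht => ?_
  have ht : 0 < t := ht
  have h1 := heat_nonneg ht.le y
  positivity

/-- Shifting the time by `τ` only decreases `t^(-1-s)`. The singular kernel therefore dominates all
the regularised ones. -/
lemma levyKernel_le (hs0 : 0 < s) (hs1 : s < 1) {τ : ℝ} (hτ : 0 ≤ τ) {y : Space N} (hy : y ≠ 0) :
    levyKernel N s τ y ≤ fracLapConst N s * ‖y‖ ^ (-((N : ℝ) + 2 * s)) := by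
  have hG := Real.Gamma_pos_of_pos (sub_pos.2 hs1)
  rw [← (fracLapConst_mul_eq_integral_heat hs0 hy).2]
  refine setIntegral_mono_on (integrableOn_levyKernel_integrand hs0 hs1 hτ hy)
    (fracLapConst_mul_eq_integral_heat hs0 hy).1 measurableSet_Ioi fun t ht => ?_
  have ht : 0 < t := ht
  have h1 := heat_nonneg ht.le y
  have : (t + τ) ^ (-1 - s) ≤ t ^ (-1 - s) :=
    Real.rpow_le_rpow_of_nonpos ht (by linarith) (by linarith)
  gcongr

lemma tendsto_levyKernel (hs0 : 0 < s) (hs1 : s < 1) {y : Space N} (hy : y ≠ 0) :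
    Tendsto (fun τ => levyKernel N s τ y) (𝓝[>] 0)
      (𝓝 (fracLapConst N s * ‖y‖ ^ (-((N : ℝ) + 2 * s)))) := by
  have hG := Real.Gamma_pos_of_pos (sub_pos.2 hs1)
  rw [← (fracLapConst_mul_eq_integral_heat hs0 hy).2]
  refine tendsto_integral_filter_of_dominated_convergence
    (fun t => s / Real.Gamma (1 - s) * t ^ (-1 - s) * heat N t y) ?_ ?_
    (fracLapConst_mul_eq_integral_heat hs0 hy).1 ?_
  · filter_upwards [self_mem_nhdsWithin] with τ hτ
    exact (integrableOn_levyKernel_integrand hs0 hs1 (le_of_lt hτ) hy).1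
  · filter_upwards [self_mem_nhdsWithin] with τ hτ
    have hτ : 0 < τ := hτ
    filter_upwards [ae_restrict_mem measurableSet_Ioi] with t ht
    have ht : 0 < t := ht
    have h1 := heat_nonneg ht.le y
    rw [Real.norm_of_nonneg (by positivity)]
    have : (t + τ) ^ (-1 - s) ≤ t ^ (-1 - s) :=
      Real.rpow_le_rpow_of_nonpos ht (by linarith) (by linarith)
    gcongr
  · filter_upwards [ae_restrict_mem measurableSet_Ioi] with t ht
    have ht : 0 < t := ht
    have h : ContinuousAt (fun τ : ℝ => (t + τ) ^ (-1 - s)) 0 :=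
      ContinuousAt.rpow_const (by fun_prop) (Or.inl (by simpa using ht.ne'))
    have h2 : Tendsto (fun τ : ℝ => (t + τ) ^ (-1 - s)) (𝓝[>] 0) (𝓝 (t ^ (-1 - s))) := by
      simpa using h.tendsto.mono_left nhdsWithin_le_nhds
    exact (h2.const_mul _).mul_const _

lemma ofReal_levyKernel (hs0 : 0 < s) (hs1 : s < 1) {τ : ℝ} (hτ : 0 ≤ τ) {y : Space N}
    (hy : y ≠ 0) :
    ENNReal.ofReal (levyKernel N s τ y) = ∫⁻ t in Set.Ioi (0 : ℝ),
      ENNReal.ofReal (s / Real.Gamma (1 - s) * (t + τ) ^ (-1 - s)) *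
        ENNReal.ofReal (heat N t y) := by
  have hG := Real.Gamma_pos_of_pos (sub_pos.2 hs1)
  rw [levyKernel, ofReal_integral_eq_lintegral_ofReal
    (integrableOn_levyKernel_integrand hs0 hs1 hτ hy)]
  · refine setLIntegral_congr_fun measurableSet_Ioi fun t ht => ?_
    have ht : 0 < t := ht
    exact ENNReal.ofReal_mul (by positivity)
  · filter_upwards [ae_restrict_mem measurableSet_Ioi] with t ht
    have ht : 0 < t := ht
    have h1 := heat_nonneg ht.le y
    simp only [Pi.zero_apply]
    positivity

lemma stronglyMeasurable_levyKernel (s τ : ℝ) : StronglyMeasurable (levyKernel N s τ) := by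
  have h1 : Measurable fun p : Space N × ℝ => heat N p.2 p.1 :=
    measurable_heat_uncurry.comp measurable_swap
  have h2 : Measurable fun p : Space N × ℝ =>
      s / Real.Gamma (1 - s) * (p.2 + τ) ^ (-1 - s) := by fun_prop
  exact (h2.mul h1).stronglyMeasurable.integral_prod_right

/-- Every heat kernel has mass one, so the mass is the integral of the time weight. That it is
finite for `τ > 0` is the point of the regularisation: `u x` and `u (x - y)` can be integrated
separately. -/
lemma integral_levyKernel (hN : 1 ≤ N) (hs0 : 0 < s) (hs1 : s < 1) {τ : ℝ} (hτ : 0 < τ) :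
    Integrable (levyKernel N s τ) ∧
      ∫ y, levyKernel N s τ y = τ ^ (-s) / Real.Gamma (1 - s) := by
  have hG := Real.Gamma_pos_of_pos (sub_pos.2 hs1)
  have h1 : ∫⁻ y, ENNReal.ofReal (levyKernel N s τ y) =
      ENNReal.ofReal (τ ^ (-s) / Real.Gamma (1 - s)) := by
    have h2 := setLIntegral_mul_lheatFlow (N := N)
      (w := fun t => ENNReal.ofReal (s / Real.Gamma (1 - s) * (t + τ) ^ (-1 - s))) (by fun_prop)
      (F := fun _ => 1) measurable_const 0
    simp only [mul_one] at h2
    have h3 : ∫⁻ y, ENNReal.ofReal (levyKernel N s τ y) = _ :=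
      (lintegral_congr_ae ((ae_ne_zero hN).mono fun y hy =>
        ofReal_levyKernel hs0 hs1 hτ.le hy)).trans h2.symm
    rw [h3]
    have h4 : ∀ t ∈ Set.Ioi (0 : ℝ),
        ENNReal.ofReal (s / Real.Gamma (1 - s) * (t + τ) ^ (-1 - s)) *
          lheatFlow N t (fun _ => 1) 0 =
        ENNReal.ofReal (s / Real.Gamma (1 - s) * (t + τ) ^ (-1 - s)) := by
      intro t ht
      rw [lheatFlow]
      simp only [mul_one]
      rw [lintegral_heat ht, mul_one]
    obtain ⟨h5, h6⟩ := integral_Ioi_add_rpow hs0 hτ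
    rw [setLIntegral_congr_fun measurableSet_Ioi h4,
      ← ofReal_integral_eq_lintegral_ofReal (h5.const_mul _), integral_const_mul, h6]
    · congr 1
      field_simp
    · filter_upwards [ae_restrict_mem measurableSet_Ioi] with t ht
      have ht : 0 < t := ht
      simp only [Pi.zero_apply]
      positivity
  have hnn : 0 ≤ᵐ[volume] levyKernel N s τ := ae_of_all _ fun y => levyKernel_nonneg hs0 hs1 hτ.le y
  have hm := (stronglyMeasurable_levyKernel (N := N) s τ).aestronglyMeasurable (μ := volume)
  refine ⟨(lintegral_ofReal_ne_top_iff_integrable hm hnn).1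
    (by rw [h1]; exact ENNReal.ofReal_ne_top), ?_⟩
  rw [integral_eq_lintegral_of_nonneg_ae hnn hm, h1, ENNReal.toReal_ofReal (by positivity)]

lemma levyKernel_neg (τ : ℝ) (y : Space N) : levyKernel N s τ (-y) = levyKernel N s τ y := by
  simp only [levyKernel, heat_neg]

/-- The regularised fractional Laplacian of a Riesz potential is an average of heat flows. -/
lemma integral_sub_mul_levyKernel (hN : 1 ≤ N) (hα : 0 < α) (hf : HolderCompact N α f)
    (hf0 : ∀ x, 0 ≤ f x) (hs0 : 0 < s) (hs1 : s < 1) (hsN : 2 * s < N) {τ : ℝ} (hτ : 0 < τ)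
    (x : Space N) :
    ∫ y, (rieszPotential N s f x - rieszPotential N s f (x - y)) * levyKernel N s τ y =
      ∫ ρ in Set.Ioi (0 : ℝ), (Real.Gamma s * Real.Gamma (1 - s))⁻¹ *
        (ρ ^ (s - 1) * τ ^ (1 - s) / (ρ + τ)) * heatFlow N ρ f x := by
  have hG1 := Real.Gamma_pos_of_pos hs0
  have hG2 := Real.Gamma_pos_of_pos (sub_pos.2 hs1)
  have hc := hf.continuous hα
  have hFm : Measurable fun y => ENNReal.ofReal (f y) := hc.measurable.ennreal_ofReal
  obtain ⟨M, -, hM⟩ := hf.exists_bound hα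
  set u := rieszPotential N s f with hu
  have huc : Continuous u := continuous_rieszPotential hN hα hf hs0
  obtain ⟨Mu, -, hMu⟩ := exists_bound_of_tendsto_cocompact huc
    (tendsto_rieszPotential_cocompact hα hf hs0 hsN)
  have hu0 : ∀ x, 0 ≤ u x := fun x => by
    rw [hu, rieszPotential_apply]
    exact integral_nonneg fun z => mul_nonneg (rieszKernel_nonneg hs0 hsN z) (hf0 _)
  obtain ⟨hk, hkm⟩ := integral_levyKernel hN hs0 hs1 hτ
  have hku := integrable_mul_comp_const_sub hk huc hMu x
  set c := (Real.Gamma s * Real.Gamma (1 - s))⁻¹ with hcdef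
  have hc0 : 0 < c := by positivity
  obtain ⟨hri, hre⟩ := rieszPotential_eq_integral_heatFlow hN hα hf hf0 hs0 hsN x
  set B : ℝ → ℝ := fun ρ => c * (ρ ^ s * τ ^ (-s) / (ρ + τ)) * heatFlow N ρ f x with hB
  set A : ℝ → ℝ := fun ρ => c * (ρ ^ (s - 1) * τ ^ (1 - s) / (ρ + τ)) * heatFlow N ρ f x with hA
  have hB0 : ∀ ρ ∈ Set.Ioi (0 : ℝ), 0 ≤ B ρ := fun ρ hρ => by
    have hρ : 0 < ρ := hρ
    exact mul_nonneg (by positivity) (heatFlow_nonneg hf0 hρ x)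
  -- This is `1 - ρ/(ρ+τ) = τ/(ρ+τ)`: the first term is the density of `u x` times the mass of the
  -- kernel, and `B` that of the convolution of the kernel with `u`.
  have hAB : ∀ ρ ∈ Set.Ioi (0 : ℝ), A ρ = τ ^ (-s) / Real.Gamma (1 - s) *
      (ρ ^ (s - 1) / Real.Gamma s * heatFlow N ρ f x) - B ρ := by
    intro ρ hρ
    have hρ : 0 < ρ := hρ
    have e1 : ρ ^ s = ρ ^ (s - 1) * ρ := by
      rw [← Real.rpow_add_one hρ.ne']; congr 1; ring
    have e2 : τ ^ (1 - s) = τ ^ (-s) * τ := by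
      rw [← Real.rpow_add_one hτ.ne']; congr 1; ring
    simp only [hA, hB]
    rw [e1, e2, hcdef]
    field_simp
    ring
  have hBl : ∫⁻ ρ in Set.Ioi (0 : ℝ), ENNReal.ofReal (B ρ) =
      ENNReal.ofReal (∫ y, levyKernel N s τ y * u (x - y)) := by
    have h1 := lintegral_superposition_mul (N := N)
      (w₁ := fun t => ENNReal.ofReal (s / Real.Gamma (1 - s) * (t + τ) ^ (-1 - s)))
      (w₂ := fun r => ENNReal.ofReal (r ^ (s - 1) / Real.Gamma s))
      (by fun_prop) (by fun_prop) hFm x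
    simp only [setLIntegral_rpow_mul_lheatFlow hN hα hf hf0 hs0 hsN] at h1
    rw [ofReal_integral_eq_lintegral_ofReal hku
      (ae_of_all _ fun y => mul_nonneg (levyKernel_nonneg hs0 hs1 hτ.le y) (hu0 _))]
    have h2 : ∫⁻ y, ENNReal.ofReal (levyKernel N s τ y * u (x - y)) = _ :=
      (lintegral_congr_ae ((ae_ne_zero hN).mono fun y hy => by
        rw [ENNReal.ofReal_mul (levyKernel_nonneg hs0 hs1 hτ.le y),
          ofReal_levyKernel hs0 hs1 hτ.le hy])).trans h1
    rw [h2]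
    refine setLIntegral_congr_fun measurableSet_Ioi fun ρ hρ => ?_
    have hρ : 0 < ρ := hρ
    have h3 : ∫⁻ t in Set.Ioo 0 ρ, ENNReal.ofReal (s / Real.Gamma (1 - s) * (t + τ) ^ (-1 - s)) *
        ENNReal.ofReal ((ρ - t) ^ (s - 1) / Real.Gamma s) =
        ENNReal.ofReal (c * (ρ ^ s * τ ^ (-s) / (ρ + τ))) := by
      have h4 : ∀ t ∈ Set.Ioo 0 ρ,
          ENNReal.ofReal (s / Real.Gamma (1 - s) * (t + τ) ^ (-1 - s)) *
            ENNReal.ofReal ((ρ - t) ^ (s - 1) / Real.Gamma s) =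
          ENNReal.ofReal (s * c) *
            ENNReal.ofReal ((t + τ) ^ (-1 - s) * (ρ - t) ^ (s - 1)) := by
        intro t ht
        have h5 : 0 < t + τ := by linarith [ht.1]
        rw [← ENNReal.ofReal_mul (by positivity), ← ENNReal.ofReal_mul (by positivity)]
        congr 1
        rw [hcdef]
        field_simp
      rw [setLIntegral_congr_fun measurableSet_Ioo h4,
        lintegral_const_mul' _ _ ENNReal.ofReal_ne_top, setLIntegral_Ioo_rpow_mul_rpow hs0 hτ hρ,
        ← ENNReal.ofReal_mul (by positivity)]
      congr 1
      field_simp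
    simp only [h3, hB]
    rw [lheatFlow_ofReal hc hM hf0 hρ, ENNReal.ofReal_mul (by positivity)]
  have hBnn : 0 ≤ᵐ[volume.restrict (Set.Ioi (0 : ℝ))] B := by
    filter_upwards [ae_restrict_mem measurableSet_Ioi] with t ht using hB0 t ht
  have hBm : AEStronglyMeasurable B (volume.restrict (Set.Ioi (0 : ℝ))) := by
    have h2 : StronglyMeasurable fun t : ℝ => heatFlow N t f x := by
      have : StronglyMeasurable fun p : ℝ × Space N => heat N p.1 p.2 * f (x - p.2) :=
        (measurable_heat_uncurry.mul
          ((continuous_comp_const_sub hc x).measurable.comp measurable_snd)).stronglyMeasurable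
      exact this.integral_prod_right
    exact ((by fun_prop : Measurable fun ρ : ℝ => c * (ρ ^ s * τ ^ (-s) / (ρ + τ))).mul
      h2.measurable).aestronglyMeasurable
  have hBi : IntegrableOn B (Set.Ioi 0) := (lintegral_ofReal_ne_top_iff_integrable hBm hBnn).1
    (by rw [hBl]; exact ENNReal.ofReal_ne_top)
  have hBe : ∫ ρ in Set.Ioi (0 : ℝ), B ρ = ∫ y, levyKernel N s τ y * u (x - y) := by
    rw [integral_eq_lintegral_of_nonneg_ae hBnn hBm, hBl, ENNReal.toReal_ofReal]
    exact integral_nonneg fun y => mul_nonneg (levyKernel_nonneg hs0 hs1 hτ.le y) (hu0 _)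
  have e : ∀ y, (u x - u (x - y)) * levyKernel N s τ y =
      levyKernel N s τ y * u x - levyKernel N s τ y * u (x - y) := fun y => by ring
  simp only [e]
  rw [integral_sub (hk.mul_const _) hku, integral_mul_const, hkm,
    setIntegral_congr_fun measurableSet_Ioi hAB, integral_sub (hri.const_mul _) hBi,
    integral_const_mul, hre, hBe]

/-- Convergence of the regularised fractional Laplacians of a Riesz potential. -/
lemma tendsto_integral_sub_mul_levyKernel (hN : 1 ≤ N) (hα : 0 < α) (hf : HolderCompact N α f)
    (hf0 : ∀ x, 0 ≤ f x) (hs0 : 0 < s) (hs1 : s < 1) (hsN : 2 * s < N) (x : Space N) :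
    Tendsto (fun τ => ∫ y, (rieszPotential N s f x - rieszPotential N s f (x - y)) *
      levyKernel N s τ y) (𝓝[>] 0) (𝓝 (f x)) := by
  have hG1 := Real.Gamma_pos_of_pos hs0
  have hG2 := Real.Gamma_pos_of_pos (sub_pos.2 hs1)
  have hc := hf.continuous hα
  obtain ⟨M, hM0, hM⟩ := hf.exists_bound hα
  obtain ⟨hbi, hbe⟩ := integral_Ioi_rpow_div_one_add hs0 hs1
  set c := (Real.Gamma s * Real.Gamma (1 - s))⁻¹ with hcdef
  have hc0 : 0 < c := by positivity
  have hfm : StronglyMeasurable fun t : ℝ => heatFlow N t f x := by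
    have : StronglyMeasurable fun p : ℝ × Space N => heat N p.1 p.2 * f (x - p.2) :=
      (measurable_heat_uncurry.mul
        ((continuous_comp_const_sub hc x).measurable.comp measurable_snd)).stronglyMeasurable
    exact this.integral_prod_right
  -- With `ρ = τσ` the weight becomes the fixed probability density `c σ^(s-1)/(1+σ)`, normalised by
  -- the beta integral, and the heat flow is evaluated at the times `τσ → 0`.
  have h1 : Tendsto (fun τ : ℝ => ∫ σ in Set.Ioi (0 : ℝ),
      c * (σ ^ (s - 1) / (1 + σ)) * heatFlow N (τ * σ) f x) (𝓝[>] 0)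
      (𝓝 (∫ σ in Set.Ioi (0 : ℝ), c * (σ ^ (s - 1) / (1 + σ)) * f x)) := by
    refine tendsto_integral_filter_of_dominated_convergence
      (fun σ => c * (σ ^ (s - 1) / (1 + σ)) * M) ?_ ?_ ((hbi.const_mul c).mul_const M) ?_
    · refine Eventually.of_forall fun τ => ?_
      exact ((by fun_prop : Measurable fun σ : ℝ => c * (σ ^ (s - 1) / (1 + σ))).mul
        (hfm.measurable.comp (measurable_const_mul τ))).aestronglyMeasurable
    · filter_upwards [self_mem_nhdsWithin] with τ hτ
      have hτ : 0 < τ := hτ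
      filter_upwards [ae_restrict_mem measurableSet_Ioi] with σ hσ
      have hσ : 0 < σ := hσ
      rw [norm_mul, Real.norm_of_nonneg (by positivity), Real.norm_eq_abs]
      exact mul_le_mul_of_nonneg_left (abs_heatFlow_le hM (by positivity) x) (by positivity)
    · filter_upwards [ae_restrict_mem measurableSet_Ioi] with σ hσ
      have hσ : 0 < σ := hσ
      refine Tendsto.const_mul _ ((tendsto_heatFlow hc hM x).comp ?_)
      refine tendsto_nhdsWithin_iff.2 ⟨?_, ?_⟩
      · have : Continuous fun τ : ℝ => τ * σ := by fun_prop
        simpa using (this.tendsto 0).mono_left nhdsWithin_le_nhds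
      · filter_upwards [self_mem_nhdsWithin] with τ hτ
        exact mul_pos hτ hσ
  rw [integral_mul_const, integral_const_mul, hbe, hcdef, inv_mul_cancel₀ (by positivity),
    one_mul] at h1
  refine h1.congr' ?_
  filter_upwards [self_mem_nhdsWithin] with τ hτ
  have hτ : 0 < τ := hτ
  rw [integral_sub_mul_levyKernel hN hα hf hf0 hs0 hs1 hsN hτ x]
  have h2 := integral_comp_mul_left_Ioi (fun ρ : ℝ => c *
    (ρ ^ (s - 1) * τ ^ (1 - s) / (ρ + τ)) * heatFlow N ρ f x) 0 hτ
  rw [mul_zero, smul_eq_mul, eq_inv_mul_iff_mul_eq₀ hτ.ne', ← integral_const_mul] at h2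
  rw [← h2]
  refine setIntegral_congr_fun measurableSet_Ioi fun σ hσ => ?_
  have hσ : 0 < σ := hσ
  have e1 : τ * (c * ((τ * σ) ^ (s - 1) * τ ^ (1 - s) / (τ * σ + τ))) =
      c * (σ ^ (s - 1) / (1 + σ)) := by
    have e2 : τ ^ (s - 1) * τ ^ (1 - s) = 1 := by
      rw [← Real.rpow_add hτ, show s - 1 + (1 - s) = 0 by ring, Real.rpow_zero]
    rw [Real.mul_rpow hτ.le hσ.le, show τ * σ + τ = τ * (1 + σ) by ring,
      show τ ^ (s - 1) * σ ^ (s - 1) * τ ^ (1 - s) = (τ ^ (s - 1) * τ ^ (1 - s)) * σ ^ (s - 1) by ring,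
      e2]
    field_simp
  rw [← e1]
  ring

end Regularisation

/-! ### Second differences of Riesz potentials -/

section SecondDifference

lemma integral_two_mul_sub_sub {X : Type*} [MeasurableSpace X] {μ : Measure X} {a b c : X → ℝ}
    (ha : Integrable a μ) (hb : Integrable b μ) (hc : Integrable c μ) :
    ∫ x, (2 * a x - b x - c x) ∂μ = 2 * ∫ x, a x ∂μ - ∫ x, b x ∂μ - ∫ x, c x ∂μ := by
  have h := integral_sub ((ha.const_mul 2).sub hb) hc
  have h' := integral_sub (ha.const_mul 2) hb
  rw [integral_const_mul] at h'
  simp only [Pi.sub_apply] at h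
  rw [h, h']

variable {N : ℕ} {α : ℝ≥0} {f : Space N → ℝ} {s : ℝ}

/-- A bounded Hölder function is Hölder for every smaller exponent. This is needed because the
second-difference estimate requires `s + β/2 < 1`, which `α` itself may violate. -/
lemma HolderCompact.exists_abs_sub_le_of_le (hf : HolderCompact N α f) (hα : 0 < α) {β : ℝ}
    (hβ0 : 0 ≤ β) (hβ : β ≤ α) :
    ∃ H : ℝ, 0 ≤ H ∧ ∀ x y, |f x - f y| ≤ H * ‖x - y‖ ^ β := by
  obtain ⟨H, hH0, hH⟩ := hf.exists_abs_sub_le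
  obtain ⟨M, hM0, hM⟩ := hf.exists_bound hα
  refine ⟨H + 2 * M, by positivity, fun x y => ?_⟩
  rcases eq_or_ne x y with rfl | hxy
  · simp only [sub_self, abs_zero]
    positivity
  have hp : 0 < ‖x - y‖ := norm_pos_iff.2 (sub_ne_zero.2 hxy)
  have hp0 : 0 ≤ ‖x - y‖ ^ β := by positivity
  rcases le_total ‖x - y‖ 1 with h | h
  · have h1 : ‖x - y‖ ^ (α : ℝ) ≤ ‖x - y‖ ^ β := Real.rpow_le_rpow_of_exponent_ge hp h hβ
    calc _ ≤ H * ‖x - y‖ ^ β := (hH x y).trans (by gcongr)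
      _ ≤ _ := by gcongr; linarith
  · have h1 : 1 ≤ ‖x - y‖ ^ β := Real.one_le_rpow h hβ0
    calc _ ≤ |f x| + |f y| := abs_sub _ _
      _ ≤ 2 * M * 1 := by linarith [hM x, hM y]
      _ ≤ (H + 2 * M) * ‖x - y‖ ^ β := by gcongr; linarith

lemma abs_heatFlow_sub_le (hc : Continuous f) {M H β : ℝ} (hM : ∀ x, |f x| ≤ M)
    (hH : ∀ x y, |f x - f y| ≤ H * ‖x - y‖ ^ β) {r : ℝ} (hr : 0 < r) (x y : Space N) :
    |heatFlow N r f x - heatFlow N r f y| ≤ H * ‖x - y‖ ^ β := by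
  have hi := integrable_heat (N := N) hr
  rw [heatFlow, heatFlow, ← integral_sub (integrable_mul_comp_const_sub hi hc hM x)
    (integrable_mul_comp_const_sub hi hc hM y)]
  have hle : ∀ z, ‖heat N r z * f (x - z) - heat N r z * f (y - z)‖ ≤
      heat N r z * (H * ‖x - y‖ ^ β) := fun z => by
    rw [← mul_sub, norm_mul, Real.norm_of_nonneg (heat_nonneg hr.le z), Real.norm_eq_abs]
    have := hH (x - z) (y - z)
    rw [sub_sub_sub_cancel_right] at this
    exact mul_le_mul_of_nonneg_left this (heat_nonneg hr.le z)
  refine (norm_integral_le_of_norm_le (hi.mul_const _) (ae_of_all _ hle)).trans_eq ?_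
  rw [integral_mul_const, integral_heat hr, one_mul]

lemma heatFlow_sub_eq (r : ℝ) (f : Space N → ℝ) (x y : Space N) :
    heatFlow N r f (x - y) = ∫ z, heat N r (z - y) * f (x - z) := by
  rw [heatFlow, ← integral_sub_right_eq_self (fun z => heat N r z * f (x - y - z)) y]
  simp only [sub_sub, add_sub_cancel]

/-- The second difference is moved onto the heat kernel. There it has zero integral, so `f x` may be
subtracted, and it is bounded by `|y|²/r` times the kernel at time `4r`. The moment of order `β` of
the latter supplies `r^(β/2)`. -/
lemma abs_heatFlow_second_difference_le (hc : Continuous f) {M H β : ℝ} (hβ : 0 ≤ β)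
    (hM : ∀ x, |f x| ≤ M) (hH : ∀ x y, |f x - f y| ≤ H * ‖x - y‖ ^ β)
    {r : ℝ} (hr : 0 < r) (x : Space N) {y : Space N} (hy : ‖y‖ ^ 2 ≤ r) :
    |2 * heatFlow N r f x - heatFlow N r f (x - y) - heatFlow N r f (x + y)| ≤
      4 * 4 ^ ((N : ℝ) / 2) * 4 ^ (β / 2) * H * (∫ w : Space N, heat N 1 w * ‖w‖ ^ β) *
        (‖y‖ ^ 2 * r ^ (β / 2 - 1)) := by
  have hi := integrable_heat (N := N) hr
  set Δ : Space N → ℝ := fun z => 2 * heat N r z - heat N r (z - y) - heat N r (z + y) with hΔ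
  have hi1 : Integrable fun z => heat N r (z - y) := hi.comp_sub_right y
  have hi2 : Integrable fun z => heat N r (z + y) := hi.comp_add_right y
  have hΔi : Integrable Δ := ((hi.const_mul 2).sub hi1).sub hi2
  have hΔ0 : ∫ z, Δ z = 0 := by
    rw [hΔ, integral_two_mul_sub_sub hi hi1 hi2, integral_sub_right_eq_self,
      integral_add_right_eq_self, integral_heat hr]
    norm_num
  have e1 : 2 * heatFlow N r f x - heatFlow N r f (x - y) - heatFlow N r f (x + y) =
      ∫ z, Δ z * (f (x - z) - f x) := by
    have h1 := heatFlow_sub_eq r f x y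
    have h2 := heatFlow_sub_eq r f x (-y)
    simp only [sub_neg_eq_add] at h2
    have j0 := integrable_mul_comp_const_sub hi hc hM x
    have j1 := integrable_mul_comp_const_sub hi1 hc hM x
    have j2 := integrable_mul_comp_const_sub hi2 hc hM x
    rw [h1, h2, heatFlow, ← integral_two_mul_sub_sub j0 j1 j2]
    have e2 : ∫ z, Δ z * (f (x - z) - f x) = (∫ z, Δ z * f (x - z)) - ∫ z, Δ z * f x := by
      rw [← integral_sub (integrable_mul_comp_const_sub hΔi hc hM x) (hΔi.mul_const _)]
      simp only [mul_sub]
    rw [e2, integral_mul_const, hΔ0, zero_mul, sub_zero]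
    refine integral_congr_ae (ae_of_all _ fun z => ?_)
    simp only [hΔ]
    ring
  have hi4 := integrable_heat_mul_norm_rpow (N := N) hβ (by positivity : 0 < 4 * r)
  have hle : ∀ z, ‖Δ z * (f (x - z) - f x)‖ ≤
      4 * 4 ^ ((N : ℝ) / 2) * (‖y‖ ^ 2 / r) * H * (heat N (4 * r) z * ‖z‖ ^ β) := by
    intro z
    rw [norm_mul, Real.norm_eq_abs, Real.norm_eq_abs]
    have h1 := abs_heat_second_difference_le hr hy z
    have h2 := hH (x - z) x
    rw [show x - z - x = -z by abel, norm_neg] at h2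
    calc _ ≤ 4 * 4 ^ ((N : ℝ) / 2) * (‖y‖ ^ 2 / r) * heat N (4 * r) z * (H * ‖z‖ ^ β) :=
          mul_le_mul h1 h2 (abs_nonneg _) ((abs_nonneg _).trans h1)
      _ = _ := by ring
  have e3 : ∫ z : Space N, heat N (4 * r) z * ‖z‖ ^ β =
      4 ^ (β / 2) * r ^ (β / 2) * ∫ w : Space N, heat N 1 w * ‖w‖ ^ β := by
    rw [integral_heat_mul (by positivity), ← integral_const_mul]
    refine integral_congr_ae (ae_of_all _ fun w => ?_)
    simp only
    rw [norm_smul, Real.norm_of_nonneg (Real.sqrt_nonneg _),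
      Real.mul_rpow (Real.sqrt_nonneg _) (norm_nonneg _), Real.sqrt_eq_rpow,
      ← Real.rpow_mul (by positivity), Real.mul_rpow (by norm_num) hr.le,
      show 1 / 2 * β = β / 2 by ring]
    ring
  rw [e1]
  refine (norm_integral_le_of_norm_le (hi4.const_mul _) (ae_of_all _ hle)).trans_eq ?_
  rw [integral_const_mul, e3, Real.rpow_sub_one hr.ne']
  ring

/-- A Riesz potential of a Hölder function has a Hölder-type bound of order `2 s + β` on its second
differences. -/
lemma exists_rieszPotential_second_difference_le (hN : 1 ≤ N) (hα : 0 < α)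
    (hf : HolderCompact N α f) (hf0 : ∀ x, 0 ≤ f x) (hs0 : 0 < s) (hsN : 2 * s < N)
    {β : ℝ} (hβ0 : 0 < β) (hβα : β ≤ α) (hβs : s + β / 2 < 1) :
    ∃ C : ℝ, 0 ≤ C ∧ ∀ x y, |2 * rieszPotential N s f x - rieszPotential N s f (x - y) -
      rieszPotential N s f (x + y)| ≤ C * ‖y‖ ^ (2 * s + β) := by
  have hG := Real.Gamma_pos_of_pos hs0
  have hc := hf.continuous hα
  obtain ⟨M, -, hM⟩ := hf.exists_bound hα
  obtain ⟨H, hH0, hH⟩ := hf.exists_abs_sub_le_of_le hα hβ0.le hβα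
  set I := ∫ w : Space N, heat N 1 w * ‖w‖ ^ β with hI
  have hI0 : 0 ≤ I := integral_nonneg fun w => mul_nonneg (heat_nonneg zero_le_one w) (by positivity)
  set K := 4 * (4 : ℝ) ^ ((N : ℝ) / 2) * 4 ^ (β / 2) * H * I with hK
  have hK0 : 0 ≤ K := by positivity
  have hδ : 0 < 1 - s - β / 2 := by linarith
  refine ⟨2 * H / Real.Gamma s / s + K / Real.Gamma s / (1 - s - β / 2), by positivity,
    fun x y => ?_⟩
  rcases eq_or_ne y 0 with rfl | hy
  · simp only [sub_zero, add_zero, norm_zero]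
    rw [Real.zero_rpow (by positivity), mul_zero]
    exact le_of_eq (by rw [abs_eq_zero]; ring)
  have hyp : 0 < ‖y‖ := norm_pos_iff.2 hy
  set a := ‖y‖ ^ 2 with ha
  have ha0 : 0 < a := by positivity
  have hapow : ∀ c : ℝ, a ^ c = ‖y‖ ^ (2 * c) := fun c => by
    rw [ha, ← Real.rpow_natCast, ← Real.rpow_mul hyp.le]; norm_num
  set D : ℝ → ℝ := fun r => r ^ (s - 1) / Real.Gamma s *
    (2 * heatFlow N r f x - heatFlow N r f (x - y) - heatFlow N r f (x + y)) with hD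
  obtain ⟨i0, e0⟩ := rieszPotential_eq_integral_heatFlow hN hα hf hf0 hs0 hsN x
  obtain ⟨i1, e1⟩ := rieszPotential_eq_integral_heatFlow hN hα hf hf0 hs0 hsN (x - y)
  obtain ⟨i2, e2⟩ := rieszPotential_eq_integral_heatFlow hN hα hf hf0 hs0 hsN (x + y)
  have hDe : D = fun r => 2 * (r ^ (s - 1) / Real.Gamma s * heatFlow N r f x) -
      r ^ (s - 1) / Real.Gamma s * heatFlow N r f (x - y) -
      r ^ (s - 1) / Real.Gamma s * heatFlow N r f (x + y) := by
    funext r; simp only [hD]; ring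
  have hDi : IntegrableOn D (Set.Ioi 0) := by
    rw [hDe]; exact ((i0.const_mul 2).sub i1).sub i2
  have hDint : 2 * rieszPotential N s f x - rieszPotential N s f (x - y) -
      rieszPotential N s f (x + y) = ∫ r in Set.Ioi (0 : ℝ), D r := by
    rw [hDe, integral_two_mul_sub_sub i0 i1 i2, e0, e1, e2]
  -- The time integral is split at the parabolic scale `r = |y|²`. Below it the Hölder bound of the
  -- heat flow is used; above it the smoothing bound `|y|² r^(β/2-1)`, integrable against `r^(s-1)`
  -- at infinity because `s + β/2 < 1`. Both pieces scale as `|y|^(2s+β)`.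
  rw [hDint, ← Set.Ioc_union_Ioi_eq_Ioi ha0.le, setIntegral_union (Set.Ioc_disjoint_Ioi le_rfl)
    measurableSet_Ioi (hDi.mono_set Set.Ioc_subset_Ioi_self)
    (hDi.mono_set (Set.Ioi_subset_Ioi ha0.le))]
  refine (abs_add_le _ _).trans ?_
  rw [add_mul]
  refine add_le_add ?_ ?_
  · have hgi : IntegrableOn (fun r : ℝ => r ^ (s - 1)) (Set.Ioc 0 a) :=
      (intervalIntegrable_iff_integrableOn_Ioc_of_le ha0.le).1
        (intervalIntegral.intervalIntegrable_rpow' (by linarith))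
    have hle : ∀ᵐ r ∂volume.restrict (Set.Ioc 0 a),
        ‖D r‖ ≤ 2 * H / Real.Gamma s * ‖y‖ ^ β * r ^ (s - 1) := by
      filter_upwards [ae_restrict_mem measurableSet_Ioc] with r hr
      have hr0 : 0 < r := hr.1
      have h1 := abs_heatFlow_sub_le hc hM hH hr0 x (x - y)
      have h2 := abs_heatFlow_sub_le hc hM hH hr0 x (x + y)
      rw [sub_sub_cancel] at h1
      rw [sub_add_cancel_left, norm_neg] at h2
      have h3 : |2 * heatFlow N r f x - heatFlow N r f (x - y) - heatFlow N r f (x + y)| ≤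
          2 * H * ‖y‖ ^ β := by
        rw [abs_le] at h1 h2 ⊢
        constructor <;> linarith [h1.1, h1.2, h2.1, h2.2]
      rw [hD, norm_mul, Real.norm_of_nonneg (by positivity), Real.norm_eq_abs]
      calc _ ≤ r ^ (s - 1) / Real.Gamma s * (2 * H * ‖y‖ ^ β) := by gcongr
        _ = _ := by ring
    refine (norm_integral_le_of_norm_le (hgi.const_mul _) hle).trans_eq ?_
    rw [integral_const_mul, ← intervalIntegral.integral_of_le ha0.le,
      integral_rpow (Or.inl (by linarith)), sub_add_cancel, Real.zero_rpow hs0.ne', sub_zero, hapow,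
      Real.rpow_add hyp]
    ring
  · have hexp : s - 1 + (β / 2 - 1) < -1 := by linarith
    have hgi : IntegrableOn (fun r : ℝ => r ^ (s - 1 + (β / 2 - 1))) (Set.Ioi a) :=
      integrableOn_Ioi_rpow_of_lt hexp ha0
    have hle : ∀ᵐ r ∂volume.restrict (Set.Ioi a),
        ‖D r‖ ≤ K / Real.Gamma s * a * r ^ (s - 1 + (β / 2 - 1)) := by
      filter_upwards [ae_restrict_mem measurableSet_Ioi] with r hr
      have hra : a < r := hr
      have hr0 : 0 < r := ha0.trans hra
      have h3 := abs_heatFlow_second_difference_le hc hβ0.le hM hH hr0 x (y := y) hra.le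
      rw [hD, norm_mul, Real.norm_of_nonneg (by positivity), Real.norm_eq_abs]
      calc _ ≤ r ^ (s - 1) / Real.Gamma s * (K * (a * r ^ (β / 2 - 1))) := by gcongr
        _ = _ := by rw [Real.rpow_add hr0]; ring
    refine (norm_integral_le_of_norm_le (hgi.const_mul _) hle).trans_eq ?_
    rw [integral_const_mul, integral_Ioi_rpow_of_lt hexp ha0]
    have h5 : a ^ (s - 1 + (β / 2 - 1) + 1) = ‖y‖ ^ (2 * s + β) / a := by
      rw [eq_div_iff ha0.ne', ← Real.rpow_add_one ha0.ne', hapow]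
      congr 1; ring
    have h6 : s - 1 + (β / 2 - 1) + 1 = -(1 - s - β / 2) := by ring
    rw [h5, h6]
    field_simp

end SecondDifference

/-! ### The fractional Laplacian of a Riesz potential -/

section FractionalLaplacian

variable {N : ℕ} {α : ℝ≥0} {f : Space N → ℝ} {s : ℝ}

/-- Symmetrisation of an integral against an even kernel. -/
lemma integral_sub_mul_even {u k : Space N → ℝ} {x : Space N} (hk : ∀ y, k (-y) = k y)
    (hi : Integrable fun y => (u x - u (x - y)) * k y) :
    ∫ y, (u x - u (x - y)) * k y = ∫ y, (2 * u x - u (x - y) - u (x + y)) / 2 * k y := by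
  have h1 : ∫ y, (u x - u (x + y)) * k y = ∫ y, (u x - u (x - y)) * k y := by
    rw [← integral_neg_eq_self (fun y => (u x - u (x - y)) * k y)]
    simp only [sub_neg_eq_add, hk]
  have hi' : Integrable fun y => (u x - u (x + y)) * k y := by
    have := hi.comp_neg
    simpa only [sub_neg_eq_add, hk] using this
  have h2 : ∀ y, (2 * u x - u (x - y) - u (x + y)) / 2 * k y =
      2⁻¹ * ((u x - u (x - y)) * k y) + 2⁻¹ * ((u x - u (x + y)) * k y) := fun y => by ring
  simp only [h2]
  rw [integral_add (hi.const_mul _) (hi'.const_mul _), integral_const_mul, integral_const_mul, h1]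
  ring

lemma integrable_sub_mul {u k : Space N → ℝ} (hk : Integrable k) (hu : Continuous u) {M : ℝ}
    (hM : ∀ x, |u x| ≤ M) (x : Space N) : Integrable fun y => (u x - u (x - y)) * k y := by
  have h := (hk.mul_const (u x)).sub (integrable_mul_comp_const_sub hk hu hM x)
  refine h.congr (ae_of_all _ fun y => ?_)
  simp only [Pi.sub_apply]
  ring

lemma setIntegral_compl_ball_eq (u : Space N → ℝ) (q : ℝ) (x : Space N) (ε : ℝ) :
    ∫ y in (ball x ε)ᶜ, (u x - u y) / ‖x - y‖ ^ q =
      ∫ z, (u x - u (x - z)) * (ball (0 : Space N) ε)ᶜ.indicator (fun z => ‖z‖ ^ (-q)) z := by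
  rw [← integral_indicator measurableSet_ball.compl, ← integral_sub_left_eq_self _ volume x]
  refine integral_congr_ae (ae_of_all _ fun z => ?_)
  beta_reduce
  by_cases h : ‖z‖ < ε
  · rw [Set.indicator_of_notMem (by simpa using h), Set.indicator_of_notMem (by simpa using h),
      mul_zero]
  · rw [Set.indicator_of_mem (by simpa using h), Set.indicator_of_mem (by simpa using h),
      sub_sub_cancel, Real.rpow_neg (norm_nonneg _), div_eq_mul_inv]

lemma integrable_indicator_compl_ball {q : ℝ} (hq : (N : ℝ) < q) {ε : ℝ} (hε : 0 < ε) :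
    Integrable ((ball (0 : Space N) ε)ᶜ.indicator fun z => ‖z‖ ^ (-q)) :=
  (integrable_indicator_iff measurableSet_ball.compl).2
    (integrableOn_compl_ball_norm_rpow (by linarith) hε)

lemma integrableOn_compl_ball_sub_div {u : Space N → ℝ} (hu : Continuous u) {M : ℝ}
    (hM : ∀ x, |u x| ≤ M) {q : ℝ} (hq : (N : ℝ) < q) (x : Space N) {ε : ℝ} (hε : 0 < ε) :
    IntegrableOn (fun y => (u x - u y) / ‖x - y‖ ^ q) (ball x ε)ᶜ := by
  have h := (integrable_sub_mul (integrable_indicator_compl_ball hq hε) hu hM x).comp_sub_left x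
  rw [← integrable_indicator_iff measurableSet_ball.compl]
  refine h.congr (ae_of_all _ fun y => ?_)
  simp only [sub_sub_cancel]
  by_cases h : dist y x < ε
  · rw [Set.indicator_of_notMem (by simpa [← dist_eq_norm, dist_comm x y] using h),
      Set.indicator_of_notMem (by simpa using h), mul_zero]
  · rw [Set.indicator_of_mem (by simpa [← dist_eq_norm, dist_comm x y] using h),
      Set.indicator_of_mem (by simpa using h), Real.rpow_neg (norm_nonneg _), div_eq_mul_inv]

/-- The Riesz potential of a nonnegative Hölder function solves the fractional Poisson equation. -/
lemma hasFracLaplacianAt_rieszPotential_of_nonneg (hN : 1 ≤ N) (hα : 0 < α)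
    (hf : HolderCompact N α f) (hf0 : ∀ x, 0 ≤ f x) (hs0 : 0 < s) (hs1 : s < 1) (hsN : 2 * s < N)
    (x : Space N) : HasFracLaplacianAt N s (rieszPotential N s f) (f x) x := by
  set u := rieszPotential N s f with hu
  have huc : Continuous u := continuous_rieszPotential hN hα hf hs0
  obtain ⟨M, hM0, hM⟩ := exists_bound_of_tendsto_cocompact huc
    (tendsto_rieszPotential_cocompact hα hf hs0 hsN)
  have hq : (N : ℝ) < (N : ℝ) + 2 * s := by linarith
  refine ⟨fun ε hε => integrableOn_compl_ball_sub_div huc hM hq x hε, ?_⟩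
  have hα' : (0 : ℝ) < α := hα
  -- The bound by `1 - s` guarantees `s + β/2 < 1`.
  set β := min (α : ℝ) (1 - s) with hβ
  have hβ0 : 0 < β := lt_min hα' (by linarith)
  have hβ1 : β ≤ 1 - s := min_le_right _ _
  obtain ⟨C, hC0, hC⟩ := exists_rieszPotential_second_difference_le hN hα hf hf0 hs0 hsN hβ0
    (min_le_left _ _) (by linarith)
  set E : Space N → ℝ := fun y => (2 * u x - u (x - y) - u (x + y)) / 2 with hE
  have hEc : Continuous E := by
    have h1 := continuous_comp_const_sub huc x
    have h2 : Continuous fun y => u (x + y) := huc.comp (continuous_const.add continuous_id)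
    exact ((continuous_const.sub h1).sub h2).div_const 2
  set L : Space N → ℝ := fun y => ‖y‖ ^ (-((N : ℝ) + 2 * s)) with hL
  have hLm : Measurable L := measurable_norm_rpow N _
  have hL0 : ∀ y, 0 ≤ L y := fun y => by simp only [hL]; positivity
  -- Near the origin `E` is `O(|y|^(2s+β))`, leaving `|y|^(β-N)`; at infinity `E` is bounded.
  -- Without symmetrisation the product need not be absolutely integrable, hence the principal
  -- value.
  have hEL : Integrable fun y => |E y| * L y := by
    have hm : AEStronglyMeasurable (fun y => |E y| * L y) volume :=
      (hEc.abs.measurable.mul hLm).aestronglyMeasurable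
    have h1 : IntegrableOn (fun y => |E y| * L y) (ball 0 1) := by
      refine Integrable.mono' ((integrableOn_ball_norm_rpow hN
        (by linarith : -(N : ℝ) < β - N) 1).const_mul C) hm.restrict ?_
      filter_upwards [ae_restrict_of_ae (ae_ne_zero hN)] with y hy
      have hyp : 0 < ‖y‖ := norm_pos_iff.2 hy
      rw [Real.norm_of_nonneg (mul_nonneg (abs_nonneg _) (hL0 y))]
      have h2 : |E y| ≤ C * ‖y‖ ^ (2 * s + β) := by
        rw [hE, abs_div, abs_two]
        exact (half_le_self (abs_nonneg _)).trans (hC x y)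
      calc _ ≤ C * ‖y‖ ^ (2 * s + β) * L y := mul_le_mul_of_nonneg_right h2 (hL0 y)
        _ = _ := by
          rw [hL, mul_assoc, ← Real.rpow_add hyp]; congr 2; ring
    have h2 : IntegrableOn (fun y => |E y| * L y) (ball 0 1)ᶜ := by
      refine Integrable.mono' ((integrableOn_compl_ball_norm_rpow (N := N)
        (by linarith : -((N : ℝ) + 2 * s) < -(N : ℝ)) one_pos).const_mul (2 * M)) hm.restrict
        (ae_of_all _ fun y => ?_)
      rw [Real.norm_of_nonneg (mul_nonneg (abs_nonneg _) (hL0 y))]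
      refine mul_le_mul_of_nonneg_right ?_ (hL0 y)
      have h3 := abs_le.1 (hM x)
      have h4 := abs_le.1 (hM (x - y))
      have h5 := abs_le.1 (hM (x + y))
      rw [hE, abs_le]
      constructor <;> linarith [h3.1, h3.2, h4.1, h4.2, h5.1, h5.2]
    have := h1.union h2
    rwa [Set.union_compl_self, integrableOn_univ] at this
  set c := fracLapConst N s with hc
  have hlim1 : Tendsto (fun ε : ℝ => ∫ y in (ball x ε)ᶜ, (u x - u y) / ‖x - y‖ ^ ((N : ℝ) + 2 * s))
      (𝓝[>] 0) (𝓝 (∫ y, E y * L y)) := by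
    have h1 : Tendsto (fun ε : ℝ => ∫ z, E z * (ball (0 : Space N) ε)ᶜ.indicator L z) (𝓝[>] 0)
        (𝓝 (∫ y, E y * L y)) := by
      refine tendsto_integral_filter_of_dominated_convergence (fun y => |E y| * L y) ?_ ?_ hEL ?_
      · exact Eventually.of_forall fun ε => (hEc.measurable.mul
          (hLm.indicator measurableSet_ball.compl)).aestronglyMeasurable
      · refine Eventually.of_forall fun ε => ae_of_all _ fun y => ?_
        rw [norm_mul, Real.norm_eq_abs]
        refine mul_le_mul_of_nonneg_left ?_ (abs_nonneg _)
        rw [Real.norm_of_nonneg (Set.indicator_nonneg (fun z _ => hL0 z) y)]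
        exact Set.indicator_le_self' (fun z _ => hL0 z) y
      · filter_upwards [ae_ne_zero hN] with y hy
        have hyp : 0 < ‖y‖ := norm_pos_iff.2 hy
        refine tendsto_const_nhds.congr' ?_
        filter_upwards [Ioo_mem_nhdsGT hyp] with ε hε
        rw [Set.indicator_of_mem]
        simpa using hε.2.le
    refine h1.congr' ?_
    filter_upwards [self_mem_nhdsWithin] with ε hε
    rw [setIntegral_compl_ball_eq, integral_sub_mul_even]
    · intro y
      by_cases h : ‖y‖ < ε
      · rw [Set.indicator_of_notMem (by simpa using h), Set.indicator_of_notMem (by simpa using h)]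
      · rw [Set.indicator_of_mem (by simpa using h), Set.indicator_of_mem (by simpa using h),
          norm_neg]
    · exact integrable_sub_mul (integrable_indicator_compl_ball hq hε) huc hM x
  have hlim2 : Tendsto (fun τ => ∫ y, (u x - u (x - y)) * levyKernel N s τ y) (𝓝[>] 0)
      (𝓝 (∫ y, E y * (c * L y))) := by
    have h1 : Tendsto (fun τ => ∫ y, E y * levyKernel N s τ y) (𝓝[>] 0)
        (𝓝 (∫ y, E y * (c * L y))) := by
      refine tendsto_integral_filter_of_dominated_convergence (fun y => c * (|E y| * L y)) ?_ ?_
        (hEL.const_mul c) ?_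
      · exact Eventually.of_forall fun τ => (hEc.measurable.mul
          (stronglyMeasurable_levyKernel s τ).measurable).aestronglyMeasurable
      · filter_upwards [self_mem_nhdsWithin] with τ hτ
        filter_upwards [ae_ne_zero hN] with y hy
        rw [norm_mul, Real.norm_eq_abs,
          Real.norm_of_nonneg (levyKernel_nonneg hs0 hs1 (le_of_lt hτ) y), mul_left_comm]
        exact mul_le_mul_of_nonneg_left (levyKernel_le hs0 hs1 (le_of_lt hτ) hy) (abs_nonneg _)
      · filter_upwards [ae_ne_zero hN] with y hy
        exact (tendsto_levyKernel hs0 hs1 hy).const_mul _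
    refine h1.congr' ?_
    filter_upwards [self_mem_nhdsWithin] with τ hτ
    exact (integral_sub_mul_even (levyKernel_neg τ)
      (integrable_sub_mul (integral_levyKernel hN hs0 hs1 hτ).1 huc hM x)).symm
  -- Truncation and regularisation lead to the same symmetrised integral, and the regularised limit
  -- is already known to be `f x`.
  have hval : c * ∫ y, E y * L y = f x := by
    rw [← integral_const_mul]
    have h1 := tendsto_nhds_unique hlim2
      (tendsto_integral_sub_mul_levyKernel hN hα hf hf0 hs0 hs1 hsN x)
    rw [← h1]
    simp only [mul_left_comm]
  rw [← hval]
  exact hlim1.const_mul c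

end FractionalLaplacian

/-! ### Existence and uniqueness of decaying solutions -/

section Solutions

variable {N : ℕ} {α : ℝ≥0} {f : Space N → ℝ} {s : ℝ}

lemma HasFracLaplacianAt.sub {u v : Space N → ℝ} {a b : ℝ} {x : Space N}
    (hu : HasFracLaplacianAt N s u a x) (hv : HasFracLaplacianAt N s v b x) :
    HasFracLaplacianAt N s (fun y => u y - v y) (a - b) x := by
  have e : ∀ y, (u x - v x - (u y - v y)) / ‖x - y‖ ^ ((N : ℝ) + 2 * s) =
      (u x - u y) / ‖x - y‖ ^ ((N : ℝ) + 2 * s) - (v x - v y) / ‖x - y‖ ^ ((N : ℝ) + 2 * s) :=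
    fun y => by ring
  refine ⟨fun ε hε => ?_, ?_⟩
  · simp only [e]
    exact (hu.1 ε hε).sub (hv.1 ε hε)
  · refine (hu.2.sub hv.2).congr' ?_
    filter_upwards [self_mem_nhdsWithin] with ε hε
    simp only [e]
    rw [integral_sub (hu.1 ε hε) (hv.1 ε hε), mul_sub]

lemma HolderCompact.max_zero (hf : HolderCompact N α f) :
    HolderCompact N α fun x => max (f x) 0 := by
  obtain ⟨⟨C, hC⟩, hs⟩ := hf
  refine ⟨⟨C, fun x y => le_trans ?_ (hC x y)⟩, hs.comp_left (g := fun t => max t 0) (max_self 0)⟩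
  rw [edist_dist, edist_dist]
  refine ENNReal.ofReal_le_ofReal ?_
  rw [Real.dist_eq, Real.dist_eq]
  have := abs_max_sub_max_le_max (f x) 0 (f y) 0
  simpa using this

lemma HolderCompact.neg (hf : HolderCompact N α f) : HolderCompact N α fun x => - f x := by
  obtain ⟨⟨C, hC⟩, hs⟩ := hf
  refine ⟨⟨C, fun x y => ?_⟩, hs.comp_left (g := fun t => - t) neg_zero⟩
  rw [edist_neg_neg]
  exact hC x y

lemma rieszPotential_sub (hN : 1 ≤ N) (hα : 0 < α) {g : Space N → ℝ} (hf : HolderCompact N α f)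
    (hg : HolderCompact N α g) (hs0 : 0 < s) :
    rieszPotential N s (fun x => f x - g x) =
      fun x => rieszPotential N s f x - rieszPotential N s g x := by
  funext x
  simp only [rieszPotential_apply, mul_sub]
  exact integral_sub (integrable_rieszKernel_mul hN hα hf hs0 x)
    (integrable_rieszKernel_mul hN hα hg hs0 x)

/-- Positive and negative parts remain Hölder with compact support, so linearity reduces the claim
to nonnegative data, where Tonelli was available. -/
lemma hasFracLaplacianAt_rieszPotential (hN : 1 ≤ N) (hα : 0 < α)
    (hf : HolderCompact N α f) (hs0 : 0 < s) (hs1 : s < 1) (hsN : 2 * s < N)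
    (x : Space N) : HasFracLaplacianAt N s (rieszPotential N s f) (f x) x := by
  have hp := hf.max_zero
  have hm := hf.neg.max_zero
  have e : ∀ y, max (f y) 0 - max (- f y) 0 = f y := fun y => by
    rcases le_total (f y) 0 with h | h
    · rw [max_eq_right h, max_eq_left (by linarith)]; ring
    · rw [max_eq_left h, max_eq_right (by linarith)]; ring
  have h := (hasFracLaplacianAt_rieszPotential_of_nonneg hN hα hp (fun _ => le_max_right _ _)
    hs0 hs1 hsN x).sub (hasFracLaplacianAt_rieszPotential_of_nonneg hN hα hm
      (fun _ => le_max_right _ _) hs0 hs1 hsN x)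
  have e2 := rieszPotential_sub hN hα hp hm hs0
  simp only [e] at e2 h
  rw [show rieszPotential N s f = _ from e2]
  exact h

lemma isDecayingSolution_rieszPotential (hN : 1 ≤ N) (hα : 0 < α)
    (hf : HolderCompact N α f) (hs0 : 0 < s) (hs1 : s < 1) (hsN : 2 * s < N) :
    IsDecayingSolution N s f (rieszPotential N s f) where
  continuous := continuous_rieszPotential hN hα hf hs0
  equation := hasFracLaplacianAt_rieszPotential hN hα hf hs0 hs1 hsN
  decay := tendsto_rieszPotential_cocompact hα hf hs0 hsN

lemma fracLapConst_pos (hs0 : 0 < s) (hs1 : s < 1) : 0 < fracLapConst N s := by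
  have h1 : 0 < Real.Gamma (((N : ℝ) + 2 * s) / 2) := Real.Gamma_pos_of_pos (by positivity)
  have h2 : 0 < Real.Gamma (1 - s) := Real.Gamma_pos_of_pos (by linarith)
  have := Real.pi_pos
  unfold fracLapConst
  positivity

/-- Maximum principle: a continuous decaying `s`-harmonic function is nowhere positive. -/
lemma nonpos_of_hasFracLaplacianAt_zero (hN : 1 ≤ N) (hs0 : 0 < s) (hs1 : s < 1)
    {w : Space N → ℝ} (hc : Continuous w) (hw : ∀ x, HasFracLaplacianAt N s w 0 x)
    (h0 : Tendsto w (cocompact (Space N)) (𝓝 0)) (x : Space N) : w x ≤ 0 := by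
  by_contra! hx
  have : Nonempty (Fin N) := ⟨⟨0, hN⟩⟩
  have : NoncompactSpace (Space N) := NormedSpace.noncompactSpace ℝ (Space N)
  -- Outside a compact set `w` stays below the positive value `w x`, so a global maximum is
  -- attained.
  obtain ⟨x₀, hx₀⟩ := hc.neg.exists_forall_le' x
    ((h0.eventually_lt_const hx).mono fun y hy => neg_le_neg hy.le)
  have hmax : ∀ y, w y ≤ w x₀ := fun y => neg_le_neg_iff.1 (hx₀ y)
  have hpos : 0 < w x₀ := hx.trans_le (hmax x)
  set q := (N : ℝ) + 2 * s
  set g : Space N → ℝ := fun y => (w x₀ - w y) / ‖x₀ - y‖ ^ q with hg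
  have hg0 : ∀ y, 0 ≤ g y := fun y => div_nonneg (sub_nonneg.2 (hmax y)) (by positivity)
  obtain ⟨hi, hlim⟩ := hw x₀
  -- At a maximum the integrand is nonnegative, so the integrals over larger exteriors dominate the
  -- one outside the unit ball, while their limit is 0.
  have hle : fracLapConst N s * ∫ y in (ball x₀ 1)ᶜ, g y ≤ 0 := by
    refine ge_of_tendsto hlim ?_
    filter_upwards [Ioo_mem_nhdsGT (zero_lt_one' ℝ)] with ε hε
    refine mul_le_mul_of_nonneg_left ?_ (fracLapConst_pos hs0 hs1).le
    exact setIntegral_mono_set (hi ε hε.1) (ae_of_all _ hg0)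
      (Set.compl_subset_compl.2 (ball_subset_ball hε.2.le)).eventuallyLE
  have hzero : ∫ y in (ball x₀ 1)ᶜ, g y = 0 :=
    le_antisymm (nonpos_of_mul_nonpos_right hle (fracLapConst_pos hs0 hs1))
      (integral_nonneg hg0)
  rw [setIntegral_eq_zero_iff_of_nonneg_ae (ae_of_all _ hg0) (hi 1 one_pos)] at hzero
  have hU : (closedBall x₀ 1)ᶜ ⊆ (ball x₀ 1)ᶜ := Set.compl_subset_compl.2 ball_subset_closedBall
  have hne : ∀ y ∈ (closedBall x₀ 1)ᶜ, 0 < ‖x₀ - y‖ := fun y hy => by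
    rw [Set.mem_compl_iff, mem_closedBall, dist_comm, dist_eq_norm, not_le] at hy
    linarith
  have hae : w =ᵐ[volume.restrict (closedBall x₀ 1)ᶜ] fun _ => w x₀ := by
    filter_upwards [ae_restrict_of_ae_restrict_of_subset hU hzero,
      ae_restrict_mem measurableSet_closedBall.compl] with y hy hyU
    have hp := hne y hyU
    have h1 : (w x₀ - w y) / ‖x₀ - y‖ ^ q = 0 := hy
    rw [div_eq_zero_iff] at h1
    rcases h1 with h1 | h1
    · linarith
    · exact absurd h1 (by positivity)
  -- By continuity, almost everywhere equality on the open exterior becomes equality everywhere; `w`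
  -- would be a positive constant there, against its decay.
  have heq := Measure.eqOn_open_of_ae_eq hae isClosed_closedBall.isOpen_compl hc.continuousOn
    continuousOn_const
  have hev : ∀ᶠ y in cocompact (Space N), w y < w x₀ ∧ y ∈ (closedBall x₀ 1)ᶜ :=
    (h0.eventually_lt_const hpos).and (isCompact_closedBall x₀ 1).compl_mem_cocompact
  obtain ⟨y, hy1, hy2⟩ := hev.exists
  exact hy1.ne (heq hy2)

lemma IsDecayingSolution.le (hN : 1 ≤ N) (hs0 : 0 < s) (hs1 : s < 1) {u v : Space N → ℝ}
    (hu : IsDecayingSolution N s f u) (hv : IsDecayingSolution N s f v) (x : Space N) :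
    u x ≤ v x := by
  have h := nonpos_of_hasFracLaplacianAt_zero hN hs0 hs1 (w := fun y => u y - v y)
    (hu.continuous.sub hv.continuous)
    (fun x => by simpa using (hu.equation x).sub (hv.equation x))
    (by simpa using hu.decay.sub hv.decay) x
  exact sub_nonpos.1 h

lemma IsDecayingSolution.unique (hN : 1 ≤ N) (hs0 : 0 < s) (hs1 : s < 1) {u v : Space N → ℝ}
    (hu : IsDecayingSolution N s f u) (hv : IsDecayingSolution N s f v) : u = v :=
  funext fun x => le_antisymm (hu.le hN hs0 hs1 hv x) (hv.le hN hs0 hs1 hu x)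

end Solutions

end LogLaplacian

/-- Expansion of the decaying solution `Φ_s ∗ f` of `(-Δ)^s u = f` in powers of the order. -/
theorem mainTheorem6 (N : ℕ) (hN : 1 ≤ N) (α : ℝ≥0) (hα0 : 0 < α) (hα1 : α ≤ 1)
    (f : LogLaplacian.Space N → ℝ) (hf : LogLaplacian.HolderCompact N α f) :
    -- the Riesz potential is well defined and is the decaying solution
    (∀ s : ℝ, 0 < s → s < 1 → 2 * s < (N : ℝ) →
      ConvolutionExists (LogLaplacian.rieszKernel N s) f (ContinuousLinearMap.mul ℝ ℝ) volume ∧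
      LogLaplacian.IsDecayingSolution N s f (LogLaplacian.rieszPotential N s f) ∧
      ∀ v : LogLaplacian.Space N → ℝ, LogLaplacian.IsDecayingSolution N s f v →
        v = LogLaplacian.rieszPotential N s f) ∧
    -- the integrals in the logarithmic Laplacians of `f` converge absolutely
    (∀ m : ℕ, 1 ≤ m → ∀ x : LogLaplacian.Space N,
      Integrable (LogLaplacian.zeroOrderIntegrand N m f x) volume) ∧
    -- the expansion in `L^p`
    (∀ p : ℝ≥0∞, 1 < p →
      (∀ m : ℕ, 1 ≤ m → MemLp (LogLaplacian.logLaplacian N m f) p volume) ∧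
      ∀ n : ℕ, 1 ≤ n →
        LogLaplacian.IsLittleOInLp N p n (LogLaplacian.expansionRemainder N n f)) := by
  refine ⟨fun s hs0 hs1 hsN => ⟨?_, ?_, fun v hv => ?_⟩, fun m _ x => ?_, fun p hp =>
    ⟨fun m _ => ?_, fun n _ => ?_⟩⟩
  · exact LogLaplacian.convolutionExists_rieszKernel hN hα0 hf hs0
  · exact LogLaplacian.isDecayingSolution_rieszPotential hN hα0 hf hs0 hs1 hsN
  · exact hv.unique hN hs0 hs1
      (LogLaplacian.isDecayingSolution_rieszPotential hN hα0 hf hs0 hs1 hsN)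
  · exact LogLaplacian.integrable_zeroOrderIntegrand hN hα0 hf m x
  · exact LogLaplacian.memLp_logLaplacian hN hα0 hf hp m
  · exact LogLaplacian.isLittleOInLp_expansionRemainder hN hα0 hf hp n
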